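/- Let $(M,g)$ be a smooth Riemannian manifold of even dimension $d=2n$, possibly with boundary, let $A$ be a smooth $1$-form on $M$ and $B=\mathrm dA$. Let $\mathbf B(q):T_qM\to T_qM$ be the operator defined by $B_q(Q_1,Q_2)=g_q(\mathbf B(q)Q_1,Q_2)$, let $|\cdot|_{g_q^*}$ be the norm on $T_q^*M$ dual to $g_q$, and let $H(q,p)=|p-A(q)|^2_{g^*_q}$ on $T^*M$. Equip $T^*M$ with $\omega=\mathrm d\alpha$, where $\alpha=p\,\mathrm dq$ is the Liouville form. Write $w=(y,\eta)$ and $z=(x,\xi)$ for points of $\mathbf R^{n}\times\mathbf R^n=\mathbf R^{d}$, with the Euclidean norm, $|z_j|^2=x_j^2+\xi_j^2$, $\mathrm d\eta\wedge\mathrm dy=\sum_j\mathrm d\eta_j\wedge\mathrm dy_j$, $\mathrm d\xi\wedge\mathrm dx=\sum_j\mathrm d\xi_j\wedge\mathrm dx_j$, and $B_z(\varepsilon)=\{z\in\mathbf R^d:|z|\le\varepsilon\}$. Let $q_0\in M\setminus\partial M$ be such that $\mathbf B(q_0)$ is invertible and all its (complex) eigenvalues are simple. (This applies in particular when $q_0$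 is the unique non-degenerate minimum of the magnetic intensity $b(q)=\tfrac12\mathrm{Tr}\,[\mathbf B(q)^*\mathbf B(q)]^{1/2}$; no such global assumption is needed here.) Then there are an open neighbourhood $\Omega_0$ of $q_0$, with compact closure contained in $M\setminus\partial M$, smooth functions $\beta_1,\dots,\beta_n:\Omega_0\to(0,\infty)$ such that for every $q\in\Omega_0$ the eigenvalues of $\mathbf B(q)$ are simple and equal to $\pm i\beta_1(q),\dots,\pm i\beta_n(q)$, and $\varepsilon_0>0$, such that for every open neighbourhood $\Omega\subset\Omega_0$ of $q_0$ and every $\varepsilon\in(0,\varepsilon_0]$ there exist symplectomorphisms $$\varphi:(\Omega,B)\to(V,\mathrm d\eta\wedge\mathrm dy),\qquad \Phi:\bigl(V\times B_z(\varepsilon),\ \mathrm d\eta\wedge\mathrm dy+\mathrm d\xi\wedge\mathrm dx\bigr)\to(U,\omega),$$ with $V\subset\mathbf R^d$ open and $U=\Phi(V\times B_z(\varepsilon))\subset T^*M$, where $\Phi$ is the restriction of a symplectomorphism from an open neighbourhood of $V\times B_z(\varepsilon)$ onto an open subset of $T^*M$, such that $\Phi(\varphi(q),0)=(q,A(q))$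 for all $q\in\Omega$ and, with $\hat\beta_j=\beta_j\circ\varphi^{-1}$, $$H\circ\Phi(w,z)=\sum_{j=1}^{n}\hat\beta_j(w)|z_j|^2+\mathcal O(|z|^3)$$ locally uniformly in $w$: every $w_0\in V$ has a neighbourhood on which, for some constant $C$, the remainder is at most $C|z|^3$ for all $z\in B_z(\varepsilon)$. -/

import Mathlib

open Set Filter Topology Bundle
open scoped Manifold ContDiff

noncomputable section

namespace MagneticWell

section General

variable {E : Type*} [NormedAddCommGroup E] [NormedSpace ℝ E]
  {H : Type*} [TopologicalSpace H] (I : ModelWithCorners ℝ E H)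
  {M : Type*} [TopologicalSpace M] [ChartedSpace H M]
  {F : Type*} [NormedAddCommGroup F] [NormedSpace ℝ F]
  {G : Type*} [TopologicalSpace G] (J : ModelWithCorners ℝ F G)
  {N : Type*} [TopologicalSpace N] [ChartedSpace G N]

/-- The representation of a `1`-form `α` in the preferred chart at `c`, i.e. the pullback of `α`
by the inverse of that chart, a `1`-form on the model space. -/
def oneFormInChart (α : ∀ q : M, TangentSpace I q →L[ℝ] ℝ) (c : M) (x : E) : E →L[ℝ] ℝ :=
  (α ((extChartAt I c).symm x)).comp
    (mfderivWithin 𝓘(ℝ, E) I (extChartAt I c).symm (range I) x)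

/-- The exterior derivative of a `1`-form on a manifold,
`dα(X, Y) = (D_X a)(Y) - (D_Y a)(X)` where `a` represents `α` in the preferred chart at the point;
for a smooth form the result does not depend on the chart. -/
def extDerivOneForm (α : ∀ q : M, TangentSpace I q →L[ℝ] ℝ) (q : M) :
    TangentSpace I q →L[ℝ] TangentSpace I q →L[ℝ] ℝ :=
  let D : TangentSpace I q →L[ℝ] E := mfderiv I 𝓘(ℝ, E) (extChartAt I q) q
  let L : E →L[ℝ] E →L[ℝ] ℝ :=
    fderivWithin ℝ (oneFormInChart I α q) (range I) (extChartAt I q q)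
  (ContinuousLinearMap.precomp ℝ D).comp ((L - L.flip).comp D)

theorem extDerivOneForm_apply (α : ∀ q : M, TangentSpace I q →L[ℝ] ℝ) (q : M)
    (X Y : TangentSpace I q) :
    extDerivOneForm I α q X Y =
      fderivWithin ℝ (oneFormInChart I α q) (range I) (extChartAt I q q)
          (mfderiv I 𝓘(ℝ, E) (extChartAt I q) q X) (mfderiv I 𝓘(ℝ, E) (extChartAt I q) q Y)
        - fderivWithin ℝ (oneFormInChart I α q) (range I) (extChartAt I q q)
          (mfderiv I 𝓘(ℝ, E) (extChartAt I q) q Y) (mfderiv I 𝓘(ℝ, E) (extChartAt I q) q X) :=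
  rfl

/-- `f` pulls the `2`-form `τ` back to the `2`-form `σ` at every point of `S`. -/
def PullsBackOn (f : M → N) (S : Set M)
    (τ : ∀ y : N, TangentSpace J y → TangentSpace J y → ℝ)
    (σ : ∀ x : M, TangentSpace I x → TangentSpace I x → ℝ) : Prop :=
  ∀ x ∈ S, ∀ X Y : TangentSpace I x,
    τ (f x) (mfderiv I J f x X) (mfderiv I J f x Y) = σ x X Y

/-- `f`, an open partial homeomorphism, is a symplectomorphism of its (open) source, with the form
`σ`, onto its (open) target, with the form `τ`. -/
structure IsSymplectomorphism (f : OpenPartialHomeomorph M N)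
    (σ : ∀ x : M, TangentSpace I x → TangentSpace I x → ℝ)
    (τ : ∀ y : N, TangentSpace J y → TangentSpace J y → ℝ) : Prop where
  contMDiffOn : ContMDiffOn I J ∞ f f.source
  contMDiffOn_symm : ContMDiffOn J I ∞ f.symm f.target
  pullsBackOn : PullsBackOn I J f f.source τ σ

end General

section Cotangent

variable {E : Type*} [NormedAddCommGroup E] [NormedSpace ℝ E]
  {H : Type*} [TopologicalSpace H] (I : ModelWithCorners ℝ E H)
  (M : Type*) [TopologicalSpace M] [ChartedSpace H M]

/-- The cotangent bundle `T*M`. -/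
abbrev CotangentBundle [IsManifold I ∞ M] : Type _ :=
  TotalSpace (E →L[ℝ] ℝ) (fun q : M => TangentSpace I q →L[ℝ] Trivial M ℝ q)

variable [IsManifold I ∞ M]

/-- The Liouville form `p dq` on `T*M`: `V ↦ p (π_* V)` at the point `(q, p)`. -/
def liouvilleForm (ζ : CotangentBundle I M) :
    TangentSpace (I.prod 𝓘(ℝ, E →L[ℝ] ℝ)) ζ →L[ℝ] ℝ :=
  (ζ.2 : TangentSpace I ζ.1 →L[ℝ] ℝ).comp
    (mfderiv (I.prod 𝓘(ℝ, E →L[ℝ] ℝ)) I (fun ζ : CotangentBundle I M => ζ.1) ζ)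

/-- The canonical symplectic form `dp ∧ dq = d(p dq)` on `T*M`. -/
def canonicalForm (ζ : CotangentBundle I M)
    (X Y : TangentSpace (I.prod 𝓘(ℝ, E →L[ℝ] ℝ)) ζ) : ℝ :=
  extDerivOneForm (I.prod 𝓘(ℝ, E →L[ℝ] ℝ)) (liouvilleForm I M) ζ X Y

end Cotangent

section Magnetic

variable {E : Type*} [NormedAddCommGroup E] [NormedSpace ℝ E] [FiniteDimensional ℝ E]
  {H : Type*} [TopologicalSpace H] {I : ModelWithCorners ℝ E H}
  {M : Type*} [TopologicalSpace M] [ChartedSpace H M] [IsManifold I ∞ M]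

instance (q : M) : FiniteDimensional ℝ (TangentSpace I q) :=
  inferInstanceAs (FiniteDimensional ℝ E)

/-- Smooth Riemannian metrics on `M`. -/
abbrev RiemannianMetric (I : ModelWithCorners ℝ E H) (M : Type*) [TopologicalSpace M]
    [ChartedSpace H M] [IsManifold I ∞ M] : Type _ :=
  ContMDiffRiemannianMetric I ∞ E (fun q : M => TangentSpace I q)

/-- Smooth `1`-forms on `M`, i.e. smooth sections of `T*M`. -/
abbrev OneForm (I : ModelWithCorners ℝ E H) (M : Type*) [TopologicalSpace M]
    [ChartedSpace H M] [IsManifold I ∞ M] : Type _ :=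
  ContMDiffSection I (E →L[ℝ] ℝ) ∞ (fun q : M => TangentSpace I q →L[ℝ] Trivial M ℝ q)

variable (g : RiemannianMetric I M) (A : OneForm I M)

/-- The isomorphism `T*_q M → T_q M` given by the metric, inverse of `Q ↦ g_q(Q, ·)`. -/
def sharp (q : M) : (TangentSpace I q →L[ℝ] ℝ) →L[ℝ] TangentSpace I q :=
  (g.inner q).inverse

theorem isInvertible_inner (q : M) : (g.inner q).IsInvertible := by
  have hinj : Function.Injective (g.inner q).toLinearMap := by
    rw [← LinearMap.ker_eq_bot, LinearMap.ker_eq_bot']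
    intro v hv
    by_contra h
    have := g.pos q v h
    have h0 : g.inner q v = 0 := hv
    rw [h0] at this
    simp at this
  have hfin : Module.finrank ℝ (TangentSpace I q) =
      Module.finrank ℝ (TangentSpace I q →L[ℝ] ℝ) := by
    change Module.finrank ℝ E = Module.finrank ℝ (E →L[ℝ] ℝ)
    rw [← (LinearMap.toContinuousLinearMap (𝕜 := ℝ) (E := E) (F' := ℝ)).finrank_eq]
    exact Subspace.dual_finrank_eq.symm
  let e : E ≃ₗ[ℝ] (E →L[ℝ] ℝ) := LinearMap.linearEquivOfInjective
    (V := E) (V₂ := E →L[ℝ] ℝ) (g.inner q).toLinearMap hinj hfin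
  exact ⟨e.toContinuousLinearEquiv, by ext v w; rfl⟩

theorem inner_sharp (q : M) (p : TangentSpace I q →L[ℝ] ℝ) : g.inner q (sharp g q p) = p :=
  ((isInvertible_inner g q).inverse_apply_eq.mp rfl).symm

/-- The square of the norm on `T*_q M` dual to `g_q`, i.e. `g_q(p♯, p♯)`. -/
def dualNormSq (q : M) (p : TangentSpace I q →L[ℝ] ℝ) : ℝ :=
  g.inner q (sharp g q p) (sharp g q p)

/-- The magnetic `2`-form `B = dA`. -/
def magneticForm (q : M) : TangentSpace I q →L[ℝ] TangentSpace I q →L[ℝ] ℝ :=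
  extDerivOneForm I (fun q => A q) q

/-- The magnetic operator `𝐁(q) : T_q M → T_q M`. -/
def magneticOperator (q : M) : TangentSpace I q →L[ℝ] TangentSpace I q :=
  (sharp g q).comp (magneticForm A q)

/-- The defining relation of the magnetic operator: `B_q(X, Y) = g_q(𝐁(q) X, Y)`. -/
theorem magneticForm_eq_inner (q : M) (X Y : TangentSpace I q) :
    magneticForm A q X Y = g.inner q (magneticOperator g A q X) Y := by
  rw [magneticOperator, ContinuousLinearMap.comp_apply, inner_sharp]

/-- The complex eigenvalues of `𝐁(q)`, counted with multiplicity. -/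
def magneticEigenvalues (q : M) : Multiset ℂ :=
  ((magneticOperator g A q : TangentSpace I q →ₗ[ℝ] TangentSpace I q).charpoly.map
    (algebraMap ℝ ℂ)).roots

/-- The classical Hamiltonian `H(q, p) = |p - A(q)|²` on `T*M`. -/
def hamiltonian (ζ : CotangentBundle I M) : ℝ :=
  dualNormSq g ζ.1 (ζ.2 - A ζ.1)

end Magnetic

/-- `ℝ²ⁿ` with its Euclidean norm. A point `z = (x, ξ)` has `x_j = z (inl j)`, `ξ_j = z (inr j)`. -/
abbrev PhaseSpace (n : ℕ) : Type := EuclideanSpace ℝ (Fin n ⊕ Fin n)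

/-- The symplectic form `dξ ∧ dx = ∑_j dξ_j ∧ dx_j` on `ℝ²ⁿ`. -/
def stdForm (n : ℕ) (X Y : PhaseSpace n) : ℝ :=
  ∑ j : Fin n, (X (Sum.inr j) * Y (Sum.inl j) - Y (Sum.inr j) * X (Sum.inl j))

/-- The symplectic form `dη ∧ dy + dξ ∧ dx` on `ℝ²ⁿ × ℝ²ⁿ`. -/
def prodForm (n : ℕ) (X Y : PhaseSpace n × PhaseSpace n) : ℝ :=
  stdForm n X.1 Y.1 + stdForm n X.2 Y.2

/-- `|z_j|² = x_j² + ξ_j²`. -/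
def normSqAt {n : ℕ} (z : PhaseSpace n) (j : Fin n) : ℝ :=
  z (Sum.inl j) ^ 2 + z (Sum.inr j) ^ 2

end MagneticWell

end

/-!
In a chart at `q₀`, let `a` be the magnetic potential and `𝐁 x` the magnetic operator. As `𝐁 x` is
skew for the metric and its eigenvalues are simple, the implicit function theorem gives smooth
frequencies `β j` and a smooth frame in which `𝐁 x` rotates the `j`-th plane at speed `β j`.
Rescaled by the inverse square root of `β j`, this frame identifies `𝐁 x` with the standard
symplectic form.

Moser's method gives Darboux coordinates `w` for `da`. The graph of `a` is a symplectic submanifold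
of the cotangent bundle, and its symplectic normal bundle is framed by the vectors
`(Q, p)` with `Q` in the rescaled frame and `p` determined by orthogonality to the graph. Following
this frame in the directions of `z` gives a map of `(w, z)` whose pullback of the canonical form
agrees with the product form along `z = 0`, and a diffeomorphism tangent to the identity along
`z = 0` (the relative Darboux theorem) makes it symplectic near `z = 0`.

The Hamiltonian is the square of the norm of `p - a`, which vanishes on the graph and is linear in
`z` to first order, so a perturbation of second order in `z` changes the Hamiltonian only by
`O(|z|³)`. Its leading part is the squared norm of `𝐁 x Q`, where `Q` is the combination of the
frame vectors with coefficients `z`, and this is the sum of the `β j |z_j|²`.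
-/

noncomputable section

namespace MagneticWell

section Instances

variable {E F G K : Type*} [NormedAddCommGroup E] [NormedSpace ℝ E] [NormedAddCommGroup F]
  [NormedSpace ℝ F] [NormedAddCommGroup G] [NormedSpace ℝ G] [NormedAddCommGroup K]
  [NormedSpace ℝ K]

abbrev instNormedAddCommGroupLinear : NormedAddCommGroup (E →L[ℝ] F) :=
  ContinuousLinearMap.toNormedAddCommGroup

abbrev instNormedSpaceLinear : NormedSpace ℝ (E →L[ℝ] F) :=
  ContinuousLinearMap.toNormedSpace

abbrev instNormedAddCommGroupBilinear : NormedAddCommGroup (E →L[ℝ] F →L[ℝ] G) :=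
  ContinuousLinearMap.toNormedAddCommGroup

abbrev instNormedSpaceBilinear : NormedSpace ℝ (E →L[ℝ] F →L[ℝ] G) :=
  ContinuousLinearMap.toNormedSpace

abbrev instNormedAddCommGroupOfLinear : NormedAddCommGroup ((E →L[ℝ] F) →L[ℝ] G) :=
  ContinuousLinearMap.toNormedAddCommGroup

abbrev instNormedSpaceOfLinear : NormedSpace ℝ ((E →L[ℝ] F) →L[ℝ] G) :=
  ContinuousLinearMap.toNormedSpace

abbrev instNormedAddCommGroupProdLinearLinear : NormedAddCommGroup (E × (F →L[ℝ] G) →L[ℝ] K) :=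
  ContinuousLinearMap.toNormedAddCommGroup

abbrev instNormedSpaceProdLinearLinear : NormedSpace ℝ (E × (F →L[ℝ] G) →L[ℝ] K) :=
  ContinuousLinearMap.toNormedSpace

end Instances

-- On iterated spaces of continuous linear maps, the general instance search times out.
attribute [local instance] instNormedAddCommGroupLinear instNormedSpaceLinear
  instNormedAddCommGroupBilinear instNormedSpaceBilinear
  instNormedAddCommGroupOfLinear instNormedSpaceOfLinear
  instNormedAddCommGroupProdLinearLinear instNormedSpaceProdLinearLinear

section LinearMaps

variable {E F : Type*} [NormedAddCommGroup E] [NormedSpace ℝ E] [FiniteDimensional ℝ E]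
  [NormedAddCommGroup F] [NormedSpace ℝ F]

theorem isInvertible_of_injective [FiniteDimensional ℝ F]
    (hfin : Module.finrank ℝ E = Module.finrank ℝ F) {T : E →L[ℝ] F}
    (hT : Function.Injective T) : T.IsInvertible :=
  ⟨(LinearMap.linearEquivOfInjective T.toLinearMap hT hfin).toContinuousLinearEquiv, rfl⟩

theorem finrank_dual_eq : Module.finrank ℝ (E →L[ℝ] ℝ) = Module.finrank ℝ E := by
  rw [← (LinearMap.toContinuousLinearMap (𝕜 := ℝ) (E := E) (F' := ℝ)).finrank_eq]
  exact Subspace.dual_finrank_eq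

theorem isInvertible_of_pos {γ : E →L[ℝ] E →L[ℝ] ℝ} (h : ∀ X, X ≠ 0 → 0 < γ X X) :
    γ.IsInvertible := by
  refine isInvertible_of_injective finrank_dual_eq.symm ((injective_iff_map_eq_zero _).2 ?_)
  intro X hX
  by_contra hX₀
  exact (h X hX₀).ne' (by rw [hX, zero_apply])

end LinearMaps

section InverseFunction

variable {E F : Type*} [NormedAddCommGroup E] [NormedSpace ℝ E] [CompleteSpace E]
  [NormedAddCommGroup F] [NormedSpace ℝ F]

theorem isOpen_setOf_isInvertible : IsOpen {T : E →L[ℝ] F | T.IsInvertible} :=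
  ContinuousLinearEquiv.isOpen

/-- The inverse is smooth on the whole target: the source is shrunk so that the derivative stays
invertible on it. -/
theorem exists_contDiffOn_openPartialHomeomorph {n : WithTop ℕ∞} (hn : 1 ≤ n) {f : E → F}
    {U : Set E} (hU : IsOpen U) (hf : ContDiffOn ℝ n f U) {x : E} (hx : x ∈ U)
    (hfx : (fderiv ℝ f x).IsInvertible) :
    ∃ e : OpenPartialHomeomorph E F, x ∈ e.source ∧ e.source ⊆ U ∧ (e : E → F) = f ∧
      ContDiffOn ℝ n e e.source ∧ ContDiffOn ℝ n e.symm e.target := by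
  have hn₀ : n ≠ 0 := (zero_lt_one.trans_le hn).ne'
  have hfAt : ∀ y ∈ U, ContDiffAt ℝ n f y := fun y hy => hf.contDiffAt (hU.mem_nhds hy)
  obtain ⟨f', hf'⟩ := hfx
  have hfderiv : HasFDerivAt f (f' : E →L[ℝ] F) x :=
    hf' ▸ ((hfAt x hx).differentiableAt hn₀).hasFDerivAt
  let e₀ := (hfAt x hx).toOpenPartialHomeomorph f hfderiv hn₀
  let W := U ∩ fderiv ℝ f ⁻¹' {T | T.IsInvertible}
  have hW : IsOpen W :=
    (hf.continuousOn_fderiv_of_isOpen hU hn).isOpen_inter_preimage hU isOpen_setOf_isInvertible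
  refine ⟨e₀.restrOpen W hW,
    ⟨(hfAt x hx).mem_toOpenPartialHomeomorph_source hfderiv hn₀, hx, f', hf'⟩,
    fun y hy => hy.2.1, rfl, fun y hy => (hfAt y hy.2.1).contDiffWithinAt, fun y hy => ?_⟩
  have hmem := (e₀.restrOpen W hW).map_target hy
  obtain ⟨A, hA⟩ := hmem.2.2
  have hs := hfAt _ hmem.2.1
  refine (OpenPartialHomeomorph.contDiffAt_symm (f₀' := A) _ hy ?_ hs).contDiffWithinAt
  rw [hA]
  exact (hs.differentiableAt hn₀).hasFDerivAt

end InverseFunction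

/-! ### Smooth dependence of solutions of differential equations -/

section Postcomposition

section PointwiseApply

variable (K : Type*) [TopologicalSpace K] [CompactSpace K]
  (F G : Type*) [NormedAddCommGroup F] [NormedSpace ℝ F] [NormedAddCommGroup G] [NormedSpace ℝ G]

/-- Pointwise application of a continuous family of linear maps to a continuous family of
vectors; derivatives of superposition operators have this form. -/
def pointwiseApply : C(K, F →L[ℝ] G) →L[ℝ] C(K, F) →L[ℝ] C(K, G) :=
  LinearMap.mkContinuous₂
    (LinearMap.mk₂ ℝ (fun (A : C(K, F →L[ℝ] G)) (u : C(K, F)) =>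
        (⟨fun t => A t (u t), by fun_prop⟩ : C(K, G)))
      (fun A A' u => by ext; simp) (fun c A u => by ext; simp)
      (fun A u u' => by ext; simp) (fun c A u => by ext; simp)) 1
    (fun A u => by
      rw [ContinuousMap.norm_le _ (by positivity)]
      intro t
      rw [one_mul]
      exact ((A t).le_opNorm _).trans
        (mul_le_mul (A.norm_coe_le_norm t) (u.norm_coe_le_norm t) (norm_nonneg _) (norm_nonneg _)))

end PointwiseApply

variable {K : Type*} [TopologicalSpace K] [CompactSpace K]

theorem hasFDerivAt_postcomp {F G : Type*} [NormedAddCommGroup F] [NormedSpace ℝ F]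
    [NormedAddCommGroup G] [NormedSpace ℝ G] {f : C(F, G)} {f' : C(F, F →L[ℝ] G)}
    (hf : ∀ x, HasFDerivAt f (f' x) x) (γ : C(K, F)) :
    HasFDerivAt (fun γ : C(K, F) => f.comp γ) (pointwiseApply K F G (f'.comp γ)) γ := by
  rw [hasFDerivAt_iff_isLittleO_nhds_zero, Asymptotics.isLittleO_iff]
  intro c hc
  have hcont : Continuous (fun γ : C(K, F) => f'.comp γ) := ContinuousMap.continuous_postcomp f'
  obtain ⟨δ, hδ, hδ'⟩ := Metric.continuousAt_iff.1 (hcont.continuousAt (x := γ)) c hc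
  filter_upwards [Metric.ball_mem_nhds (0 : C(K, F)) hδ] with h hh
  rw [ContinuousMap.norm_le _ (by positivity)]
  intro t
  have hht : ‖h t‖ < δ := (h.norm_coe_le_norm t).trans_lt (by simpa using hh)
  -- `f'` is close to `f' (γ t)` near `γ t`, uniformly in `t`: compare `γ` with its translates.
  have hbound : ∀ y ∈ Metric.ball (γ t) δ, ‖f' y - f' (γ t)‖ ≤ c := fun y hy => by
    have hdist : dist (γ + ContinuousMap.const K (y - γ t)) γ < δ := by
      rw [dist_eq_norm, add_sub_cancel_left, ContinuousMap.norm_lt_iff _ hδ]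
      intro s
      simpa [dist_eq_norm] using hy
    simpa [dist_eq_norm] using ((ContinuousMap.dist_apply_le_dist t).trans_lt (hδ' hdist)).le
  have hmean : ‖f (γ t + h t) - f (γ t) - f' (γ t) (h t)‖ ≤ c * ‖h t‖ := by
    simpa using (convex_ball (γ t) δ).norm_image_sub_le_of_norm_hasFDerivWithin_le'
      (fun y _ => (hf y).hasFDerivWithinAt) hbound (Metric.mem_ball_self hδ)
      (y := γ t + h t) (by simpa using hht)
  exact hmean.trans (by gcongr; exact h.norm_coe_le_norm t)

universe u

variable {F G : Type u} [NormedAddCommGroup F] [NormedSpace ℝ F] [NormedAddCommGroup G]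
  [NormedSpace ℝ G]

theorem contDiff_postcomp {f : C(F, G)} (hf : ContDiff ℝ ∞ f) :
    ContDiff ℝ ∞ (fun γ : C(K, F) => f.comp γ) := by
  refine contDiff_infty.2 fun n => ?_
  induction n generalizing G with
  | zero => exact contDiff_zero.2 (ContinuousMap.continuous_postcomp f)
  | succ n ih =>
    have hf' : ContDiff ℝ ∞ (fderiv ℝ f) := hf.fderiv_right (by simp)
    let f' : C(F, F →L[ℝ] G) := ⟨fderiv ℝ f, hf'.continuous⟩
    exact contDiff_succ_iff_hasFDerivAt.2 ⟨fun γ => pointwiseApply K F G (f'.comp γ),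
      (pointwiseApply K F G).contDiff.comp (ih (f := f') hf'),
      hasFDerivAt_postcomp fun x => (hf.differentiable (by simp) x).hasFDerivAt⟩

end Postcomposition

section Curves

variable {F : Type*}

/-- The extension of a curve on the unit interval to the real line, constant on both sides. -/
abbrev extendCurve [TopologicalSpace F] (γ : C(unitInterval, F)) : ℝ → F :=
  IccExtend (zero_le_one' ℝ) γ

theorem extendCurve_coe [TopologicalSpace F] (γ : C(unitInterval, F)) (t : unitInterval) :
    extendCurve γ t = γ t :=
  IccExtend_val _ _ t

variable [NormedAddCommGroup F] [NormedSpace ℝ F]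

theorem eq_of_hasDerivWithinAt_zero {h : ℝ → F}
    (hh : ∀ t : unitInterval, HasDerivWithinAt h 0 (Icc 0 1) t) : h 1 = h 0 :=
  constant_of_derivWithin_zero (fun t ht => (hh ⟨t, ht⟩).differentiableWithinAt)
    (fun t ht => (hh ⟨t, Ico_subset_Icc_self ht⟩).derivWithin
      (uniqueDiffOn_Icc zero_lt_one t (Ico_subset_Icc_self ht))) 1 (right_mem_Icc.2 zero_le_one)

/-- Integration from `0`, as an operator on curves. -/
def primitiveCLM (F : Type*) [NormedAddCommGroup F] [NormedSpace ℝ F] :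
    C(unitInterval, F) →L[ℝ] C(unitInterval, F) :=
  have hcont (γ : C(unitInterval, F)) : Continuous (extendCurve γ) := γ.continuous.Icc_extend'
  LinearMap.mkContinuous
    { toFun := fun γ => ⟨fun t => ∫ s in (0 : ℝ)..t, extendCurve γ s,
        (intervalIntegral.continuous_primitive
          (fun a b => (hcont γ).intervalIntegrable a b) 0).comp continuous_subtype_val⟩
      map_add' := fun γ γ' => by
        ext t
        exact intervalIntegral.integral_add ((hcont γ).intervalIntegrable _ _)
          ((hcont γ').intervalIntegrable _ _)
      map_smul' := fun c γ => by
        ext t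
        exact intervalIntegral.integral_smul c _ } 1
    (fun γ => by
      rw [ContinuousMap.norm_le _ (by positivity)]
      intro t
      refine (intervalIntegral.norm_integral_le_of_norm_le_const (f := extendCurve γ) (C := ‖γ‖)
        fun s _ => γ.norm_coe_le_norm _).trans ?_
      rw [sub_zero, abs_of_nonneg t.2.1, one_mul]
      exact mul_le_of_le_one_right (norm_nonneg _) t.2.2)

theorem primitiveCLM_zero_right (γ : C(unitInterval, F)) : primitiveCLM F γ 0 = 0 :=
  intervalIntegral.integral_same

theorem hasDerivWithinAt_of_eq_add_primitiveCLM [CompleteSpace F] {γ δ : C(unitInterval, F)}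
    {x : F} (h : γ = ContinuousMap.const _ x + primitiveCLM F δ) (t : unitInterval) :
    HasDerivWithinAt (extendCurve γ) (δ t) (Icc 0 1) t := by
  have hint : HasDerivAt (fun t : ℝ => x + ∫ s in (0 : ℝ)..t, extendCurve δ s) (δ t) t := by
    rw [← extendCurve_coe δ]
    exact ((continuous_IccExtend_iff.2 δ.continuous).integral_hasStrictDerivAt
      0 (t : ℝ)).hasDerivAt.const_add x
  refine hint.hasDerivWithinAt.congr_of_mem (fun s hs => ?_) t.2
  rw [extendCurve, IccExtend_of_mem _ _ hs, h]
  rfl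

end Curves

section Flow

section Graph

variable {F : Type*} [NormedAddCommGroup F]

/-- The graph `t ↦ (t, γ t)` of a curve. -/
def graphCurve (γ : C(unitInterval, F)) : C(unitInterval, ℝ × F) :=
  ⟨fun t => (t, γ t), by fun_prop⟩

variable [NormedSpace ℝ F]

theorem graphCurve_eq_add (γ : C(unitInterval, F)) :
    graphCurve γ = graphCurve 0 +
      (ContinuousLinearMap.inr ℝ ℝ F).compLeftContinuous ℝ unitInterval γ := by
  ext t <;> simp [graphCurve]

theorem hasFDerivAt_graphCurve (γ : C(unitInterval, F)) :
    HasFDerivAt (graphCurve (F := F))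
      ((ContinuousLinearMap.inr ℝ ℝ F).compLeftContinuous ℝ unitInterval) γ :=
  ((ContinuousLinearMap.hasFDerivAt _).const_add _).congr_of_eventuallyEq
    (Eventually.of_forall graphCurve_eq_add)

theorem contDiff_graphCurve : ContDiff ℝ ∞ (graphCurve (F := F)) := by
  rw [funext graphCurve_eq_add]
  exact contDiff_const.add (ContinuousLinearMap.contDiff _)

end Graph

universe u

variable {F : Type u} [NormedAddCommGroup F] [NormedSpace ℝ F]

/-- The map whose value at `γ` is the constant `x` exactly when `γ' = f (t, γ)` and `γ 0 = x`:
the defect in Picard's integral equation with zero initial value. -/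
def picardDefect (f : C(ℝ × F, F)) (γ : C(unitInterval, F)) : C(unitInterval, F) :=
  γ - primitiveCLM F (f.comp (graphCurve γ))

/-- The derivative of `γ ↦ ∫₀ᵗ f (s, γ s) ds` at `γ`, where `f'` is the derivative of `f`. -/
def linearizedPicard (f' : C(ℝ × F, ℝ × F →L[ℝ] F)) (γ : C(unitInterval, F)) :
    C(unitInterval, F) →L[ℝ] C(unitInterval, F) :=
  (primitiveCLM F).comp ((pointwiseApply unitInterval (ℝ × F) F (f'.comp (graphCurve γ))).comp
    ((ContinuousLinearMap.inr ℝ ℝ F).compLeftContinuous ℝ unitInterval))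

theorem hasFDerivAt_picardDefect {f : C(ℝ × F, F)} {f' : C(ℝ × F, ℝ × F →L[ℝ] F)}
    (hf : ∀ p, HasFDerivAt f (f' p) p) (γ : C(unitInterval, F)) :
    HasFDerivAt (picardDefect f) (ContinuousLinearMap.id ℝ _ - linearizedPicard f' γ) γ :=
  (hasFDerivAt_id γ).sub ((primitiveCLM F).hasFDerivAt.comp γ
    ((hasFDerivAt_postcomp hf (graphCurve γ)).comp γ (hasFDerivAt_graphCurve γ)))

theorem contDiff_picardDefect {f : C(ℝ × F, F)} (hf : ContDiff ℝ ∞ f) :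
    ContDiff ℝ ∞ (picardDefect f) :=
  contDiff_id.sub ((primitiveCLM F).contDiff.comp
    ((contDiff_postcomp hf).comp contDiff_graphCurve))

theorem picardDefect_const {f : C(ℝ × F, F)} {x : F} (hx : ∀ t : unitInterval, f (t, x) = 0) :
    picardDefect f (ContinuousMap.const _ x) = ContinuousMap.const _ x := by
  have : f.comp (graphCurve (ContinuousMap.const _ x)) = 0 := ContinuousMap.ext hx
  rw [picardDefect, this, map_zero, sub_zero]

theorem linearizedPicard_const_eq_zero {f' : C(ℝ × F, ℝ × F →L[ℝ] F)} {x : F}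
    (hx : ∀ (t : unitInterval) v, f' (t, x) (0, v) = 0) :
    linearizedPicard f' (ContinuousMap.const _ x) = 0 := by
  ext δ : 1
  exact (congrArg (primitiveCLM F) (ContinuousMap.ext fun t => hx t (δ t))).trans (map_zero _)

/-- `Γ` is the flow of the differential equation `γ' = f (t, γ)` on `[0, 1]` for the initial
conditions in the open set `N`, the equation being encoded in integral form; equilibria do not
move. -/
structure IsSmoothFlowOn (f : C(ℝ × F, F)) (Γ : F → C(unitInterval, F)) (N : Set F) : Prop where
  isOpen : IsOpen N
  contDiffOn : ContDiffOn ℝ ∞ Γ N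
  picardDefect_eq : ∀ x ∈ N, picardDefect f (Γ x) = ContinuousMap.const _ x
  eq_const : ∀ x ∈ N, (∀ t : unitInterval, f (t, x) = 0) → Γ x = ContinuousMap.const _ x

namespace IsSmoothFlowOn

variable {f : C(ℝ × F, F)} {Γ : F → C(unitInterval, F)} {N : Set F} {x : F}

theorem eq_add_primitiveCLM (h : IsSmoothFlowOn f Γ N) (hx : x ∈ N) :
    Γ x = ContinuousMap.const _ x + primitiveCLM F (f.comp (graphCurve (Γ x))) :=
  sub_eq_iff_eq_add.1 (h.picardDefect_eq x hx)

theorem apply_zero (h : IsSmoothFlowOn f Γ N) (hx : x ∈ N) : Γ x 0 = x := by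
  rw [h.eq_add_primitiveCLM hx, ContinuousMap.add_apply, primitiveCLM_zero_right, add_zero,
    ContinuousMap.const_apply]

theorem hasFDerivAt (h : IsSmoothFlowOn f Γ N) (hx : x ∈ N) :
    HasFDerivAt Γ (fderiv ℝ Γ x) x :=
  ((h.contDiffOn.contDiffAt (h.isOpen.mem_nhds hx)).differentiableAt (by simp)).hasFDerivAt

theorem mono {N' : Set F} (h : IsSmoothFlowOn f Γ N) (hN' : IsOpen N') (hNN' : N' ⊆ N) :
    IsSmoothFlowOn f Γ N' where
  isOpen := hN'
  contDiffOn := h.contDiffOn.mono hNN'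
  picardDefect_eq x hx := h.picardDefect_eq x (hNN' hx)
  eq_const x hx := h.eq_const x (hNN' hx)

theorem hasFDerivAt_apply_one (h : IsSmoothFlowOn f Γ N) (hx : x ∈ N) :
    HasFDerivAt (fun y => Γ y 1) ((ContinuousMap.evalCLM ℝ 1).comp (fderiv ℝ Γ x)) x :=
  (ContinuousMap.evalCLM ℝ 1 : C(unitInterval, F) →L[ℝ] F).hasFDerivAt.comp x (h.hasFDerivAt hx)

theorem contDiffOn_apply_one (h : IsSmoothFlowOn f Γ N) :
    ContDiffOn ℝ ∞ (fun y => Γ y 1) N :=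
  (ContinuousMap.evalCLM ℝ 1 : C(unitInterval, F) →L[ℝ] F).contDiff.comp_contDiffOn h.contDiffOn

variable {f' : C(ℝ × F, ℝ × F →L[ℝ] F)}

theorem fderiv_eq_add_linearizedPicard (h : IsSmoothFlowOn f Γ N)
    (hf : ∀ p, HasFDerivAt f (f' p) p) (hx : x ∈ N) (v : F) :
    fderiv ℝ Γ x v = ContinuousMap.const _ v + linearizedPicard f' (Γ x) (fderiv ℝ Γ x v) := by
  have hcomp := (hasFDerivAt_picardDefect hf (Γ x)).comp x (h.hasFDerivAt hx)
  have hconst := (ContinuousLinearMap.const ℝ unitInterval (M := F)).hasFDerivAt (x := x)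
  have heq := hcomp.unique (hconst.congr_of_eventuallyEq <| by
    filter_upwards [h.isOpen.mem_nhds hx] with y hy using h.picardDefect_eq y hy)
  exact sub_eq_iff_eq_add.1 (DFunLike.congr_fun heq v)

theorem fderiv_apply_zero (h : IsSmoothFlowOn f Γ N) (hf : ∀ p, HasFDerivAt f (f' p) p)
    (hx : x ∈ N) (v : F) : fderiv ℝ Γ x v 0 = v := by
  rw [h.fderiv_eq_add_linearizedPicard hf hx, ContinuousMap.add_apply, ContinuousMap.const_apply]
  exact (congrArg (v + ·) (primitiveCLM_zero_right _)).trans (add_zero v)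

variable [CompleteSpace F]

theorem hasDerivWithinAt (h : IsSmoothFlowOn f Γ N) (hx : x ∈ N) (t : unitInterval) :
    HasDerivWithinAt (extendCurve (Γ x)) (f (t, Γ x t)) (Icc 0 1) t :=
  hasDerivWithinAt_of_eq_add_primitiveCLM (h.eq_add_primitiveCLM hx) t

theorem hasDerivWithinAt_fderiv (h : IsSmoothFlowOn f Γ N) (hf : ∀ p, HasFDerivAt f (f' p) p)
    (hx : x ∈ N) (v : F) (t : unitInterval) :
    HasDerivWithinAt (extendCurve (fderiv ℝ Γ x v)) (f' (t, Γ x t) (0, fderiv ℝ Γ x v t))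
      (Icc 0 1) t :=
  hasDerivWithinAt_of_eq_add_primitiveCLM (h.fderiv_eq_add_linearizedPicard hf hx v) t

end IsSmoothFlowOn

/-- At an equilibrium where `f (t, ·)` vanishes to second order, the derivative of the Picard
defect is the identity, so the inverse function theorem in the Banach space of curves solves the
equation for all nearby initial conditions, smoothly in the initial condition. -/
theorem exists_isSmoothFlowOn [CompleteSpace F] {f : C(ℝ × F, F)} (hf : ContDiff ℝ ∞ f) {p : F}
    (h₀ : ∀ t : unitInterval, f (t, p) = 0)
    (h₁ : ∀ (t : unitInterval) v, fderiv ℝ f (t, p) (0, v) = 0) :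
    ∃ N Γ, p ∈ N ∧ IsSmoothFlowOn f Γ N := by
  let f' : C(ℝ × F, ℝ × F →L[ℝ] F) := ⟨fderiv ℝ f, hf.continuous_fderiv (by simp)⟩
  let cst : F →L[ℝ] C(unitInterval, F) := ContinuousLinearMap.const ℝ unitInterval
  have hderiv : fderiv ℝ (picardDefect f) (cst p) = ContinuousLinearMap.id ℝ _ := by
    rw [(hasFDerivAt_picardDefect (f' := f')
      (fun q => (hf.differentiable (by simp) q).hasFDerivAt) (cst p)).fderiv]
    exact (congrArg _ (linearizedPicard_const_eq_zero h₁)).trans (sub_zero _)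
  obtain ⟨e, hpe, -, he, -, hes⟩ := exists_contDiffOn_openPartialHomeomorph (by simp) isOpen_univ
    (contDiff_picardDefect hf).contDiffOn (mem_univ (cst p))
    ⟨ContinuousLinearEquiv.refl ℝ _, hderiv.symm⟩
  have hfix : ∀ x, (∀ t : unitInterval, f (t, x) = 0) → e (cst x) = cst x := fun x hx => by
    rw [he]
    exact picardDefect_const hx
  refine ⟨cst ⁻¹' (e.target ∩ e.source), fun x => e.symm (cst x),
    ⟨hfix p h₀ ▸ e.map_source hpe, hpe⟩,
    (e.open_target.inter e.open_source).preimage cst.continuous,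
    hes.comp cst.contDiff.contDiffOn fun x hx => hx.1,
    fun x hx => he ▸ e.right_inv hx.1, fun x hx hfx => ?_⟩
  calc e.symm (cst x) = e.symm (e (cst x)) := by rw [hfix x hfx]
    _ = cst x := e.left_inv hx.2

theorem exists_isSmoothFlowOn_mem_ball [CompleteSpace F] {f : C(ℝ × F, F)} (hf : ContDiff ℝ ∞ f)
    {p : F} (h₀ : ∀ t : unitInterval, f (t, p) = 0)
    (h₁ : ∀ (t : unitInterval) v, fderiv ℝ f (t, p) (0, v) = 0) {r : ℝ} (hr : 0 < r) :
    ∃ N Γ, p ∈ N ∧ IsSmoothFlowOn f Γ N ∧ ∀ x ∈ N, ∀ t, Γ x t ∈ Metric.ball p r := by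
  obtain ⟨N, Γ, hpN, hΓ⟩ := exists_isSmoothFlowOn hf h₀ h₁
  refine ⟨N ∩ Γ ⁻¹' Metric.ball (ContinuousMap.const _ p) r, Γ, ⟨hpN, ?_⟩, hΓ.mono
    (hΓ.contDiffOn.continuousOn.isOpen_inter_preimage hΓ.isOpen Metric.isOpen_ball)
    inter_subset_left, fun x hx t => (ContinuousMap.dist_apply_le_dist t).trans_lt hx.2⟩
  rw [mem_preimage, hΓ.eq_const p hpN h₀]
  exact Metric.mem_ball_self hr

end Flow

/-! ### The Moser argument -/

theorem two_le_infty : (2 : WithTop ℕ∞) ≤ ∞ := WithTop.coe_le_coe.2 le_top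

section ExteriorDerivative

variable {F : Type*} [NormedAddCommGroup F] [NormedSpace ℝ F]

/-- Antisymmetrization of bilinear forms, without the factor `1/2`, as in the exterior derivative
of a `1`-form. -/
def altCLM (F : Type*) [NormedAddCommGroup F] [NormedSpace ℝ F] :
    (F →L[ℝ] F →L[ℝ] ℝ) →L[ℝ] (F →L[ℝ] F →L[ℝ] ℝ) :=
  ContinuousLinearMap.id ℝ _ -
    (ContinuousLinearMap.flipₗᵢ ℝ F F ℝ).toContinuousLinearEquiv.toContinuousLinearMap

@[simp]
theorem altCLM_apply (b : F →L[ℝ] F →L[ℝ] ℝ) (X Y : F) : altCLM F b X Y = b X Y - b Y X := rfl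

/-- The exterior derivative of a `1`-form on a vector space. -/
def dForm (θ : F → F →L[ℝ] ℝ) (x : F) : F →L[ℝ] F →L[ℝ] ℝ :=
  altCLM F (fderiv ℝ θ x)

variable {θ η : F → F →L[ℝ] ℝ} {x : F}

theorem dForm_apply (θ : F → F →L[ℝ] ℝ) (x X Y : F) :
    dForm θ x X Y = fderiv ℝ θ x X Y - fderiv ℝ θ x Y X := rfl

theorem dForm_swap (θ : F → F →L[ℝ] ℝ) (x X Y : F) : dForm θ x X Y = -dForm θ x Y X := by
  rw [dForm_apply, dForm_apply, neg_sub]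

theorem dForm_add (hθ : DifferentiableAt ℝ θ x) (hη : DifferentiableAt ℝ η x) :
    dForm (θ + η) x = dForm θ x + dForm η x := by
  rw [dForm, fderiv_add hθ hη, map_add]
  rfl

theorem dForm_sub (hθ : DifferentiableAt ℝ θ x) (hη : DifferentiableAt ℝ η x) :
    dForm (θ - η) x = dForm θ x - dForm η x := by
  rw [dForm, fderiv_sub hθ hη, map_sub]
  rfl

theorem dForm_fderiv_eq_zero {f : F → ℝ} (hf : ContDiffAt ℝ 2 f x) :
    dForm (fderiv ℝ f) x = 0 := by
  ext X Y
  rw [dForm_apply, hf.isSymmSndFDerivAt (by simp) X Y, sub_self]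
  rfl

theorem contDiffOn_dForm {U : Set F} (hU : IsOpen U) (hθ : ContDiffOn ℝ ∞ θ U) :
    ContDiffOn ℝ ∞ (dForm θ) U :=
  (altCLM F).contDiff.comp_contDiffOn (hθ.fderiv_of_isOpen hU (by simp))

theorem hasFDerivAt_dForm (hθ : ContDiffAt ℝ 2 θ x) :
    HasFDerivAt (dForm θ) (fderiv ℝ (dForm θ) x) x :=
  ((altCLM F).differentiableAt.comp x
    ((hθ.fderiv_right (m := 1) le_rfl).differentiableAt (by simp))).hasFDerivAt

theorem fderiv_dForm_apply (hθ : ContDiffAt ℝ 2 θ x) (X Y Z : F) :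
    fderiv ℝ (dForm θ) x X Y Z =
      fderiv ℝ (fderiv ℝ θ) x X Y Z - fderiv ℝ (fderiv ℝ θ) x X Z Y := by
  have hθ' := ((hθ.fderiv_right (m := 1) le_rfl).differentiableAt (by simp)).hasFDerivAt
  have h := (altCLM F).hasFDerivAt.comp x hθ'
  exact DFunLike.congr_fun (DFunLike.congr_fun (DFunLike.congr_fun h.fderiv X) Y) Z

theorem fderiv_dForm_cyclic (hθ : ContDiffAt ℝ 2 θ x) (X Y Z : F) :
    fderiv ℝ (dForm θ) x X Y Z + fderiv ℝ (dForm θ) x Y Z X + fderiv ℝ (dForm θ) x Z X Y = 0 := by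
  have hsymm (a b c : F) : fderiv ℝ (fderiv ℝ θ) x a b c = fderiv ℝ (fderiv ℝ θ) x b a c :=
    DFunLike.congr_fun (hθ.isSymmSndFDerivAt (by simp) a b) c
  simp only [fderiv_dForm_apply hθ]
  linear_combination hsymm X Y Z + hsymm Y Z X + hsymm Z X Y

end ExteriorDerivative

section MoserField

variable {F : Type*} [NormedAddCommGroup F] [NormedSpace ℝ F]

/-- The family `d (α + t σ)` of `2`-forms joining `dα` to `d (α + σ)`, as a function of `(t, y)`. -/
def moserForm (α σ : F → F →L[ℝ] ℝ) (p : ℝ × F) : F →L[ℝ] F →L[ℝ] ℝ :=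
  dForm α p.2 + p.1 • dForm σ p.2

/-- The time-dependent vector field `X` with `i_X d(α + t σ) = -σ` of Moser's method. Where
`d(α + t σ)` is degenerate it is `0`, the value of `ContinuousLinearMap.inverse` there. -/
def moserField (α σ : F → F →L[ℝ] ℝ) (p : ℝ × F) : F :=
  -(moserForm α σ p).inverse (σ p.2)

/-- The points of `ℝ × U` at which `d(α + t σ)` is nondegenerate. -/
def moserDomain (α σ : F → F →L[ℝ] ℝ) (U : Set F) : Set (ℝ × F) :=
  Prod.snd ⁻¹' U ∩ moserForm α σ ⁻¹' {T | T.IsInvertible}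

variable {α σ : F → F →L[ℝ] ℝ} {U : Set F} {p : ℝ × F}

theorem moserForm_apply (α σ : F → F →L[ℝ] ℝ) (p : ℝ × F) (u v : F) :
    moserForm α σ p u v = dForm α p.2 u v + p.1 * dForm σ p.2 u v := rfl

theorem moserForm_swap (α σ : F → F →L[ℝ] ℝ) (p : ℝ × F) (u v : F) :
    moserForm α σ p u v = -moserForm α σ p v u := by
  rw [moserForm_apply, moserForm_apply, dForm_swap α, dForm_swap σ]
  ring

theorem moserForm_moserField (hp : (moserForm α σ p).IsInvertible) :
    moserForm α σ p (moserField α σ p) = -σ p.2 := by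
  rw [moserField, map_neg, hp.self_apply_inverse]

theorem hasFDerivAt_moserForm {t : ℝ} {y : F} (hα : ContDiffAt ℝ 2 α y)
    (hσ : ContDiffAt ℝ 2 σ y) :
    HasFDerivAt (moserForm α σ) (fderiv ℝ (moserForm α σ) (t, y)) (t, y) := by
  have hderiv := ((hasFDerivAt_dForm hα).comp (t, y) (hasFDerivAt_snd (𝕜 := ℝ))).add
    ((hasFDerivAt_fst (𝕜 := ℝ) (p := (t, y))).smul
      ((hasFDerivAt_dForm hσ).comp (t, y) (hasFDerivAt_snd (𝕜 := ℝ))))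
  exact hderiv.differentiableAt.hasFDerivAt

theorem fderiv_moserForm_apply {t : ℝ} {y : F} (hα : ContDiffAt ℝ 2 α y)
    (hσ : ContDiffAt ℝ 2 σ y) (s : ℝ) (w u v : F) :
    fderiv ℝ (moserForm α σ) (t, y) (s, w) u v =
      fderiv ℝ (dForm α) y w u v + (t * fderiv ℝ (dForm σ) y w u v + s * dForm σ y u v) := by
  have hderiv := (((hasFDerivAt_dForm hα).comp (t, y) (hasFDerivAt_snd (𝕜 := ℝ))).add
    ((hasFDerivAt_fst (𝕜 := ℝ) (p := (t, y))).smul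
      ((hasFDerivAt_dForm hσ).comp (t, y) (hasFDerivAt_snd (𝕜 := ℝ))))).fderiv
  exact DFunLike.congr_fun (DFunLike.congr_fun (DFunLike.congr_fun hderiv (s, w)) u) v

/-- Moser's infinitesimal identity: the Lie derivative of `d(α + t σ)` along `X` is `-dσ`, by
Cartan's formula, and compensates its derivative in `t`. -/
theorem lieDerivative_moserForm_eq_zero {X : ℝ × F → F} {t : ℝ} {y : F} (hα : ContDiffAt ℝ 2 α y)
    (hσ : ContDiffAt ℝ 2 σ y) (hX : DifferentiableAt ℝ X (t, y))
    (hXσ : ∀ᶠ p in 𝓝 (t, y), moserForm α σ p (X p) = -σ p.2) (u v : F) :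
    fderiv ℝ (moserForm α σ) (t, y) (1, X (t, y)) u v
      + moserForm α σ (t, y) (fderiv ℝ X (t, y) (0, u)) v
      + moserForm α σ (t, y) u (fderiv ℝ X (t, y) (0, v)) = 0 := by
  have hσ' : HasFDerivAt (fun p : ℝ × F => -σ p.2)
      (-(fderiv ℝ σ y).comp (ContinuousLinearMap.snd ℝ ℝ F)) (t, y) :=
    ((hσ.differentiableAt (by simp)).hasFDerivAt.comp (t, y) hasFDerivAt_snd).neg
  have hderiv := (((hasFDerivAt_moserForm hα hσ).clm_apply hX.hasFDerivAt).congr_of_eventuallyEq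
    (hXσ.mono fun p hp => hp.symm)).unique hσ'
  have hcontract (a b : F) : moserForm α σ (t, y) (fderiv ℝ X (t, y) (0, a)) b
      + fderiv ℝ (moserForm α σ) (t, y) (0, a) (X (t, y)) b = -fderiv ℝ σ y a b :=
    DFunLike.congr_fun (DFunLike.congr_fun hderiv (0, a)) b
  have hswap (θ : F → F →L[ℝ] ℝ) (hθ : ContDiffAt ℝ 2 θ y) (a b c : F) :
      fderiv ℝ (dForm θ) y a b c = -fderiv ℝ (dForm θ) y a c b := by
    rw [fderiv_dForm_apply hθ, fderiv_dForm_apply hθ, neg_sub]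
  rw [moserForm_swap α σ (t, y) u]
  simp only [fderiv_moserForm_apply hα hσ] at hcontract ⊢
  rw [dForm_apply]
  linear_combination hcontract u v - hcontract v u
    + fderiv_dForm_cyclic hα (X (t, y)) u v + t * fderiv_dForm_cyclic hσ (X (t, y)) u v
    - hswap α hα u v (X (t, y)) - t * hswap σ hσ u v (X (t, y))

theorem contDiffOn_moserForm (hU : IsOpen U) (hα : ContDiffOn ℝ ∞ α U) (hσ : ContDiffOn ℝ ∞ σ U) :
    ContDiffOn ℝ ∞ (moserForm α σ) (Prod.snd ⁻¹' U) :=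
  ((contDiffOn_dForm hU hα).comp contDiff_snd.contDiffOn (mapsTo_preimage _ _)).add
    (contDiff_fst.contDiffOn.smul
      ((contDiffOn_dForm hU hσ).comp contDiff_snd.contDiffOn (mapsTo_preimage _ _)))

theorem hasFDerivAt_moserField_zero {t : ℝ} {y : F}
    (hC : DifferentiableAt ℝ (fun p => (moserForm α σ p).inverse) (t, y))
    (hσ : HasFDerivAt σ (0 : F →L[ℝ] F →L[ℝ] ℝ) y) (hσy : σ y = 0) :
    HasFDerivAt (moserField α σ) (0 : ℝ × F →L[ℝ] F) (t, y) := by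
  have hσ' : HasFDerivAt (fun p : ℝ × F => σ p.2) (0 : ℝ × F →L[ℝ] F →L[ℝ] ℝ) (t, y) :=
    (hσ.comp (t, y) (hasFDerivAt_snd (𝕜 := ℝ))).congr_fderiv (ContinuousLinearMap.zero_comp _)
  refine (hC.hasFDerivAt.clm_apply hσ').neg.congr_fderiv ?_
  ext q <;> simp [hσy]

variable [CompleteSpace F]

theorem isOpen_moserDomain (hU : IsOpen U) (hα : ContDiffOn ℝ ∞ α U) (hσ : ContDiffOn ℝ ∞ σ U) :
    IsOpen (moserDomain α σ U) :=
  (contDiffOn_moserForm hU hα hσ).continuousOn.isOpen_inter_preimage (hU.preimage continuous_snd)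
    isOpen_setOf_isInvertible

theorem contDiffAt_inverse_moserForm (hU : IsOpen U) (hα : ContDiffOn ℝ ∞ α U)
    (hσ : ContDiffOn ℝ ∞ σ U) (hp : p ∈ moserDomain α σ U) :
    ContDiffAt ℝ ∞ (fun p => (moserForm α σ p).inverse) p :=
  hp.2.contDiffAt_map_inverse.comp p ((contDiffOn_moserForm hU hα hσ).contDiffAt
    ((hU.preimage continuous_snd).mem_nhds hp.1))

theorem contDiffAt_moserField (hU : IsOpen U) (hα : ContDiffOn ℝ ∞ α U) (hσ : ContDiffOn ℝ ∞ σ U)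
    (hp : p ∈ moserDomain α σ U) : ContDiffAt ℝ ∞ (moserField α σ) p :=
  ((contDiffAt_inverse_moserForm hU hα hσ hp).clm_apply
    ((hσ.contDiffAt (hU.mem_nhds hp.1)).comp p contDiff_snd.contDiffAt)).neg

end MoserField

section Moser

theorem exists_contDiff_eventuallyEq_nhdsSet {E G : Type*} [NormedAddCommGroup E]
    [NormedSpace ℝ E] [FiniteDimensional ℝ E] [NormedAddCommGroup G] [NormedSpace ℝ G]
    {K O : Set E} (hK : IsCompact K) (hO : IsOpen O) (hKO : K ⊆ O) {X : E → G}
    (hX : ∀ p ∈ O, ContDiffAt ℝ ∞ X p) : ∃ f : E → G, ContDiff ℝ ∞ f ∧ f =ᶠ[𝓝ˢ K] X := by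
  obtain ⟨L, hL, hKL, hLO⟩ := exists_compact_between hK hO hKO
  obtain ⟨ρ, hρ1, hρ0, -⟩ := exists_contMDiffMap_one_nhds_of_subset_interior (n := ⊤) 𝓘(ℝ, E)
    hK.isClosed hKL
  refine ⟨fun p => ρ p • X p, contDiff_iff_contDiffAt.2 fun p => ?_,
    hρ1.mono fun p hp => by simp only [hp, one_smul]⟩
  by_cases hp : p ∈ L
  · exact ρ.contMDiff.contDiff.contDiffAt.smul (hX p (hLO hp))
  · refine contDiffAt_const (c := (0 : G)) |>.congr_of_eventuallyEq ?_
    filter_upwards [hL.isClosed.isOpen_compl.mem_nhds hp] with q hq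
    rw [hρ0 q hq, zero_smul]

universe u

variable {F : Type u} [NormedAddCommGroup F] [NormedSpace ℝ F] {α σ : F → F →L[ℝ] ℝ} {U : Set F}

theorem exists_contDiff_eq_moserField [FiniteDimensional ℝ F] (hU : IsOpen U)
    (hα : ContDiffOn ℝ ∞ α U) (hσ : ContDiffOn ℝ ∞ σ U) {p : F}
    (hp : ∀ t : unitInterval, (↑t, p) ∈ moserDomain α σ U) :
    ∃ (f : C(ℝ × F, F)) (r : ℝ), ContDiff ℝ ∞ f ∧ 0 < r ∧
      ∀ (t : unitInterval), ∀ y ∈ Metric.ball p r,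
        (↑t, y) ∈ moserDomain α σ U ∧ f =ᶠ[𝓝 (↑t, y)] moserField α σ := by
  have : CompleteSpace F := FiniteDimensional.complete ℝ F
  have hO := isOpen_moserDomain hU hα hσ
  obtain ⟨f, hf, hfX⟩ := exists_contDiff_eventuallyEq_nhdsSet
    (isCompact_Icc.prod isCompact_singleton) hO
    (by rintro ⟨t, y⟩ ⟨ht, rfl⟩; exact hp ⟨t, ht⟩) fun q hq => contDiffAt_moserField hU hα hσ hq
  obtain ⟨W, hW, hKW, hWf⟩ := eventually_nhdsSet_iff_exists.1
    (hfX.and (hO.mem_nhdsSet.2 (by rintro ⟨t, y⟩ ⟨ht, rfl⟩; exact hp ⟨t, ht⟩)))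
  obtain ⟨u, v, -, hv, hu, hpv, huv⟩ := generalized_tube_lemma isCompact_Icc
    isCompact_singleton hW hKW
  obtain ⟨r, hr, hrv⟩ := Metric.isOpen_iff.1 hv p (hpv rfl)
  have hmem (t : unitInterval) (y) (hy : y ∈ Metric.ball p r) : ((t : ℝ), y) ∈ W :=
    huv ⟨hu t.2, hrv hy⟩
  exact ⟨⟨f, hf.continuous⟩, r, hf, hr, fun t y hy => ⟨(hWf _ (hmem t y hy)).2,
    Filter.mem_of_superset (hW.mem_nhds (hmem t y hy)) fun q hq => (hWf q hq).1⟩⟩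

section Flow

variable [CompleteSpace F] {f : C(ℝ × F, F)} {Γ : F → C(unitInterval, F)} {N : Set F} {x : F}

theorem IsSmoothFlowOn.dForm_apply_one (hΓ : IsSmoothFlowOn f Γ N) (hf : ContDiff ℝ ∞ f)
    (hU : IsOpen U) (hα : ContDiffOn ℝ ∞ α U) (hσ : ContDiffOn ℝ ∞ σ U) (hx : x ∈ N)
    (hfX : ∀ t : unitInterval, (↑t, Γ x t) ∈ moserDomain α σ U ∧
      f =ᶠ[𝓝 (↑t, Γ x t)] moserField α σ) (u v : F) :
    dForm (α + σ) (Γ x 1) (fderiv ℝ Γ x u 1) (fderiv ℝ Γ x v 1) = dForm α x u v := by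
  let f' : C(ℝ × F, ℝ × F →L[ℝ] F) := ⟨fderiv ℝ f, hf.continuous_fderiv (by simp)⟩
  have hff' : ∀ q, HasFDerivAt f (f' q) q := fun q => (hf.differentiable (by simp) q).hasFDerivAt
  let h : ℝ → ℝ := fun t => moserForm α σ (t, extendCurve (Γ x) t)
    (extendCurve (fderiv ℝ Γ x u) t) (extendCurve (fderiv ℝ Γ x v) t)
  have hh (t : unitInterval) : HasDerivWithinAt h 0 (Icc 0 1) t := by
    obtain ⟨hO, heq⟩ := hfX t
    have hα' := (hα.contDiffAt (hU.mem_nhds hO.1)).of_le two_le_infty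
    have hσ' := (hσ.contDiffAt (hU.mem_nhds hO.1)).of_le two_le_infty
    have hzero := lieDerivative_moserForm_eq_zero hα' hσ'
      (contDiffAt_moserField hU hα hσ hO |>.differentiableAt (by simp))
      (by filter_upwards [(isOpen_moserDomain hU hα hσ).mem_nhds hO] with q hq using
        moserForm_moserField hq.2) (fderiv ℝ Γ x u t) (fderiv ℝ Γ x v t)
    have hcurve := (hasDerivWithinAt_id (t : ℝ) (Icc 0 1)).prodMk (hΓ.hasDerivWithinAt hx t)
    have hform : HasFDerivAt (moserForm α σ) (fderiv ℝ (moserForm α σ) (t, Γ x t))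
        (t, extendCurve (Γ x) t) := by
      rw [extendCurve_coe]
      exact hasFDerivAt_moserForm hα' hσ'
    have hderiv := ((hform.comp_hasDerivWithinAt_of_eq (t : ℝ) hcurve rfl).clm_apply
      (hΓ.hasDerivWithinAt_fderiv hff' hx u t)).clm_apply
      (hΓ.hasDerivWithinAt_fderiv hff' hx v t)
    refine hderiv.congr_deriv ?_
    rw [← heq.fderiv_eq, ← heq.eq_of_nhds] at hzero
    simpa [f', extendCurve_coe] using hzero
  obtain ⟨hO, -⟩ := hfX 1
  have h01 : moserForm α σ (1, Γ x 1) (fderiv ℝ Γ x u 1) (fderiv ℝ Γ x v 1) =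
      moserForm α σ (0, x) u v := by
    have h1 (γ : C(unitInterval, F)) : extendCurve γ 1 = γ 1 := extendCurve_coe γ 1
    have h0 (γ : C(unitInterval, F)) : extendCurve γ 0 = γ 0 := extendCurve_coe γ 0
    simpa only [h, h1, h0, hΓ.apply_zero hx, hΓ.fderiv_apply_zero hff' hx] using
      eq_of_hasDerivWithinAt_zero hh
  rw [dForm_add ((hα.contDiffAt (hU.mem_nhds hO.1)).differentiableAt (by simp))
    ((hσ.contDiffAt (hU.mem_nhds hO.1)).differentiableAt (by simp))]
  simpa [moserForm_apply] using h01

theorem IsSmoothFlowOn.fderiv_apply_one_eq_id (hΓ : IsSmoothFlowOn f Γ N) (hf : ContDiff ℝ ∞ f)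
    (hx : x ∈ N) (h₀ : ∀ t : unitInterval, f (t, x) = 0)
    (h₁ : ∀ t : unitInterval, fderiv ℝ f (t, x) = 0) :
    fderiv ℝ (fun x => Γ x 1) x = ContinuousLinearMap.id ℝ F := by
  let f' : C(ℝ × F, ℝ × F →L[ℝ] F) := ⟨fderiv ℝ f, hf.continuous_fderiv (by simp)⟩
  have hff' : ∀ q, HasFDerivAt f (f' q) q := fun q => (hf.differentiable (by simp) q).hasFDerivAt
  rw [(hΓ.hasFDerivAt_apply_one hx).fderiv]
  ext v
  have hconst := eq_of_hasDerivWithinAt_zero fun t => by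
    have hderiv := hΓ.hasDerivWithinAt_fderiv hff' hx v t
    rw [hΓ.eq_const x hx h₀] at hderiv
    exact hderiv.congr_deriv (DFunLike.congr_fun (h₁ t) _)
  calc fderiv ℝ Γ x v 1 = fderiv ℝ Γ x v 0 :=
        (extendCurve_coe _ 1).symm.trans (hconst.trans (extendCurve_coe _ 0))
    _ = v := hΓ.fderiv_apply_zero hff' hx v

end Flow

theorem mem_moserDomain_of_dForm_eq_zero {p : F} (hp : p ∈ U) (hαp : (dForm α p).IsInvertible)
    (hσp : dForm σ p = 0) (t : ℝ) : (t, p) ∈ moserDomain α σ U :=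
  ⟨hp, by
    have : moserForm α σ (t, p) = dForm α p := by
      ext u v
      simp [moserForm_apply, hσp]
    rwa [mem_preimage, this]⟩

/-- **Moser's trick**: the diffeomorphism is the time-one map of the flow of the Moser field. -/
theorem exists_moser [FiniteDimensional ℝ F] {S : Set F} (hU : IsOpen U)
    (hα : ContDiffOn ℝ ∞ α U) (hσ : ContDiffOn ℝ ∞ σ U)
    (hS : ∀ p ∈ S, p ∈ U → σ p = 0 ∧ fderiv ℝ σ p = 0) {p₀ : F} (hp₀S : p₀ ∈ S) (hp₀ : p₀ ∈ U)
    (hnondeg : (dForm α p₀).IsInvertible) :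
    ∃ e : OpenPartialHomeomorph F F, p₀ ∈ e.source ∧ e.source ⊆ U ∧ e.target ⊆ U ∧
      ContDiffOn ℝ ∞ e e.source ∧ ContDiffOn ℝ ∞ e.symm e.target ∧
      (∀ x ∈ e.source, ∀ X Y, dForm (α + σ) (e x) (fderiv ℝ e x X) (fderiv ℝ e x Y) =
        dForm α x X Y) ∧
      ∀ p ∈ S, p ∈ e.source → e p = p ∧ fderiv ℝ e p = ContinuousLinearMap.id ℝ F := by
  have : CompleteSpace F := FiniteDimensional.complete ℝ F
  obtain ⟨f, r, hf, hr, hfX⟩ := exists_contDiff_eq_moserField hU hα hσ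
    fun t : unitInterval => mem_moserDomain_of_dForm_eq_zero hp₀ hnondeg
      (by rw [dForm, (hS p₀ hp₀S hp₀).2, map_zero]) t
  have hfS (p) (hp : p ∈ S) (hpr : p ∈ Metric.ball p₀ r) (t : unitInterval) :
      f (t, p) = 0 ∧ fderiv ℝ f (t, p) = 0 := by
    obtain ⟨hO, heq⟩ := hfX t p hpr
    obtain ⟨hσp, hσp'⟩ := hS p hp hO.1
    refine ⟨by rw [heq.eq_of_nhds, moserField, hσp, map_zero, neg_zero], ?_⟩
    rw [heq.fderiv_eq]
    exact (hasFDerivAt_moserField_zero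
      ((contDiffAt_inverse_moserForm hU hα hσ hO).differentiableAt (by simp))
      (hσp' ▸ ((hσ.contDiffAt (hU.mem_nhds hO.1)).differentiableAt (by simp)).hasFDerivAt)
      hσp).fderiv
  have hp₀r := Metric.mem_ball_self (x := p₀) hr
  obtain ⟨N, Γ, hp₀N, hΓ, hball⟩ := exists_isSmoothFlowOn_mem_ball hf
    (fun t => (hfS p₀ hp₀S hp₀r t).1) (fun t v => by rw [(hfS p₀ hp₀S hp₀r t).2]; rfl) hr
  have hstart (x) (hx : x ∈ N) : x ∈ Metric.ball p₀ r := by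
    simpa only [hΓ.apply_zero hx] using hball x hx 0
  have hid (p) (hp : p ∈ S) (hpN : p ∈ N) :=
    hΓ.fderiv_apply_one_eq_id hf hpN (fun t => (hfS p hp (hstart p hpN) t).1)
      fun t => (hfS p hp (hstart p hpN) t).2
  obtain ⟨e, hpe, heN, he, hes, hes'⟩ := exists_contDiffOn_openPartialHomeomorph (n := ∞) (by simp)
    hΓ.isOpen hΓ.contDiffOn_apply_one hp₀N
    ⟨ContinuousLinearEquiv.refl ℝ F, (hid p₀ hp₀S hp₀N).symm⟩
  have hmem (x) (hx : x ∈ e.source) : e x ∈ U := he ▸ (hfX 1 _ (hball x (heN hx) 1)).1.1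
  refine ⟨e, hpe, fun x hx => (hfX 0 _ (hstart x (heN hx))).1.1,
    fun y hy => e.right_inv hy ▸ hmem _ (e.map_target hy), hes, hes', fun x hx X Y => ?_,
    fun p hp hpe => ?_⟩
  · rw [he, (hΓ.hasFDerivAt_apply_one (heN hx)).fderiv]
    exact hΓ.dForm_apply_one hf hU hα hσ (heN hx) (fun t => hfX t _ (hball x (heN hx) t)) X Y
  · rw [he]
    refine ⟨?_, hid p hp (heN hpe)⟩
    exact DFunLike.congr_fun
      (hΓ.eq_const p (heN hpe) fun t => (hfS p hp (hstart p (heN hpe)) t).1) 1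

end Moser

/-! ### The relative Darboux theorem -/

section SecondOrder

variable {E G : Type*} [NormedAddCommGroup E] [NormedSpace ℝ E] [NormedAddCommGroup G]
  [NormedSpace ℝ G] {R : E →L[ℝ] G} {p : E}

theorem fderiv_apply_const {θ : E → G →L[ℝ] ℝ} (hθ : DifferentiableAt ℝ θ p) (u : E) (v : G) :
    fderiv ℝ (fun y => θ y v) p u = fderiv ℝ θ p u v := by
  rw [(hθ.hasFDerivAt.clm_apply (hasFDerivAt_const v p)).fderiv]
  simp

theorem hasFDerivAt_clm_apply_of_eq_zero {c : E → G →L[ℝ] ℝ} (hc : DifferentiableAt ℝ c p)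
    (hp : R p = 0) : HasFDerivAt (fun x => c x (R x)) ((c p).comp R) p := by
  refine (hc.hasFDerivAt.clm_apply R.hasFDerivAt).congr_fderiv ?_
  ext u
  simp [hp]

theorem fderiv_bilin_apply_self {b : E → G →L[ℝ] G →L[ℝ] ℝ} (hb : DifferentiableAt ℝ b p)
    (v : E) : fderiv ℝ (fun x => b x (R x) (R x)) p v =
      (fderiv ℝ b p v (R p) + b p (R v) + (b p).flip (R v)) (R p) := by
  rw [((hb.hasFDerivAt.clm_apply R.hasFDerivAt).clm_apply R.hasFDerivAt).fderiv]
  simp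
  ring

theorem fderiv_fderiv_bilin_apply_self {b : E → G →L[ℝ] G →L[ℝ] ℝ} (hb : ContDiffAt ℝ 2 b p)
    (hp : R p = 0) (u v : E) : fderiv ℝ (fderiv ℝ fun x => b x (R x) (R x)) p u v =
      b p (R u) (R v) + b p (R v) (R u) := by
  have hf : ContDiffAt ℝ 2 (fun x => b x (R x) (R x)) p :=
    (hb.clm_apply R.contDiff.contDiffAt).clm_apply R.contDiff.contDiffAt
  rw [← fderiv_apply_const ((hf.fderiv_right (m := 1) le_rfl).differentiableAt (by simp))]
  have hev : (fun y => fderiv ℝ (fun x => b x (R x) (R x)) y v) =ᶠ[𝓝 p] fun y =>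
      (fderiv ℝ b y v (R y) + b y (R v) + (b y).flip (R v)) (R y) :=
    (hb.eventually (by simp)).mono fun y hy =>
      fderiv_bilin_apply_self (hy.differentiableAt (by simp)) v
  have hb' : DifferentiableAt ℝ b p := hb.differentiableAt (by simp)
  have hc : DifferentiableAt ℝ
      (fun y => fderiv ℝ b y v (R y) + b y (R v) + (b y).flip (R v)) p :=
    (((((hb.fderiv_right (m := 1) le_rfl).differentiableAt (by simp)).clm_apply
      (differentiableAt_const v)).clm_apply R.differentiableAt).add
      (hb'.clm_apply (differentiableAt_const _))).add
      (((ContinuousLinearMap.flipₗᵢ ℝ G G ℝ).differentiable _).comp p hb' |>.clm_apply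
        (differentiableAt_const _))
  rw [hev.fderiv_eq, (hasFDerivAt_clm_apply_of_eq_zero hc hp).fderiv]
  simp [hp, add_comm]

end SecondOrder

section RelativeDarboux

universe u

variable {F : Type u} [NormedAddCommGroup F] [NormedSpace ℝ F] {P : F →L[ℝ] F} {U : Set F}
  {θ : F → F →L[ℝ] ℝ}

/-- The pullback of `θ` by the projection is closed. -/
theorem exists_fderiv_eq_comp_projection (hP : ∀ x, P (P x) = P x) (hU : IsOpen U)
    (hconv : Convex ℝ U) (hPU : MapsTo P U U) (hθ : ContDiffOn ℝ ∞ θ U)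
    (hd : ∀ p ∈ U, P p = p → dForm θ p = 0) :
    ∃ f : F → ℝ, ContDiffOn ℝ ∞ f U ∧ ∀ x ∈ U, fderiv ℝ f x = (θ (P x)).comp P := by
  have hη : ContDiffOn ℝ ∞ (fun x => (θ (P x)).comp P) U :=
    (hθ.comp P.contDiff.contDiffOn hPU).clm_comp contDiffOn_const
  have hηd (x) (hx : x ∈ U) (u v : F) :
      fderiv ℝ (fun x => (θ (P x)).comp P) x u v = fderiv ℝ θ (P x) (P u) (P v) := by
    have hθd := ((hθ.contDiffAt (hU.mem_nhds (hPU hx))).differentiableAt (by simp)).hasFDerivAt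
    have hderiv := ((hθd.comp x P.hasFDerivAt).clm_comp (hasFDerivAt_const P x)).fderiv
    refine (DFunLike.congr_fun (DFunLike.congr_fun hderiv u) v).trans ?_
    simp
  obtain ⟨f, hf⟩ := hconv.exists_forall_hasFDerivAt_of_fderiv_symmetric hU
    (hη.differentiableOn (by simp)) fun x hx u v => by
      rw [hηd x hx, hηd x hx, ← sub_eq_zero, ← dForm_apply, hd _ (hPU hx) (hP x)]
      rfl
  refine ⟨f, ?_, fun x hx => (hf x hx).fderiv⟩
  rw [contDiffOn_infty_iff_fderiv_of_isOpen hU]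
  exact ⟨fun x hx => (hf x hx).differentiableAt.differentiableWithinAt,
    hη.congr fun x hx => (hf x hx).fderiv⟩

theorem exists_fderiv_eq_of_projection_eq (hP : ∀ x, P (P x) = P x) (hU : IsOpen U)
    (hconv : Convex ℝ U) (hPU : MapsTo P U U) (hθ : ContDiffOn ℝ ∞ θ U)
    (hd : ∀ p ∈ U, P p = p → dForm θ p = 0) :
    ∃ f : F → ℝ, ContDiffOn ℝ ∞ f U ∧ ∀ p ∈ U, P p = p → fderiv ℝ f p = θ p := by
  obtain ⟨f, hf, hf'⟩ := exists_fderiv_eq_comp_projection hP hU hconv hPU hθ hd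
  let R := ContinuousLinearMap.id ℝ F - P
  have hθP : ContDiffOn ℝ ∞ (fun x => θ (P x)) U := hθ.comp P.contDiff.contDiffOn hPU
  refine ⟨fun x => f x + θ (P x) (R x), hf.add (hθP.clm_apply R.contDiff.contDiffOn),
    fun p hp hPp => ?_⟩
  have hRp : R p = 0 := sub_eq_zero.2 hPp.symm
  have hderiv := ((hf.contDiffAt (hU.mem_nhds hp)).differentiableAt (by simp)).hasFDerivAt.add
    (hasFDerivAt_clm_apply_of_eq_zero
      ((hθP.contDiffAt (hU.mem_nhds hp)).differentiableAt (by simp)) hRp)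
  refine hderiv.fderiv.trans ?_
  ext v
  simp [hf' p hp, hPp, R]

theorem exists_fderiv_fderiv_eq_of_projection_eq (hP : ∀ x, P (P x) = P x) (hU : IsOpen U)
    (hPU : MapsTo P U U) (hθ : ContDiffOn ℝ ∞ θ U) (hθ₀ : ∀ p ∈ U, P p = p → θ p = 0)
    (hd : ∀ p ∈ U, P p = p → dForm θ p = 0) :
    ∃ f : F → ℝ, ContDiffOn ℝ ∞ f U ∧
      ∀ p ∈ U, P p = p → fderiv ℝ f p = 0 ∧ fderiv ℝ (fderiv ℝ f) p = fderiv ℝ θ p := by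
  let R := ContinuousLinearMap.id ℝ F - P
  let b := fun x => (1 / 2 : ℝ) • fderiv ℝ θ (P x)
  have hb : ContDiffOn ℝ ∞ b U :=
    ((hθ.fderiv_of_isOpen hU (by simp)).comp P.contDiff.contDiffOn hPU).const_smul _
  refine ⟨fun x => b x (R x) (R x),
    (hb.clm_apply R.contDiff.contDiffOn).clm_apply R.contDiff.contDiffOn, fun p hp hPp => ?_⟩
  have hRp : R p = 0 := sub_eq_zero.2 hPp.symm
  have hbp := hb.contDiffAt (hU.mem_nhds hp)
  have hsymm (u v : F) : fderiv ℝ θ p u v = fderiv ℝ θ p v u := by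
    rw [← sub_eq_zero, ← dForm_apply, hd p hp hPp]
    rfl
  have hrange (u v : F) : fderiv ℝ θ p (P u) v = 0 := by
    have hθP : (fun x => θ (P x)) =ᶠ[𝓝 p] fun _ => 0 := by
      filter_upwards [hU.mem_nhds hp] with x hx using hθ₀ _ (hPU hx) (hP x)
    have hθd := ((hθ.contDiffAt (hU.mem_nhds (hPU hp))).differentiableAt (by simp)).hasFDerivAt
    have hzero := (hθd.comp p P.hasFDerivAt).unique
      ((hasFDerivAt_const (0 : F →L[ℝ] ℝ) p).congr_of_eventuallyEq hθP)
    rw [← hPp]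
    exact DFunLike.congr_fun (DFunLike.congr_fun hzero u) v
  constructor
  · ext v
    rw [fderiv_bilin_apply_self (hbp.differentiableAt (by simp)), hRp, map_zero]
    rfl
  · ext u v
    rw [fderiv_fderiv_bilin_apply_self (hbp.of_le two_le_infty) hRp]
    simp [b, R, hPp, hrange, hsymm _ (P _), hsymm v u]
    ring

theorem dForm_sub_fderiv {f : F → ℝ} {x : F} (hθ : DifferentiableAt ℝ θ x)
    (hf : ContDiffAt ℝ ∞ f x) : dForm (θ - fderiv ℝ f) x = dForm θ x := by
  rw [dForm_sub hθ ((hf.fderiv_right (m := ∞) (by simp)).differentiableAt (by simp)),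
    dForm_fderiv_eq_zero (hf.of_le two_le_infty), sub_zero]

/-- Three successive corrections by exact forms: the pullback of `θ` by the projection, the rest of
`θ` along the range, and the first derivative of what remains. -/
theorem exists_dForm_eq_vanishing_on_range (hP : ∀ x, P (P x) = P x) (hU : IsOpen U)
    (hθ : ContDiffOn ℝ ∞ θ U) {p₀ : F} (hp₀ : p₀ ∈ U) (hPp₀ : P p₀ = p₀)
    (hd : ∀ p ∈ U, P p = p → dForm θ p = 0) :
    ∃ (U' : Set F) (σ : F → F →L[ℝ] ℝ), IsOpen U' ∧ U' ⊆ U ∧ p₀ ∈ U' ∧ ContDiffOn ℝ ∞ σ U' ∧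
      (∀ x ∈ U', dForm σ x = dForm θ x) ∧
      ∀ p ∈ U', P p = p → σ p = 0 ∧ fderiv ℝ σ p = 0 := by
  obtain ⟨r, hr, hrU⟩ := Metric.isOpen_iff.1 hU p₀ hp₀
  let U' := Metric.ball p₀ r ∩ P ⁻¹' Metric.ball p₀ r
  have hU' : IsOpen U' := Metric.isOpen_ball.inter (Metric.isOpen_ball.preimage P.continuous)
  have hU'U : U' ⊆ U := inter_subset_left.trans hrU
  have hconv : Convex ℝ U' := (convex_ball p₀ r).inter
    ((convex_ball p₀ r).is_linear_preimage P.isBoundedLinearMap.toIsLinearMap)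
  have hPU' : MapsTo P U' U' := fun x hx => ⟨hx.2, by rw [mem_preimage, hP]; exact hx.2⟩
  have hθ' := hθ.mono hU'U
  obtain ⟨f, hf, hf₀⟩ := exists_fderiv_eq_of_projection_eq hP hU' hconv hPU' hθ'
    fun p hp => hd p (hU'U hp)
  have hσ : ContDiffOn ℝ ∞ (θ - fderiv ℝ f) U' := hθ'.sub (hf.fderiv_of_isOpen hU' (by simp))
  have hσd (x) (hx : x ∈ U') : dForm (θ - fderiv ℝ f) x = dForm θ x :=
    dForm_sub_fderiv ((hθ'.contDiffAt (hU'.mem_nhds hx)).differentiableAt (by simp))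
      (hf.contDiffAt (hU'.mem_nhds hx))
  have hσ₀ (p) (hp : p ∈ U') (hPp : P p = p) : (θ - fderiv ℝ f) p = 0 :=
    sub_eq_zero.2 (hf₀ p hp hPp).symm
  obtain ⟨g, hg, hg₀⟩ := exists_fderiv_fderiv_eq_of_projection_eq hP hU' hPU' hσ hσ₀
    fun p hp hPp => (hσd p hp).trans (hd p (hU'U hp) hPp)
  have hσdiff (x) (hx : x ∈ U') : DifferentiableAt ℝ (θ - fderiv ℝ f) x :=
    (hσ.contDiffAt (hU'.mem_nhds hx)).differentiableAt (by simp)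
  have hg' : ContDiffOn ℝ ∞ (fderiv ℝ g) U' := hg.fderiv_of_isOpen hU' (by simp)
  refine ⟨U', θ - fderiv ℝ f - fderiv ℝ g, hU', hU'U,
    ⟨Metric.mem_ball_self hr, by rw [mem_preimage, hPp₀]; exact Metric.mem_ball_self hr⟩,
    hσ.sub hg', fun x hx => ?_, fun p hp hPp => ⟨?_, ?_⟩⟩
  · rw [dForm_sub_fderiv (hσdiff x hx) (hg.contDiffAt (hU'.mem_nhds hx)), hσd x hx]
  · rw [Pi.sub_apply, hσ₀ p hp hPp, (hg₀ p hp hPp).1, sub_zero]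
  · rw [fderiv_sub (hσdiff p hp)
      ((hg'.contDiffAt (hU'.mem_nhds hp)).differentiableAt (by simp)), (hg₀ p hp hPp).2, sub_self]

theorem exists_relative_darboux [FiniteDimensional ℝ F] (hP : ∀ x, P (P x) = P x)
    (hU : IsOpen U) {α₀ α₁ : F → F →L[ℝ] ℝ} (hα₀ : ContDiffOn ℝ ∞ α₀ U)
    (hα₁ : ContDiffOn ℝ ∞ α₁ U) {p₀ : F} (hp₀ : p₀ ∈ U) (hPp₀ : P p₀ = p₀)
    (hd : ∀ p ∈ U, P p = p → dForm α₁ p = dForm α₀ p) (hnd : (dForm α₀ p₀).IsInvertible) :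
    ∃ e : OpenPartialHomeomorph F F, p₀ ∈ e.source ∧ e.source ⊆ U ∧ e.target ⊆ U ∧
      ContDiffOn ℝ ∞ e e.source ∧ ContDiffOn ℝ ∞ e.symm e.target ∧
      (∀ x ∈ e.source, ∀ X Y, dForm α₁ (e x) (fderiv ℝ e x X) (fderiv ℝ e x Y) =
        dForm α₀ x X Y) ∧
      ∀ p ∈ e.source, P p = p → e p = p ∧ fderiv ℝ e p = ContinuousLinearMap.id ℝ F := by
  have hdiff {η : F → F →L[ℝ] ℝ} {V : Set F} (hV : IsOpen V) (hη : ContDiffOn ℝ ∞ η V) {x : F}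
      (hx : x ∈ V) : DifferentiableAt ℝ η x :=
    (hη.contDiffAt (hV.mem_nhds hx)).differentiableAt (by simp)
  have hsub (x) (hx : x ∈ U) : dForm (α₁ - α₀) x = dForm α₁ x - dForm α₀ x :=
    dForm_sub (hdiff hU hα₁ hx) (hdiff hU hα₀ hx)
  obtain ⟨U', σ, hU', hU'U, hpU', hσ, hdσ, hσP⟩ := exists_dForm_eq_vanishing_on_range
    (θ := α₁ - α₀) hP hU (hα₁.sub hα₀) hp₀ hPp₀ fun p hp hPp => by
      rw [hsub p hp, hd p hp hPp, sub_self]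
  obtain ⟨e, hpe, hesource, hetarget, he, he', hpull, hfix⟩ := exists_moser hU' (hα₀.mono hU'U) hσ
    (S := {p | P p = p}) (fun p hp hpU => hσP p hpU hp) hPp₀ hpU' hnd
  refine ⟨e, hpe, hesource.trans hU'U, hetarget.trans hU'U, he, he', fun x hx X Y => ?_,
    fun p hp hPp => hfix p hPp hp⟩
  have hex : e x ∈ U' := hetarget (e.map_source hx)
  have hform : dForm (α₀ + σ) (e x) = dForm α₁ (e x) := by
    rw [dForm_add (hdiff hU hα₀ (hU'U hex)) (hdiff hU' hσ hex), hdσ _ hex, hsub _ (hU'U hex),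
      add_sub_cancel]
  rw [← hpull x hx, hform]

end RelativeDarboux

/-! ### Simple eigenvalues of skew operators -/

section Eigenvalues

variable {ι : Type*} [Fintype ι]

open Matrix

theorem re_map_ofReal_mulVec (M : Matrix ι ι ℝ) (w : ι → ℂ) (i : ι) :
    ((M.map (algebraMap ℝ ℂ) *ᵥ w) i).re = (M *ᵥ fun j => (w j).re) i := by
  simp [mulVec, dotProduct]

theorem im_map_ofReal_mulVec (M : Matrix ι ι ℝ) (w : ι → ℂ) (i : ι) :
    ((M.map (algebraMap ℝ ℂ) *ᵥ w) i).im = (M *ᵥ fun j => (w j).im) i := by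
  simp [mulVec, dotProduct]

theorem scalar_sub_map_ofReal_mulVec_eq_zero_iff [DecidableEq ι] (M : Matrix ι ι ℝ) (c : ℂ)
    (u v : ι → ℝ) :
    (scalar ι c - M.map (algebraMap ℝ ℂ)) *ᵥ (fun j => (⟨u j, v j⟩ : ℂ)) = 0 ↔
      M *ᵥ u = c.re • u - c.im • v ∧ M *ᵥ v = c.re • v + c.im • u := by
  simp only [sub_mulVec, sub_eq_zero, funext_iff, ← forall_and]
  refine forall_congr' fun i => ?_
  rw [Complex.ext_iff, re_map_ofReal_mulVec, im_map_ofReal_mulVec]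
  simp [mulVec_diagonal, eq_comm]

variable {E : Type*} [AddCommGroup E] [Module ℝ E] [FiniteDimensional ℝ E]

/-- A real operator has the eigenvalue `c` if and only if it has a complex eigenvector `u + i v`,
which is written here without complexifying `E`. -/
theorem mem_roots_charpoly_iff (T : E →ₗ[ℝ] E) (c : ℂ) :
    c ∈ (T.charpoly.map (algebraMap ℝ ℂ)).roots ↔
      ∃ u v : E, (u ≠ 0 ∨ v ≠ 0) ∧ T u = c.re • u - c.im • v ∧ T v = c.re • v + c.im • u := by
  let b := Module.finBasis ℝ E
  let M := LinearMap.toMatrix b b T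
  let w : E → E → Fin (Module.finrank ℝ E) → ℂ := fun u v j => ⟨b.equivFun u j, b.equivFun v j⟩
  have hM : ∀ x : E, M *ᵥ b.equivFun x = b.equivFun (T x) := LinearMap.toMatrix_mulVec_repr b b T
  have hw : ∀ u v, w u v ≠ 0 ↔ u ≠ 0 ∨ v ≠ 0 := fun u v => by
    rw [← not_and_or, ← b.equivFun.map_eq_zero_iff, ← b.equivFun.map_eq_zero_iff (x := v)]
    simp only [w, ne_eq, funext_iff, Pi.zero_apply, Complex.ext_iff, Complex.zero_re,
      Complex.zero_im, forall_and]
  have heigen : ∀ u v, (scalar _ c - M.map (algebraMap ℝ ℂ)) *ᵥ w u v = 0 ↔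
      T u = c.re • u - c.im • v ∧ T v = c.re • v + c.im • u := fun u v => by
    simp only [w, scalar_sub_map_ofReal_mulVec_eq_zero_iff, hM, ← map_smul, ← map_sub, ← map_add,
      b.equivFun.injective.eq_iff]
  have hsurj : ∀ z, ∃ u v, w u v = z := fun z =>
    ⟨b.equivFun.symm fun j => (z j).re, b.equivFun.symm fun j => (z j).im, by
      simp only [w, LinearEquiv.apply_symm_apply, Complex.eta]⟩
  rw [Polynomial.mem_roots (T.charpoly_monic.map _).ne_zero, Polynomial.IsRoot.def,
    ← LinearMap.charpoly_toMatrix T b, ← Matrix.charpoly_map, Matrix.eval_charpoly,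
    ← Matrix.exists_mulVec_eq_zero_iff]
  constructor
  · rintro ⟨z, hz, hcz⟩
    obtain ⟨u, v, rfl⟩ := hsurj z
    exact ⟨u, v, (hw u v).1 hz, (heigen u v).1 hcz⟩
  · rintro ⟨u, v, huv, hT⟩
    exact ⟨w u v, (hw u v).2 huv, (heigen u v).2 hT⟩

theorem card_roots_charpoly (T : E →ₗ[ℝ] E) :
    Multiset.card (T.charpoly.map (algebraMap ℝ ℂ)).roots = Module.finrank ℝ E := by
  rw [IsAlgClosed.card_roots_eq_natDegree, (T.charpoly_monic).natDegree_map,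
    LinearMap.charpoly_natDegree]

theorem conj_mem_roots_charpoly {T : E →ₗ[ℝ] E} {c : ℂ}
    (hc : c ∈ (T.charpoly.map (algebraMap ℝ ℂ)).roots) :
    (starRingEnd ℂ) c ∈ (T.charpoly.map (algebraMap ℝ ℂ)).roots := by
  have hne := T.charpoly_monic.ne_zero
  rw [Polynomial.mem_roots_map hne, ← Polynomial.aeval_def] at hc ⊢
  rw [Polynomial.aeval_conj, hc, map_zero]

theorem card_eq_two_mul_card_filter_im_pos {S : Finset ℂ} (hconj : ∀ c ∈ S, (starRingEnd ℂ) c ∈ S)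
    (him : ∀ c ∈ S, c.im ≠ 0) : S.card = 2 * (S.filter fun c => 0 < c.im).card := by
  have hneg : (S.filter fun c => ¬ 0 < c.im).card = (S.filter fun c => 0 < c.im).card := by
    refine Finset.card_bij' (fun c _ => (starRingEnd ℂ) c) (fun c _ => (starRingEnd ℂ) c)
      (fun c hc => ?_) (fun c hc => ?_) (fun c _ => by simp) (fun c _ => by simp)
    · rw [Finset.mem_filter, not_lt] at hc
      refine Finset.mem_filter.2 ⟨hconj c hc.1, ?_⟩
      rw [Complex.conj_im, neg_pos]
      exact hc.2.lt_of_ne (him c hc.1)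
    · rw [Finset.mem_filter] at hc
      refine Finset.mem_filter.2 ⟨hconj c hc.1, ?_⟩
      rw [Complex.conj_im, neg_pos]
      exact hc.2.not_gt
  have hsum := S.card_filter_add_card_filter_not fun c => 0 < c.im
  rw [hneg] at hsum
  rw [← hsum, two_mul]

end Eigenvalues

section SkewOperators

variable {E : Type*} [NormedAddCommGroup E] [NormedSpace ℝ E]

/-- `g` is an inner product for which `T` is skew-symmetric. -/
structure IsSkew (g : E →L[ℝ] E →L[ℝ] ℝ) (T : E →L[ℝ] E) : Prop where
  symm : ∀ X Y, g X Y = g Y X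
  pos : ∀ X, X ≠ 0 → 0 < g X X
  skew : ∀ X Y, g (T X) Y = -g X (T Y)

/-- `T` acts on the span of `u` and `v` as the rotation generator with frequency `b`; equivalently
`u + i v` is a complex eigenvector of `T` for the eigenvalue `i b`. -/
structure IsRotationPair (T : E →L[ℝ] E) (b : ℝ) (u v : E) : Prop where
  left : T u = -(b • v)
  right : T v = b • u

variable {g : E →L[ℝ] E →L[ℝ] ℝ} {T : E →L[ℝ] E}

namespace IsSkew

theorem eq_zero_of_self (h : IsSkew g T) {x : E} (hx : g x x = 0) : x = 0 := by
  by_contra hne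
  exact (h.pos x hne).ne' hx

theorem nonneg (h : IsSkew g T) (x : E) : 0 ≤ g x x := by
  rcases eq_or_ne x 0 with rfl | hx
  · simp
  · exact (h.pos x hx).le

theorem apply_self_eq_zero (h : IsSkew g T) (x : E) : g (T x) x = 0 := by
  have := h.skew x x
  rw [h.symm x (T x)] at this
  linarith

theorem re_eq_zero (h : IsSkew g T) {a b : ℝ} {u v : E} (huv : u ≠ 0 ∨ v ≠ 0)
    (hu : T u = a • u - b • v) (hv : T v = a • v + b • u) : a = 0 := by
  have hTu := h.apply_self_eq_zero u
  have hTv := h.apply_self_eq_zero v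
  rw [hu] at hTu
  rw [hv] at hTv
  simp only [map_sub, map_add, map_smul, sub_apply, add_apply, smul_apply, smul_eq_mul] at hTu hTv
  have hzero : a * (g u u + g v v) = 0 := by
    rw [h.symm v u] at hTu
    linear_combination hTu + hTv
  have hpos : 0 < g u u + g v v := by
    rcases huv with hu | hv
    · exact add_pos_of_pos_of_nonneg (h.pos u hu) (h.nonneg v)
    · exact add_pos_of_nonneg_of_pos (h.nonneg u) (h.pos v hv)
  exact (mul_eq_zero.1 hzero).resolve_right hpos.ne'

theorem eq_zero_of_orthogonal [FiniteDimensional ℝ E] (h : IsSkew g T) {ι : Type*} [Fintype ι]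
    (hι : Fintype.card ι = Module.finrank ℝ E) {w : ι → E} (hw : ∀ i, w i ≠ 0)
    (ho : ∀ i j, i ≠ j → g (w i) (w j) = 0) {x : E} (hx : ∀ i, g x (w i) = 0) : x = 0 := by
  have hli : LinearIndependent ℝ w :=
    LinearMap.linearIndependent_of_isOrthoᵢ (B := g.toBilinForm) (fun i j hij => ho i j hij)
      fun i => (h.pos _ (hw i)).ne'
  have hspan := hli.span_eq_top_of_card_eq_finrank' hι
  have hle : Submodule.span ℝ (range w) ≤ LinearMap.ker (g x : E →ₗ[ℝ] ℝ) :=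
    Submodule.span_le.2 (range_subset_iff.2 hx)
  exact h.eq_zero_of_self (hle (hspan ▸ Submodule.mem_top))

end IsSkew

namespace IsRotationPair

variable {b : ℝ} {u v : E}

theorem inner_eq_zero (hp : IsRotationPair T b u v) (h : IsSkew g T) (hb : b ≠ 0) : g u v = 0 := by
  have hTu := h.apply_self_eq_zero u
  rw [hp.left] at hTu
  simp only [map_neg, map_smul, neg_apply, smul_apply, smul_eq_mul, neg_eq_zero] at hTu
  exact (h.symm u v).trans ((mul_eq_zero.1 hTu).resolve_left hb)

theorem inner_self_eq (hp : IsRotationPair T b u v) (h : IsSkew g T) (hb : b ≠ 0) :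
    g u u = g v v := by
  have huv := h.skew u v
  rw [hp.left, hp.right] at huv
  simp only [map_neg, map_smul, neg_apply, smul_apply, smul_eq_mul] at huv
  exact mul_left_cancel₀ hb (by linarith)

theorem right_ne_zero (hp : IsRotationPair T b u v) (h : IsSkew g T) (hb : b ≠ 0) (hu : u ≠ 0) :
    v ≠ 0 := by
  rintro rfl
  exact hu (h.eq_zero_of_self ((hp.inner_self_eq h hb).trans (map_zero _)))

theorem smul (hp : IsRotationPair T b u v) (c : ℝ) : IsRotationPair T b (c • u) (c • v) :=
  ⟨by rw [map_smul, hp.left, smul_neg, smul_comm], by rw [map_smul, hp.right, smul_comm]⟩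

theorem orthogonal (hp : IsRotationPair T b u v) (h : IsSkew g T) {b' : ℝ} {u' v' : E}
    (hp' : IsRotationPair T b' u' v') (hb : b ^ 2 ≠ b' ^ 2) :
    g u u' = 0 ∧ g u v' = 0 ∧ g v u' = 0 ∧ g v v' = 0 := by
  have huu := h.skew u u'
  have huv := h.skew u v'
  have hvu := h.skew v u'
  have hvv := h.skew v v'
  rw [hp.left, hp'.left] at huu
  rw [hp.left, hp'.right] at huv
  rw [hp.right, hp'.left] at hvu
  rw [hp.right, hp'.right] at hvv
  simp only [map_neg, map_smul, neg_apply, smul_apply, smul_eq_mul] at huu huv hvu hvv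
  have hcancel : ∀ r : ℝ, (b ^ 2 - b' ^ 2) * r = 0 → r = 0 := fun r hr =>
    (mul_eq_zero.1 hr).resolve_left (sub_ne_zero.2 hb)
  refine ⟨hcancel _ ?_, hcancel _ ?_, hcancel _ ?_, hcancel _ ?_⟩
  · linear_combination b * hvu - b' * huv
  · linear_combination b * hvv + b' * huu
  · linear_combination -b * huu - b' * hvv
  · linear_combination -b * huv + b' * hvu

end IsRotationPair

/-- A full system of complex eigenvectors `u j + i v j`, for pairwise different eigenvalues `i b j`
in the upper half plane. -/
structure IsRotationSystem {ι : Type*} (T : E →L[ℝ] E) (b : ι → ℝ) (u v : ι → E) : Prop where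
  injective : Function.Injective b
  pos : ∀ j, 0 < b j
  ne_zero : ∀ j, u j ≠ 0
  pair : ∀ j, IsRotationPair T (b j) (u j) (v j)

namespace IsRotationSystem

variable {ι : Type*} {b : ι → ℝ} {u v : ι → E}

theorem sq_ne_sq (hp : IsRotationSystem T b u v) {i j : ι} (hij : i ≠ j) : b i ^ 2 ≠ b j ^ 2 :=
  fun hb => hij (hp.injective ((sq_eq_sq₀ (hp.pos i).le (hp.pos j).le).1 hb))

theorem smul (hp : IsRotationSystem T b u v) {c : ι → ℝ} (hc : ∀ j, c j ≠ 0) :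
    IsRotationSystem T b (fun j => c j • u j) (fun j => c j • v j) :=
  ⟨hp.injective, hp.pos, fun j => smul_ne_zero (hc j) (hp.ne_zero j), fun j => (hp.pair j).smul _⟩

theorem eq_zero_of_orthogonal [Fintype ι] [FiniteDimensional ℝ E] (hp : IsRotationSystem T b u v)
    (h : IsSkew g T) (hι : Module.finrank ℝ E = 2 * Fintype.card ι) {x : E}
    (hu : ∀ j, g x (u j) = 0) (hv : ∀ j, g x (v j) = 0) : x = 0 := by
  have huv : ∀ i j, g (u i) (v j) = 0 := fun i j => by
    rcases eq_or_ne i j with rfl | hij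
    · exact (hp.pair i).inner_eq_zero h (hp.pos i).ne'
    · exact ((hp.pair i).orthogonal h (hp.pair j) (hp.sq_ne_sq hij)).2.1
  refine h.eq_zero_of_orthogonal (w := Sum.elim u v) (by simp [hι, two_mul]) ?_ ?_ ?_
  · rintro (j | j)
    · exact hp.ne_zero j
    · exact (hp.pair j).right_ne_zero h (hp.pos j).ne' (hp.ne_zero j)
  · rintro (i | i) (j | j) hij
    · exact ((hp.pair i).orthogonal h (hp.pair j) (hp.sq_ne_sq (by simpa using hij))).1
    · exact huv i j
    · exact (h.symm _ _).trans (huv j i)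
    · exact ((hp.pair i).orthogonal h (hp.pair j) (hp.sq_ne_sq (by simpa using hij))).2.2.2
  · exact Sum.rec hu hv

end IsRotationSystem

variable [FiniteDimensional ℝ E]

theorem IsSkew.re_eq_zero_of_mem_roots (h : IsSkew g T) {c : ℂ}
    (hc : c ∈ ((T : E →ₗ[ℝ] E).charpoly.map (algebraMap ℝ ℂ)).roots) : c.re = 0 := by
  obtain ⟨u, v, huv, hu, hv⟩ := (mem_roots_charpoly_iff _ c).1 hc
  exact h.re_eq_zero huv hu hv

theorem IsSkew.im_ne_zero_of_mem_roots (h : IsSkew g T) (hT : Function.Injective T) {c : ℂ}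
    (hc : c ∈ ((T : E →ₗ[ℝ] E).charpoly.map (algebraMap ℝ ℂ)).roots) : c.im ≠ 0 := by
  intro him
  obtain ⟨u, v, huv, hu, hv⟩ := (mem_roots_charpoly_iff _ c).1 hc
  simp only [h.re_eq_zero_of_mem_roots hc, him, zero_smul, sub_zero, add_zero] at hu hv
  exact huv.elim (fun hne => hne (hT (hu.trans (map_zero T).symm)))
    fun hne => hne (hT (hv.trans (map_zero T).symm))

theorem IsSkew.exists_isRotationPair (h : IsSkew g T) {c : ℂ}
    (hc : c ∈ ((T : E →ₗ[ℝ] E).charpoly.map (algebraMap ℝ ℂ)).roots) (him : c.im ≠ 0) :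
    ∃ u v : E, u ≠ 0 ∧ IsRotationPair T c.im u v := by
  obtain ⟨u, v, huv, hu, hv⟩ := (mem_roots_charpoly_iff _ c).1 hc
  simp only [h.re_eq_zero_of_mem_roots hc, zero_smul, zero_sub, zero_add] at hu hv
  have hp : IsRotationPair T c.im u v := ⟨hu, hv⟩
  refine ⟨u, v, ?_, hp⟩
  rintro rfl
  have hv₀ : g v v = 0 := (hp.inner_self_eq h him).symm.trans (map_zero _)
  exact huv.elim (fun hne => hne rfl) fun hne => hne (h.eq_zero_of_self hv₀)

theorem IsSkew.exists_isRotationSystem (h : IsSkew g T) {n : ℕ}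
    (hn : Module.finrank ℝ E = 2 * n) (hT : Function.Injective T)
    (hs : ((T : E →ₗ[ℝ] E).charpoly.map (algebraMap ℝ ℂ)).roots.Nodup) :
    ∃ (b : Fin n → ℝ) (u v : Fin n → E), IsRotationSystem T b u v := by
  let S : Finset ℂ := ⟨((T : E →ₗ[ℝ] E).charpoly.map (algebraMap ℝ ℂ)).roots, hs⟩
  have hcard : (S.filter fun c => 0 < c.im).card = n := by
    have hS : S.card = 2 * n := (card_roots_charpoly (T : E →ₗ[ℝ] E)).trans hn
    have := card_eq_two_mul_card_filter_im_pos (S := S) (fun c hc => conj_mem_roots_charpoly hc)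
      fun c hc => h.im_ne_zero_of_mem_roots hT hc
    omega
  let e := (Finset.equivFinOfCardEq hcard).symm
  have hroot : ∀ j, (e j : ℂ) ∈ S := fun j => (Finset.mem_filter.1 (e j).2).1
  have hpos : ∀ j, 0 < (e j : ℂ).im := fun j => (Finset.mem_filter.1 (e j).2).2
  choose u v hu hp using fun j => h.exists_isRotationPair (hroot j) (hpos j).ne'
  refine ⟨fun j => (e j : ℂ).im, u, v, fun i j hij => ?_, hpos, hu, hp⟩
  refine e.injective (Subtype.ext (Complex.ext ?_ hij))
  rw [h.re_eq_zero_of_mem_roots (hroot i), h.re_eq_zero_of_mem_roots (hroot j)]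

end SkewOperators

section Implicit

variable {X Y Z : Type*} [NormedAddCommGroup X] [NormedSpace ℝ X] [CompleteSpace X]
  [NormedAddCommGroup Y] [NormedSpace ℝ Y] [CompleteSpace Y] [NormedAddCommGroup Z]
  [NormedSpace ℝ Z]

theorem exists_contDiffOn_implicitFunction {m : WithTop ℕ∞} (hm : 1 ≤ m) {U : Set (X × Y)}
    (hU : IsOpen U) {f : X × Y → Z} (hf : ContDiffOn ℝ m f U) {x₀ : X} {y₀ : Y}
    (h₀ : (x₀, y₀) ∈ U) (hf₀ : f (x₀, y₀) = 0)
    (hfy : ((fderiv ℝ f (x₀, y₀)).comp (.inr ℝ X Y)).IsInvertible) :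
    ∃ (N : Set X) (h : X → Y), IsOpen N ∧ x₀ ∈ N ∧ ContDiffOn ℝ m h N ∧ h x₀ = y₀ ∧
      ∀ x ∈ N, f (x, h x) = 0 := by
  obtain ⟨L, hL⟩ := hfy
  have hfd : HasFDerivAt f (fderiv ℝ f (x₀, y₀)) (x₀, y₀) :=
    ((hf.contDiffAt (hU.mem_nhds h₀)).differentiableAt
      (zero_lt_one.trans_le hm).ne').hasFDerivAt
  let A : (X × Y) ≃L[ℝ] (X × Z) := (ContinuousLinearEquiv.refl ℝ X).skewProd L
    ((fderiv ℝ f (x₀, y₀)).comp (.inl ℝ X Y))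
  have hA : (A : X × Y →L[ℝ] X × Z) = fderiv ℝ (fun p : X × Y => (p.1, f p)) (x₀, y₀) := by
    rw [(hasFDerivAt_fst.prodMk hfd).fderiv]
    refine ContinuousLinearMap.ext fun p => Prod.ext rfl ?_
    change L p.2 + fderiv ℝ f (x₀, y₀) (p.1, 0) = fderiv ℝ f (x₀, y₀) p
    have hLp : fderiv ℝ f (x₀, y₀) (0, p.2) = L p.2 := (DFunLike.congr_fun hL p.2).symm
    rw [← hLp, ← map_add, Prod.mk_add_mk, zero_add, add_zero]
  obtain ⟨e, he₀, -, he, -, hes⟩ := exists_contDiffOn_openPartialHomeomorph hm hU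
    (contDiff_fst.contDiffOn.prodMk hf) h₀ ⟨A, hA⟩
  have hsymm : ∀ q ∈ e.target, (e.symm q).1 = q.1 ∧ f (e.symm q) = q.2 := fun q hq =>
    Prod.ext_iff.1 ((congrFun he _).symm.trans (e.right_inv hq))
  have he0 : e (x₀, y₀) = (x₀, 0) := (congrFun he _).trans (congrArg (Prod.mk x₀) hf₀)
  refine ⟨(fun x : X => (x, (0 : Z))) ⁻¹' e.target, fun x => (e.symm (x, 0)).2,
    e.open_target.preimage (by fun_prop), mem_preimage.2 (he0 ▸ e.map_source he₀), ?_, ?_,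
    fun x hx => ?_⟩
  · exact contDiff_snd.comp_contDiffOn (hes.comp
      (contDiff_id.prodMk contDiff_const).contDiffOn fun x hx => hx)
  · exact congrArg Prod.snd ((congrArg e.symm he0.symm).trans (e.left_inv he₀))
  · have hpair : (x, (e.symm (x, 0)).2) = e.symm (x, 0) := Prod.ext (hsymm _ hx).1.symm rfl
    exact (congrArg f hpair).trans (hsymm _ hx).2

end Implicit

section EigenEquation

variable {E : Type*} [NormedAddCommGroup E] [NormedSpace ℝ E]

/-- The equations of a complex eigenvector `u + i v` of `S` with eigenvalue `a + i b`, normalized by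
its Hermitian product with `u₀ + i v₀`; the argument is `(S, (a, b), u, v)`. -/
def eigenEquation (g : E →L[ℝ] E →L[ℝ] ℝ) (u₀ v₀ : E) (p : (E →L[ℝ] E) × (ℝ × ℝ) × E × E) :
    (E × E) × ℝ × ℝ :=
  ((p.1 p.2.2.1 - p.2.1.1 • p.2.2.1 + p.2.1.2 • p.2.2.2,
    p.1 p.2.2.2 - p.2.1.1 • p.2.2.2 - p.2.1.2 • p.2.2.1),
    g u₀ p.2.2.1 + g v₀ p.2.2.2 - (g u₀ u₀ + g v₀ v₀), g u₀ p.2.2.2 - g v₀ p.2.2.1)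

theorem contDiff_eigenEquation (g : E →L[ℝ] E →L[ℝ] ℝ) (u₀ v₀ : E) :
    ContDiff ℝ ∞ (eigenEquation g u₀ v₀) := by
  unfold eigenEquation
  fun_prop

theorem fderiv_eigenEquation (g : E →L[ℝ] E →L[ℝ] ℝ) (u₀ v₀ : E) (T : E →L[ℝ] E) (b : ℝ)
    (y : (ℝ × ℝ) × E × E) :
    fderiv ℝ (eigenEquation g u₀ v₀) (T, (0, b), u₀, v₀) (0, y) =
      ((T y.2.1 - y.1.1 • u₀ + (b • y.2.2 + y.1.2 • v₀),
        T y.2.2 - y.1.1 • v₀ - (b • y.2.1 + y.1.2 • u₀)),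
        g u₀ y.2.1 + g v₀ y.2.2, g u₀ y.2.2 - g v₀ y.2.1) := by
  rw [← ((contDiff_eigenEquation g u₀ v₀).differentiable (by simp) _).lineDeriv_eq_fderiv]
  refine HasLineDerivAt.lineDeriv ?_
  have hs := hasDerivAt_id (0 : ℝ)
  have hu : HasDerivAt (fun s : ℝ => u₀ + s • y.2.1) y.2.1 0 := by
    simpa using (hs.smul_const y.2.1).const_add u₀
  have hv : HasDerivAt (fun s : ℝ => v₀ + s • y.2.2) y.2.2 0 := by
    simpa using (hs.smul_const y.2.2).const_add v₀
  have ha : HasDerivAt (fun s : ℝ => s * y.1.1) y.1.1 0 := by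
    simpa using hs.mul_const y.1.1
  have hb : HasDerivAt (fun s : ℝ => b + s * y.1.2) y.1.2 0 := by
    simpa using (hs.mul_const y.1.2).const_add b
  have hcomp : ∀ {w : ℝ → E} {w' : E}, HasDerivAt w w' 0 → ∀ ℓ : E →L[ℝ] ℝ,
      HasDerivAt (fun s => ℓ (w s)) (ℓ w') 0 := fun hw ℓ => ℓ.hasFDerivAt.comp_hasDerivAt 0 hw
  have hTu := T.hasFDerivAt.comp_hasDerivAt 0 hu
  have hTv := T.hasFDerivAt.comp_hasDerivAt 0 hv
  have hline := (((hTu.sub (ha.smul hu)).add (hb.smul hv)).prodMk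
    ((hTv.sub (ha.smul hv)).sub (hb.smul hu))).prodMk
    ((((hcomp hu (g u₀)).add (hcomp hv (g v₀))).sub_const (g u₀ u₀ + g v₀ v₀)).prodMk
      ((hcomp hv (g u₀)).sub (hcomp hu (g v₀))))
  refine (hline.congr_of_eventuallyEq (.of_forall fun s => ?_)).congr_deriv ?_
  · simp [eigenEquation]
  · simp

variable {g : E →L[ℝ] E →L[ℝ] ℝ} {T : E →L[ℝ] E}

/-- Pairing the linearized equation with the eigenvector itself removes the variation `u' + i v'` of
the eigenvector. -/
theorem IsRotationPair.eq_zero_of_linearized_eigenvalue {b : ℝ} {u v : E}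
    (hp : IsRotationPair T b u v) (h : IsSkew g T) (hb : b ≠ 0) (hu : u ≠ 0) {a' b' : ℝ} {u' v' : E}
    (hu' : T u' - a' • u + (b • v' + b' • v) = 0) (hv' : T v' - a' • v - (b • u' + b' • u) = 0) :
    a' = 0 ∧ b' = 0 := by
  have huv := hp.inner_eq_zero h hb
  have hvu := (h.symm v u).trans huv
  have huu := hp.inner_self_eq h hb
  have hu'u := congrArg (g u) hu'
  have hu'v := congrArg (g v) hu'
  have hv'u := congrArg (g u) hv'
  have hv'v := congrArg (g v) hv'
  have suu := h.skew u u'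
  have svv := h.skew v v'
  have svu := h.skew v u'
  have suv := h.skew u v'
  rw [hp.left] at suu suv
  rw [hp.right] at svv svu
  simp only [map_add, map_sub, map_smul, map_neg, map_zero, neg_apply, smul_apply, smul_eq_mul]
    at hu'u hu'v hv'u hv'v suu svv svu suv
  have hcancel : ∀ r : ℝ, r * g u u = 0 → r = 0 := fun r hr =>
    (mul_eq_zero.1 hr).resolve_right (h.pos u hu).ne'
  constructor <;> apply hcancel
  · linear_combination (-1 / 2) * (hu'u + hv'v - suu - svv) + a' / 2 * huu + b' / 2 * huv
      - b' / 2 * hvu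
  · linear_combination (1 / 2) * (hu'v - hv'u - svu + suv) + b' / 2 * huu - a' / 2 * huv
      + a' / 2 * hvu

variable {ι : Type*} [Fintype ι] {b : ι → ℝ} {u v : ι → E} [FiniteDimensional ℝ E]

/-- The eigenspace of a simple eigenvalue is a complex line, so an eigenvector which is Hermitian
orthogonal to `u j + i v j` vanishes. -/
theorem IsRotationSystem.eq_zero_of_isRotationPair (hp : IsRotationSystem T b u v)
    (h : IsSkew g T) (hι : Module.finrank ℝ E = 2 * Fintype.card ι) {j : ι} {u' v' : E}
    (hp' : IsRotationPair T (b j) u' v') (hre : g (u j) u' + g (v j) v' = 0)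
    (him : g (u j) v' - g (v j) u' = 0) : u' = 0 ∧ v' = 0 := by
  have hbj := (hp.pos j).ne'
  have suu := h.skew u' (u j)
  have suv := h.skew u' (v j)
  rw [hp'.left, (hp.pair j).left] at suu
  rw [hp'.left, (hp.pair j).right] at suv
  simp only [map_smul, map_neg, neg_apply, smul_apply, smul_eq_mul] at suu suv
  have hvu : g v' (u j) + g u' (v j) = 0 :=
    (mul_eq_zero.1 (by linear_combination -suu : b j * _ = 0)).resolve_left hbj
  have hvv : g v' (v j) - g u' (u j) = 0 :=
    (mul_eq_zero.1 (by linear_combination -suv : b j * _ = 0)).resolve_left hbj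
  rw [h.symm (u j), h.symm (v j)] at hre him
  have hu' : u' = 0 := by
    refine hp.eq_zero_of_orthogonal h hι (fun k => ?_) fun k => ?_ <;>
      rcases eq_or_ne j k with rfl | hjk
    · linarith
    · exact (hp'.orthogonal h (hp.pair k) (hp.sq_ne_sq hjk)).1
    · linarith
    · exact (hp'.orthogonal h (hp.pair k) (hp.sq_ne_sq hjk)).2.1
  refine ⟨hu', ?_⟩
  have hTu' := hp'.left
  rw [hu', map_zero] at hTu'
  exact (smul_eq_zero.1 (neg_eq_zero.1 hTu'.symm)).resolve_left hbj

theorem IsRotationSystem.isInvertible_fderiv_eigenEquation (hp : IsRotationSystem T b u v)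
    (h : IsSkew g T) (hι : Module.finrank ℝ E = 2 * Fintype.card ι) (j : ι) :
    ((fderiv ℝ (eigenEquation g (u j) (v j)) (T, (0, b j), u j, v j)).comp
      (.inr ℝ (E →L[ℝ] E) ((ℝ × ℝ) × E × E))).IsInvertible := by
  have hdim : Module.finrank ℝ ((ℝ × ℝ) × E × E) = Module.finrank ℝ ((E × E) × ℝ × ℝ) := by
    simp only [Module.finrank_prod, Module.finrank_self, add_comm]
  refine isInvertible_of_injective hdim ((injective_iff_map_eq_zero _).2 ?_)
  rintro ⟨⟨a', b'⟩, u', v'⟩ hy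
  have hlin := (fderiv_eigenEquation g (u j) (v j) T (b j) ((a', b'), u', v')).symm.trans hy
  simp only [Prod.mk_eq_zero] at hlin
  obtain ⟨⟨hu', hv'⟩, hre, him⟩ := hlin
  obtain ⟨rfl, rfl⟩ := (hp.pair j).eq_zero_of_linearized_eigenvalue h (hp.pos j).ne'
    (hp.ne_zero j) hu' hv'
  simp only [zero_smul, sub_zero, add_zero] at hu' hv'
  have hp' : IsRotationPair T (b j) u' v' :=
    ⟨eq_neg_of_add_eq_zero_left hu', sub_eq_zero.1 hv'⟩
  obtain ⟨rfl, rfl⟩ := hp.eq_zero_of_isRotationPair h hι hp' hre him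
  rfl

theorem IsRotationSystem.exists_contDiffOn_eigenvector (hp : IsRotationSystem T b u v)
    (h : IsSkew g T) (hι : Module.finrank ℝ E = 2 * Fintype.card ι) (j : ι) :
    ∃ (N : Set (E →L[ℝ] E)) (a' b' : (E →L[ℝ] E) → ℝ) (u' v' : (E →L[ℝ] E) → E), IsOpen N ∧ T ∈ N ∧
      ContDiffOn ℝ ∞ b' N ∧ ContDiffOn ℝ ∞ u' N ∧ ContDiffOn ℝ ∞ v' N ∧ b' T = b j ∧ u' T = u j ∧
      ∀ S ∈ N, S (u' S) = a' S • u' S - b' S • v' S ∧ S (v' S) = a' S • v' S + b' S • u' S := by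
  have : CompleteSpace E := FiniteDimensional.complete ℝ E
  have huv := (hp.pair j).inner_eq_zero h (hp.pos j).ne'
  have hzero : eigenEquation g (u j) (v j) (T, (0, b j), u j, v j) = 0 := by
    simp [eigenEquation, (hp.pair j).left, (hp.pair j).right, huv, (h.symm (v j) (u j)).trans huv]
  obtain ⟨N, y, hN, hTN, hy, hyT, hsol⟩ := exists_contDiffOn_implicitFunction (by simp) isOpen_univ
    (contDiff_eigenEquation g (u j) (v j)).contDiffOn (mem_univ _) hzero
    (hp.isInvertible_fderiv_eigenEquation h hι j)
  refine ⟨N, fun S => (y S).1.1, fun S => (y S).1.2, fun S => (y S).2.1, fun S => (y S).2.2,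
    hN, hTN, hy.fst.snd, hy.snd.fst, hy.snd.snd, congrArg (·.1.2) hyT,
    congrArg (·.2.1) hyT, fun S hS => ?_⟩
  have hS := hsol S hS
  simp only [eigenEquation, Prod.mk_eq_zero] at hS
  refine ⟨sub_eq_zero.1 (Eq.trans ?_ hS.1.1), sub_eq_zero.1 (Eq.trans ?_ hS.1.2)⟩ <;> abel

/-- The real parts of the eigenvalues are not controlled near `T`; they vanish again at every
operator which is skew for some inner product. -/
theorem IsRotationSystem.exists_contDiffOn (hp : IsRotationSystem T b u v) (h : IsSkew g T)
    (hι : Module.finrank ℝ E = 2 * Fintype.card ι) :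
    ∃ (N : Set (E →L[ℝ] E)) (b' : ι → (E →L[ℝ] E) → ℝ) (u' v' : ι → (E →L[ℝ] E) → E),
      IsOpen N ∧ T ∈ N ∧
      (∀ j, ContDiffOn ℝ ∞ (b' j) N ∧ ContDiffOn ℝ ∞ (u' j) N ∧ ContDiffOn ℝ ∞ (v' j) N) ∧
      ∀ S ∈ N, ∀ g', IsSkew g' S →
        IsRotationSystem S (fun j => b' j S) (fun j => u' j S) (fun j => v' j S) := by
  choose N a' b' u' v' hN hTN hb' hu' hv' hb'T hu'T hsol using hp.exists_contDiffOn_eigenvector h hι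
  have hb'c : ∀ j, ContinuousAt (b' j) T := fun j =>
    (hb' j).continuousOn.continuousAt ((hN j).mem_nhds (hTN j))
  have hu'c : ∀ j, ContinuousAt (u' j) T := fun j =>
    (hu' j).continuousOn.continuousAt ((hN j).mem_nhds (hTN j))
  have hnear : ∀ᶠ S in 𝓝 T, ((∀ j, S ∈ N j) ∧ (∀ j, 0 < b' j S) ∧ ∀ j, u' j S ≠ 0) ∧
      ∀ i j, i ≠ j → b' i S ≠ b' j S := by
    refine .and (.and ?_ (.and ?_ ?_)) ?_
    · exact eventually_all.2 fun j => (hN j).eventually_mem (hTN j)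
    · exact eventually_all.2 fun j =>
        (hb'c j).eventually_const_lt ((hp.pos j).trans_eq (hb'T j).symm)
    · exact eventually_all.2 fun j => (hu'c j).eventually_ne ((hu'T j).trans_ne (hp.ne_zero j))
    · refine eventually_all.2 fun i => eventually_all.2 fun j => eventually_imp_distrib_left.2
        fun hij => ((hb'c i).ne_iff_eventually_ne (hb'c j)).1 ?_
      rw [hb'T, hb'T]
      exact hp.injective.ne hij
  obtain ⟨N', hN', hN'o, hTN'⟩ := eventually_nhds_iff.1 hnear
  have hN'N : ∀ j, N' ⊆ N j := fun j S hS => (hN' S hS).1.1 j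
  refine ⟨N', b', u', v', hN'o, hTN', fun j => ⟨(hb' j).mono (hN'N j), (hu' j).mono (hN'N j),
    (hv' j).mono (hN'N j)⟩, fun S hS g' hg' => ?_⟩
  obtain ⟨⟨-, hpos, hne⟩, hinj⟩ := hN' S hS
  refine ⟨fun i j hij => by_contra fun hne => hinj i j hne hij, hpos, hne, fun j => ?_⟩
  obtain ⟨hSu, hSv⟩ := hsol j S (hN'N j hS)
  have ha := hg'.re_eq_zero (.inl (hne j)) hSu hSv
  exact ⟨by simpa [ha] using hSu, by simpa [ha] using hSv⟩

end EigenEquation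

section Eigenframe

variable {E : Type*} [NormedAddCommGroup E] [NormedSpace ℝ E]

theorem IsRotationSystem.exists_contDiffOn_normalized {ι : Type*} {N : Set E}
    {g : E → E →L[ℝ] E →L[ℝ] ℝ} {T : E → E →L[ℝ] E} (hg : ContDiffOn ℝ ∞ g N)
    (h : ∀ x ∈ N, IsSkew (g x) (T x)) {β : ι → E → ℝ} {u v : ι → E → E}
    (hβ : ∀ j, ContDiffOn ℝ ∞ (β j) N) (hu : ∀ j, ContDiffOn ℝ ∞ (u j) N)
    (hp : ∀ x ∈ N, IsRotationSystem (T x) (fun j => β j x) (fun j => u j x) (fun j => v j x)) :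
    ∃ s : ι → E → ℝ, (∀ j, ContDiffOn ℝ ∞ (s j) N) ∧ ∀ x ∈ N, ∀ j, s j x ≠ 0 ∧
      g x (s j x • v j x) (s j x • v j x) = (β j x)⁻¹ := by
  have hpos : ∀ x ∈ N, ∀ j, 0 < β j x * g x (u j x) (u j x) := fun x hx j =>
    mul_pos ((hp x hx).pos j) ((h x hx).pos _ ((hp x hx).ne_zero j))
  refine ⟨fun j x => (√(β j x * g x (u j x) (u j x)))⁻¹, fun j => ?_, fun x hx j => ⟨?_, ?_⟩⟩
  · exact (((hβ j).mul ((hg.clm_apply (hu j)).clm_apply (hu j))).sqrt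
      fun x hx => (hpos x hx j).ne').inv fun x hx => (Real.sqrt_pos.2 (hpos x hx j)).ne'
  · exact inv_ne_zero (Real.sqrt_pos.2 (hpos x hx j)).ne'
  · have hβ₀ := ((hp x hx).pos j).ne'
    have hu₀ := ((h x hx).pos _ ((hp x hx).ne_zero j)).ne'
    simp only [map_smul, smul_apply, smul_eq_mul, ← ((hp x hx).pair j).inner_self_eq (h x hx) hβ₀]
    rw [← mul_assoc, ← mul_inv, Real.mul_self_sqrt (hpos x hx j).le]
    field_simp

variable [FiniteDimensional ℝ E]

theorem exists_contDiffOn_eigenframe {n : ℕ} (hn : Module.finrank ℝ E = 2 * n) {O : Set E}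
    (hO : IsOpen O) {x₀ : E} (hx₀ : x₀ ∈ O) {g : E → E →L[ℝ] E →L[ℝ] ℝ} {T : E → E →L[ℝ] E}
    (hg : ContDiffOn ℝ ∞ g O) (hT : ContDiffOn ℝ ∞ T O) (h : ∀ x ∈ O, IsSkew (g x) (T x))
    (hinj : Function.Injective (T x₀))
    (hs : ((T x₀ : E →ₗ[ℝ] E).charpoly.map (algebraMap ℝ ℂ)).roots.Nodup) :
    ∃ (N : Set E) (β : Fin n → E → ℝ) (u v : Fin n → E → E), IsOpen N ∧ N ⊆ O ∧ x₀ ∈ N ∧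
      (∀ j, ContDiffOn ℝ ∞ (β j) N ∧ ContDiffOn ℝ ∞ (u j) N ∧ ContDiffOn ℝ ∞ (v j) N) ∧
      ∀ x ∈ N, IsRotationSystem (T x) (fun j => β j x) (fun j => u j x) (fun j => v j x) ∧
        ∀ j, g x (v j x) (v j x) = (β j x)⁻¹ := by
  obtain ⟨b, u₀, v₀, hp⟩ := (h x₀ hx₀).exists_isRotationSystem hn hinj hs
  obtain ⟨W, b', u', v', hW, hxW, hsmooth, hsys⟩ := hp.exists_contDiffOn (h x₀ hx₀) (by simpa)
  have hTW : ContDiffOn ℝ ∞ T (O ∩ T ⁻¹' W) := hT.mono inter_subset_left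
  have hb : ∀ j, ContDiffOn ℝ ∞ (fun x => b' j (T x)) (O ∩ T ⁻¹' W) := fun j =>
    (hsmooth j).1.comp hTW fun x hx => hx.2
  have hu : ∀ j, ContDiffOn ℝ ∞ (fun x => u' j (T x)) (O ∩ T ⁻¹' W) := fun j =>
    (hsmooth j).2.1.comp hTW fun x hx => hx.2
  have hv : ∀ j, ContDiffOn ℝ ∞ (fun x => v' j (T x)) (O ∩ T ⁻¹' W) := fun j =>
    (hsmooth j).2.2.comp hTW fun x hx => hx.2
  have hpT : ∀ x ∈ O ∩ T ⁻¹' W, IsRotationSystem (T x) (fun j => b' j (T x))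
      (fun j => u' j (T x)) (fun j => v' j (T x)) := fun x hx => hsys (T x) hx.2 (g x) (h x hx.1)
  obtain ⟨s, hs, hsg⟩ := IsRotationSystem.exists_contDiffOn_normalized (hg.mono inter_subset_left)
    (fun x hx => h x hx.1) hb hu hpT
  exact ⟨O ∩ T ⁻¹' W, fun j x => b' j (T x), fun j x => s j x • u' j (T x),
    fun j x => s j x • v' j (T x), hT.continuousOn.isOpen_inter_preimage hO hW, inter_subset_left,
    ⟨hx₀, hxW⟩, fun j => ⟨hb j, (hs j).smul (hu j), (hs j).smul (hv j)⟩,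
    fun x hx => ⟨(hpT x hx).smul fun j => (hsg x hx j).1, fun j => (hsg x hx j).2⟩⟩

end Eigenframe

section Spectrum

variable {ι : Type*} [Fintype ι]

theorem mem_pair_mul_I_iff {b : ℝ} {c : ℂ} :
    c ∈ ({(b : ℂ) * Complex.I, -((b : ℂ) * Complex.I)} : Multiset ℂ) ↔
      c.re = 0 ∧ (c.im = b ∨ c.im = -b) := by
  simp [Complex.ext_iff, and_or_left]

theorem nodup_sum_pair_mul_I {b : ι → ℝ} (hb : Function.Injective b) (hpos : ∀ j, 0 < b j) :
    (∑ j, ({(b j : ℂ) * Complex.I, -((b j : ℂ) * Complex.I)} : Multiset ℂ)).Nodup := by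
  change (Multiset.bind Finset.univ.val _).Nodup
  refine Multiset.nodup_bind.2 ⟨fun j _ => ?_, Finset.univ.nodup.pairwise fun i _ j _ hij => ?_⟩
  · have hne : (b j : ℂ) * Complex.I ≠ 0 :=
      mul_ne_zero (Complex.ofReal_ne_zero.2 (hpos j).ne') Complex.I_ne_zero
    simpa [self_eq_neg] using hne
  · refine Multiset.disjoint_left.2 fun {c} hi hj => hij (hb ?_)
    have hi₀ := hpos i
    have hj₀ := hpos j
    rcases (mem_pair_mul_I_iff.1 hi).2 with hci | hci <;>
      rcases (mem_pair_mul_I_iff.1 hj).2 with hcj | hcj <;> linarith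

variable {E : Type*} [NormedAddCommGroup E] [NormedSpace ℝ E] [FiniteDimensional ℝ E]
  {T : E →L[ℝ] E} {b : ι → ℝ} {u v : ι → E}

theorem IsRotationSystem.mem_roots_charpoly (hp : IsRotationSystem T b u v) {c : ℂ}
    (hc : c ∈ ∑ j, ({(b j : ℂ) * Complex.I, -((b j : ℂ) * Complex.I)} : Multiset ℂ)) :
    c ∈ ((T : E →ₗ[ℝ] E).charpoly.map (algebraMap ℝ ℂ)).roots := by
  obtain ⟨j, -, hj⟩ := Multiset.mem_sum.1 hc
  obtain ⟨hre, him⟩ := mem_pair_mul_I_iff.1 hj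
  have hleft := (hp.pair j).left
  have hright := (hp.pair j).right
  rw [mem_roots_charpoly_iff]
  rcases him with him | him
  · exact ⟨u j, v j, .inl (hp.ne_zero j), by simpa [hre, him], by simpa [hre, him]⟩
  · exact ⟨u j, -v j, .inl (hp.ne_zero j), by simpa [hre, him], by simpa [hre, him]⟩

theorem IsRotationSystem.nodup_roots_charpoly_and_eq (hp : IsRotationSystem T b u v)
    (hι : Module.finrank ℝ E = 2 * Fintype.card ι) :
    ((T : E →ₗ[ℝ] E).charpoly.map (algebraMap ℝ ℂ)).roots.Nodup ∧
      ((T : E →ₗ[ℝ] E).charpoly.map (algebraMap ℝ ℂ)).roots =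
        ∑ j, {(b j : ℂ) * Complex.I, -((b j : ℂ) * Complex.I)} := by
  have hnodup := nodup_sum_pair_mul_I hp.injective hp.pos
  have heq := Multiset.eq_of_le_of_card_le
    ((Multiset.le_iff_subset hnodup).2 fun c hc => hp.mem_roots_charpoly hc)
    (by rw [card_roots_charpoly, hι]; simp [mul_comm])
  exact ⟨heq ▸ hnodup, heq.symm⟩

end Spectrum

/-! ### Frames adapted to a magnetic field -/

section Forms

variable {F F' : Type*} [NormedAddCommGroup F'] [NormedSpace ℝ F'] [NormedAddCommGroup F]
  [NormedSpace ℝ F]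

theorem dForm_pullback_of_hasFDerivWithinAt {f : F → F'} {θ : F' → F' →L[ℝ] ℝ}
    {θ' : F' →L[ℝ] F' →L[ℝ] ℝ} {x : F} (hf : ContDiffAt ℝ 2 f x)
    (hθ : HasFDerivWithinAt θ θ' (range f) (f x)) (X Y : F) :
    dForm (fun y => (θ (f y)).comp (fderiv ℝ f y)) x X Y =
      θ' (fderiv ℝ f x X) (fderiv ℝ f x Y) - θ' (fderiv ℝ f x Y) (fderiv ℝ f x X) := by
  have hf' : HasFDerivAt f (fderiv ℝ f x) x := (hf.differentiableAt (by simp)).hasFDerivAt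
  have hf'' : DifferentiableAt ℝ (fderiv ℝ f) x :=
    (hf.fderiv_right (m := 1) le_rfl).differentiableAt (by simp)
  have hsymm : IsSymmSndFDerivAt ℝ f x := hf.isSymmSndFDerivAt (by simp)
  have hcomp : HasFDerivAt (fun y => θ (f y)) (θ'.comp (fderiv ℝ f x)) x :=
    hasFDerivWithinAt_univ.1 <| hθ.comp x hf'.hasFDerivWithinAt fun y _ => mem_range_self y
  rw [dForm_apply, (hcomp.clm_comp hf''.hasFDerivAt).fderiv]
  simp [hsymm X Y]

theorem dForm_pullback {f : F → F'} {θ : F' → F' →L[ℝ] ℝ} {x : F} (hf : ContDiffAt ℝ 2 f x)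
    (hθ : DifferentiableAt ℝ θ (f x)) (X Y : F) :
    dForm (fun y => (θ (f y)).comp (fderiv ℝ f y)) x X Y =
      dForm θ (f x) (fderiv ℝ f x X) (fderiv ℝ f x Y) :=
  dForm_pullback_of_hasFDerivWithinAt hf hθ.hasFDerivAt.hasFDerivWithinAt X Y

theorem contDiffOn_pullback {f : F → F'} {θ : F' → F' →L[ℝ] ℝ} {U : Set F} {U' : Set F'}
    (hU : IsOpen U) (hf : ContDiffOn ℝ ∞ f U) (hθ : ContDiffOn ℝ ∞ θ U') (h : MapsTo f U U') :
    ContDiffOn ℝ ∞ (fun y => (θ (f y)).comp (fderiv ℝ f y)) U :=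
  (hθ.comp hf h).clm_comp (hf.fderiv_of_isOpen hU (by simp))

theorem dForm_linear (b : F →L[ℝ] F →L[ℝ] ℝ) (x : F) : dForm (fun y => b y) x = altCLM F b := by
  rw [dForm, b.hasFDerivAt.fderiv]

/-- The coordinate functional of index `i` on phase space, as a continuous linear map. -/
def coordCLM {n : ℕ} (i : Fin n ⊕ Fin n) : PhaseSpace n →L[ℝ] ℝ := EuclideanSpace.proj i

@[simp]
theorem coordCLM_apply {n : ℕ} (i : Fin n ⊕ Fin n) (z : PhaseSpace n) : coordCLM i z = z i := rfl

/-- The bilinear form `(w, w') ↦ ∑ η_j y'_j`, i.e. the primitive `η dy` of the standard form. -/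
def stdPrimitive (n : ℕ) : PhaseSpace n →L[ℝ] PhaseSpace n →L[ℝ] ℝ :=
  ∑ j : Fin n, (coordCLM (Sum.inr j)).smulRight (coordCLM (Sum.inl j))

theorem stdPrimitive_apply (n : ℕ) (X Y : PhaseSpace n) :
    stdPrimitive n X Y = ∑ j : Fin n, X (Sum.inr j) * Y (Sum.inl j) := by
  simp [stdPrimitive, sum_apply]

/-- The standard form as a continuous bilinear map. -/
def stdFormCLM (n : ℕ) : PhaseSpace n →L[ℝ] PhaseSpace n →L[ℝ] ℝ := altCLM _ (stdPrimitive n)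

theorem stdFormCLM_apply (n : ℕ) (X Y : PhaseSpace n) : stdFormCLM n X Y = stdForm n X Y := by
  simp [stdFormCLM, stdPrimitive_apply, stdForm, Finset.sum_sub_distrib]

theorem dForm_stdPrimitive (n : ℕ) (w X Y : PhaseSpace n) :
    dForm (fun w => stdPrimitive n w) w X Y = stdForm n X Y := by
  rw [dForm_linear, ← stdFormCLM_apply]
  rfl

/-- The primitive `η dy + ξ dx` of the product form. -/
def prodPrimitive (n : ℕ) :
    (PhaseSpace n × PhaseSpace n) →L[ℝ] (PhaseSpace n × PhaseSpace n) →L[ℝ] ℝ :=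
  ((stdPrimitive n).bilinearComp (ContinuousLinearMap.fst ℝ _ _) (ContinuousLinearMap.fst ℝ _ _)) +
    ((stdPrimitive n).bilinearComp (ContinuousLinearMap.snd ℝ _ _)
      (ContinuousLinearMap.snd ℝ _ _))

theorem dForm_prodPrimitive (n : ℕ) (w X Y : PhaseSpace n × PhaseSpace n) :
    dForm (fun w => prodPrimitive n w) w X Y = prodForm n X Y := by
  rw [dForm_linear, prodForm, ← stdFormCLM_apply, ← stdFormCLM_apply]
  simp [prodPrimitive, stdFormCLM]

theorem eq_zero_of_stdForm {n : ℕ} {X : PhaseSpace n} (h : ∀ Y, stdForm n X Y = 0) : X = 0 := by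
  classical
  ext i
  rcases i with j | j
  · simpa [stdForm] using h (EuclideanSpace.single (Sum.inr j) 1)
  · simpa [stdForm] using h (EuclideanSpace.single (Sum.inl j) 1)

theorem eq_zero_of_prodForm {n : ℕ} {X : PhaseSpace n × PhaseSpace n}
    (h : ∀ Y, prodForm n X Y = 0) : X = 0 := by
  have hzero : ∀ X : PhaseSpace n, stdForm n X 0 = 0 := fun X => by simp [stdForm]
  refine Prod.ext (eq_zero_of_stdForm fun Y => ?_) (eq_zero_of_stdForm fun Y => ?_)
  · simpa [prodForm, hzero] using h (Y, 0)
  · simpa [prodForm, hzero] using h (0, Y)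

theorem isInvertible_dForm_stdPrimitive (n : ℕ) (w : PhaseSpace n) :
    (dForm (fun w => stdPrimitive n w) w).IsInvertible := by
  refine isInvertible_of_injective finrank_dual_eq.symm ?_
  rw [injective_iff_map_eq_zero]
  exact fun X hX => eq_zero_of_stdForm fun Y => by rw [← dForm_stdPrimitive n w, hX]; rfl

theorem isInvertible_dForm_prodPrimitive (n : ℕ) (w : PhaseSpace n × PhaseSpace n) :
    (dForm (fun w => prodPrimitive n w) w).IsInvertible := by
  refine isInvertible_of_injective finrank_dual_eq.symm ?_
  rw [injective_iff_map_eq_zero]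
  exact fun X hX => eq_zero_of_prodForm fun Y => by rw [← dForm_prodPrimitive n w, hX]; rfl

/-- The bilinear form underlying the Liouville form `p dx` on `E × E*`. -/
def liouvilleCLM (E : Type*) [NormedAddCommGroup E] [NormedSpace ℝ E] :
    (E × (E →L[ℝ] ℝ)) →L[ℝ] (E × (E →L[ℝ] ℝ)) →L[ℝ] ℝ :=
  (ContinuousLinearMap.precomp ℝ (ContinuousLinearMap.fst ℝ E (E →L[ℝ] ℝ))).comp
    (ContinuousLinearMap.snd ℝ E (E →L[ℝ] ℝ))

theorem liouvilleCLM_apply (E : Type*) [NormedAddCommGroup E] [NormedSpace ℝ E]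
    (X Y : E × (E →L[ℝ] ℝ)) : liouvilleCLM E X Y = X.2 Y.1 := rfl

theorem dForm_liouvilleCLM {E : Type*} [NormedAddCommGroup E] [NormedSpace ℝ E]
    (x X Y : E × (E →L[ℝ] ℝ)) :
    dForm (fun x => liouvilleCLM E x) x X Y = X.2 Y.1 - Y.2 X.1 := by
  rw [dForm_linear]
  rfl

end Forms

section FrameMap

variable {E : Type*} [NormedAddCommGroup E] [NormedSpace ℝ E] {n : ℕ}

/-- The linear map `(x, ξ) ↦ ∑ x_j u_j + ξ_j v_j`. -/
def frameMap (u v : Fin n → E) : PhaseSpace n →L[ℝ] E :=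
  ∑ j : Fin n, ((coordCLM (Sum.inl j)).smulRight (u j) + (coordCLM (Sum.inr j)).smulRight (v j))

theorem frameMap_apply (u v : Fin n → E) (z : PhaseSpace n) :
    frameMap u v z = ∑ j : Fin n, (z (Sum.inl j) • u j + z (Sum.inr j) • v j) := by
  simp [frameMap, sum_apply]

theorem contDiffOn_frameMap {X : Type*} [NormedAddCommGroup X] [NormedSpace ℝ X] {N : Set X}
    {u v : Fin n → X → E} (hu : ∀ j, ContDiffOn ℝ ∞ (u j) N) (hv : ∀ j, ContDiffOn ℝ ∞ (v j) N) :
    ContDiffOn ℝ ∞ (fun x => frameMap (fun j => u j x) (fun j => v j x)) N := by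
  have hsmulRight (c : PhaseSpace n →L[ℝ] ℝ) {w : X → E} (hw : ContDiffOn ℝ ∞ w N) :
      ContDiffOn ℝ ∞ (fun x => c.smulRight (w x)) N :=
    (ContinuousLinearMap.smulRightL ℝ (PhaseSpace n) E c).contDiff.comp_contDiffOn hw
  exact ContDiffOn.sum fun j _ => (hsmulRight _ (hu j)).add (hsmulRight _ (hv j))

variable {g : E →L[ℝ] E →L[ℝ] ℝ} {T : E →L[ℝ] E} {β : Fin n → ℝ}
  {u v : Fin n → E}

/-- An adapted frame: rotation pairs of different frequencies, normalized by
`g(u_j, u_j) = 1 / β_j`. -/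
structure IsAdaptedFrame (g : E →L[ℝ] E →L[ℝ] ℝ) (T : E →L[ℝ] E) (β : Fin n → ℝ)
    (u v : Fin n → E) : Prop where
  isSkew : IsSkew g T
  isRotationSystem : IsRotationSystem T β v u
  inner_self : ∀ j, g (u j) (u j) = (β j)⁻¹

namespace IsAdaptedFrame

theorem inner_frameMap (h : IsAdaptedFrame g T β u v) (a b : PhaseSpace n) :
    g (frameMap u v a) (frameMap u v b) =
      ∑ j, (β j)⁻¹ * (a (Sum.inl j) * b (Sum.inl j) + a (Sum.inr j) * b (Sum.inr j)) := by
  have hp := h.isRotationSystem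
  rw [frameMap_apply u v a, map_sum, sum_apply]
  refine Finset.sum_congr rfl fun i _ => ?_
  rw [frameMap_apply, map_sum, Finset.sum_eq_single i]
  · have hvu := (hp.pair i).inner_eq_zero h.isSkew (hp.pos i).ne'
    have huv := (h.isSkew.symm (u i) (v i)).trans hvu
    have hvv := (hp.pair i).inner_self_eq h.isSkew (hp.pos i).ne'
    simp only [map_add, map_smul, add_apply, smul_apply, smul_eq_mul, huv, hvu, hvv, h.inner_self]
    ring
  · intro j _ hji
    obtain ⟨hvv, hvu, huv, huu⟩ :=
      (hp.pair i).orthogonal h.isSkew (hp.pair j) (hp.sq_ne_sq hji.symm)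
    simp [hvv, hvu, huv, huu]
  · simp

theorem apply_frameMap (h : IsAdaptedFrame g T β u v) (z : PhaseSpace n) :
    T (frameMap u v z) = frameMap u v (WithLp.toLp 2 (Sum.elim
      (fun j => -(β j * z (Sum.inr j))) (fun j => β j * z (Sum.inl j)))) := by
  rw [frameMap_apply, frameMap_apply, map_sum]
  refine Finset.sum_congr rfl fun j _ => ?_
  have hp := h.isRotationSystem.pair j
  simp only [map_add, map_smul, hp.left, hp.right, Sum.elim_inl, Sum.elim_inr]
  module

theorem form_frameMap (h : IsAdaptedFrame g T β u v) (a b : PhaseSpace n) :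
    g (T (frameMap u v a)) (frameMap u v b) = -stdForm n a b := by
  rw [h.apply_frameMap, h.inner_frameMap, stdForm, ← Finset.sum_neg_distrib]
  refine Finset.sum_congr rfl fun j _ => ?_
  have hβ := h.isRotationSystem.pos j
  simp only [Sum.elim_inl, Sum.elim_inr]
  field_simp
  ring

theorem normSq_frameMap (h : IsAdaptedFrame g T β u v) (z : PhaseSpace n) :
    g (T (frameMap u v z)) (T (frameMap u v z)) = ∑ j, β j * normSqAt z j := by
  rw [h.apply_frameMap, h.inner_frameMap]
  refine Finset.sum_congr rfl fun j _ => ?_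
  have hβ := h.isRotationSystem.pos j
  simp only [Sum.elim_inl, Sum.elim_inr, normSqAt]
  field_simp
  ring

theorem injective_frameMap (h : IsAdaptedFrame g T β u v) : Function.Injective (frameMap u v) := by
  rw [injective_iff_map_eq_zero]
  refine fun z hz => eq_zero_of_stdForm fun b => neg_eq_zero.1 ?_
  rw [← h.form_frameMap z b, hz, map_zero, map_zero, zero_apply]

end IsAdaptedFrame

/-- Exchanging `x` and `ξ`. -/
def swapCLE (n : ℕ) : PhaseSpace n ≃L[ℝ] PhaseSpace n :=
  (LinearIsometryEquiv.piLpCongrLeft 2 ℝ ℝ (Equiv.sumComm (Fin n) (Fin n))).toContinuousLinearEquiv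

theorem stdForm_swapCLE (n : ℕ) (a b : PhaseSpace n) :
    stdForm n (swapCLE n a) (swapCLE n b) = -stdForm n a b := by
  simp only [stdForm, ← Finset.sum_neg_distrib]
  refine Finset.sum_congr rfl fun j _ => ?_
  have hinl : ∀ a : PhaseSpace n, swapCLE n a (Sum.inl j) = a (Sum.inr j) := fun _ => rfl
  have hinr : ∀ a : PhaseSpace n, swapCLE n a (Sum.inr j) = a (Sum.inl j) := fun _ => rfl
  rw [hinl, hinl, hinr, hinr]
  ring

end FrameMap

section Taylor

variable {W Z Y : Type*} [NormedAddCommGroup W] [NormedSpace ℝ W] [NormedAddCommGroup Z]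
  [NormedSpace ℝ Z] [NormedAddCommGroup Y] [NormedSpace ℝ Y]

theorem exists_norm_le_of_vanishing {U : Set (W × Z)} (hU : IsOpen U) {f : W × Z → Y}
    (hf : ContDiffOn ℝ 1 f U) {w₀ : W} (h₀ : (w₀, (0 : Z)) ∈ U)
    (hv : ∀ w, (w, (0 : Z)) ∈ U → f (w, 0) = 0) :
    ∃ C : ℝ, 0 ≤ C ∧ ∀ᶠ p in 𝓝 (w₀, (0 : Z)), ‖f p‖ ≤ C * ‖p.2‖ := by
  have hfderiv : ContinuousAt (fderiv ℝ f) (w₀, 0) :=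
    (hf.continuousOn_fderiv_of_isOpen hU le_rfl).continuousAt (hU.mem_nhds h₀)
  set C := ‖fderiv ℝ f (w₀, 0)‖ + 1
  obtain ⟨r, hr, hball⟩ := Metric.eventually_nhds_iff_ball.1
    ((hfderiv.norm.eventually_lt_const (lt_add_one _)).and (hU.eventually_mem h₀))
  refine ⟨C, by positivity, ?_⟩
  filter_upwards [Metric.ball_mem_nhds _ hr] with p hp
  have hp₀ : (p.1, (0 : Z)) ∈ Metric.ball (w₀, (0 : Z)) r := by
    rw [Metric.mem_ball, Prod.dist_eq] at hp ⊢
    simpa using (max_lt_iff.1 hp).1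
  have hmvt := (convex_ball (w₀, (0 : Z)) r).norm_image_sub_le_of_norm_fderiv_le (𝕜 := ℝ) (f := f)
    (fun x hx => (hf.contDiffAt (hU.mem_nhds (hball x hx).2)).differentiableAt one_ne_zero)
    (fun x hx => (hball x hx).1.le) hp₀ hp
  have hsub : p - (p.1, (0 : Z)) = (0, p.2) := by ext <;> simp
  rw [hv _ (hball _ hp₀).2, sub_zero, hsub] at hmvt
  simpa using hmvt

theorem exists_norm_le_sq_of_vanishing {U : Set (W × Z)} (hU : IsOpen U) {f : W × Z → Y}
    (hf : ContDiffOn ℝ 2 f U) {w₀ : W} (h₀ : (w₀, (0 : Z)) ∈ U)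
    (hv : ∀ w, (w, (0 : Z)) ∈ U → f (w, 0) = 0)
    (hd : ∀ w, (w, (0 : Z)) ∈ U → ∀ z, fderiv ℝ f (w, 0) (0, z) = 0) :
    ∃ C : ℝ, 0 ≤ C ∧ ∀ᶠ p in 𝓝 (w₀, (0 : Z)), ‖f p‖ ≤ C * ‖p.2‖ ^ 2 := by
  have hpartial : ContDiffOn ℝ 1 (fun p => (fderiv ℝ f p).comp (.inr ℝ W Z)) U :=
    (hf.fderiv_of_isOpen hU le_rfl).clm_comp contDiffOn_const
  obtain ⟨C, hC, hev⟩ := exists_norm_le_of_vanishing hU hpartial h₀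
    fun w hw => ContinuousLinearMap.ext (hd w hw)
  obtain ⟨r, hr, hball⟩ := Metric.eventually_nhds_iff_ball.1 (hev.and (hU.eventually_mem h₀))
  refine ⟨C, hC, ?_⟩
  filter_upwards [Metric.ball_mem_nhds _ hr] with p hp
  have hfiber : ∀ z ∈ Metric.closedBall (0 : Z) ‖p.2‖,
      (p.1, z) ∈ Metric.ball (w₀, (0 : Z)) r := by
    intro z hz
    rw [Metric.mem_ball, Prod.dist_eq, max_lt_iff, dist_zero_right] at hp ⊢
    exact ⟨hp.1, (mem_closedBall_zero_iff.1 hz).trans_lt hp.2⟩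
  have hderiv : ∀ z ∈ Metric.closedBall (0 : Z) ‖p.2‖, HasFDerivWithinAt (fun z => f (p.1, z))
      ((fderiv ℝ f (p.1, z)).comp (.inr ℝ W Z)) (Metric.closedBall 0 ‖p.2‖) z := by
    intro z hz
    have hfz := (hf.contDiffAt (hU.mem_nhds (hball _ (hfiber z hz)).2)).differentiableAt two_ne_zero
    exact (hfz.hasFDerivAt.comp z (hasFDerivAt_prodMk_right p.1 z)).hasFDerivWithinAt
  have hbound : ∀ z ∈ Metric.closedBall (0 : Z) ‖p.2‖,
      ‖(fderiv ℝ f (p.1, z)).comp (.inr ℝ W Z)‖ ≤ C * ‖p.2‖ := fun z hz =>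
    (hball _ (hfiber z hz)).1.trans
      (mul_le_mul_of_nonneg_left (mem_closedBall_zero_iff.1 hz) hC)
  have hmvt := (convex_closedBall (0 : Z) ‖p.2‖).norm_image_sub_le_of_norm_hasFDerivWithin_le
    hderiv hbound (x := 0) (y := p.2) (by simp) (by simp)
  rw [hv _ (hball _ (hfiber 0 (by simp))).2, sub_zero, sub_zero] at hmvt
  rwa [pow_two, ← mul_assoc]

end Taylor

/-! ### Darboux and Weinstein charts -/

section Darboux

variable {n : ℕ}

theorem exists_darboux_chart_zero {U : Set (PhaseSpace n)} (hU : IsOpen U)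
    (h₀ : (0 : PhaseSpace n) ∈ U) {α : PhaseSpace n → PhaseSpace n →L[ℝ] ℝ}
    (hα : ContDiffOn ℝ ∞ α U) (hα₀ : ∀ X Y, dForm α 0 X Y = stdForm n X Y) :
    ∃ e : OpenPartialHomeomorph (PhaseSpace n) (PhaseSpace n), 0 ∈ e.source ∧ e 0 = 0 ∧
      e.target ⊆ U ∧ ContDiffOn ℝ ∞ e e.source ∧ ContDiffOn ℝ ∞ e.symm e.target ∧
      ∀ w ∈ e.source, ∀ X Y,
        dForm α (e w) (fderiv ℝ e w X) (fderiv ℝ e w Y) = stdForm n X Y := by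
  have hfix : ∀ w ∈ U, (0 : PhaseSpace n →L[ℝ] PhaseSpace n) w = w →
      dForm α w = dForm (fun w => stdPrimitive n w) w := by
    intro w _ hw
    obtain rfl : w = 0 := hw.symm
    ext X Y
    exact (hα₀ X Y).trans (dForm_stdPrimitive n 0 X Y).symm
  obtain ⟨e, he₀, -, hetarget, he, he', hpull, hid⟩ := exists_relative_darboux
    (P := (0 : PhaseSpace n →L[ℝ] PhaseSpace n)) (fun _ => rfl) hU
    (stdPrimitive n).contDiff.contDiffOn hα h₀ rfl hfix (isInvertible_dForm_stdPrimitive n 0)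
  exact ⟨e, he₀, (hid 0 he₀ rfl).1, hetarget, he, he', fun w hw X Y =>
    (hpull w hw X Y).trans (dForm_stdPrimitive n w X Y)⟩

theorem exists_darboux_chart {E : Type*} [NormedAddCommGroup E] [NormedSpace ℝ E]
    {N : Set E} (hN : IsOpen N) {x₀ : E} (hx₀ : x₀ ∈ N)
    {a : E → E →L[ℝ] ℝ} (ha : ContDiffOn ℝ ∞ a N) (L : PhaseSpace n ≃L[ℝ] E)
    (hL : ∀ X Y, dForm a x₀ (L X) (L Y) = stdForm n X Y) :
    ∃ κ : OpenPartialHomeomorph (PhaseSpace n) E, 0 ∈ κ.source ∧ κ 0 = x₀ ∧ κ.target ⊆ N ∧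
      ContDiffOn ℝ ∞ κ κ.source ∧ ContDiffOn ℝ ∞ κ.symm κ.target ∧
      ∀ w ∈ κ.source, ∀ X Y,
        dForm a (κ w) (fderiv ℝ κ w X) (fderiv ℝ κ w Y) = stdForm n X Y := by
  let τ : PhaseSpace n ≃ₜ E := L.toHomeomorph.trans (Homeomorph.addLeft x₀)
  have hτ : ContDiff ℝ ∞ τ := contDiff_const.add L.contDiff
  have hτ' : ContDiff ℝ ∞ τ.symm := L.symm.contDiff.comp (contDiff_const.add contDiff_id)
  have hτd : ∀ w, HasFDerivAt τ (L : PhaseSpace n →L[ℝ] E) w := fun w =>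
    L.hasFDerivAt.const_add x₀
  have hτ₀ : τ 0 = x₀ := (congrArg (x₀ + ·) (map_zero L)).trans (add_zero x₀)
  have hpull : ∀ w ∈ τ ⁻¹' N, ∀ X Y, dForm (fun w => (a (τ w)).comp (fderiv ℝ τ w)) w X Y =
      dForm a (τ w) (L X) (L Y) := fun w hw X Y => by
    rw [dForm_pullback (hτ.of_le two_le_infty).contDiffAt
      ((ha.contDiffAt (hN.mem_nhds hw)).differentiableAt (by simp)), (hτd w).fderiv]
    rfl
  have h₀ : (0 : PhaseSpace n) ∈ τ ⁻¹' N := mem_preimage.2 (hτ₀ ▸ hx₀)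
  have hU : IsOpen (τ ⁻¹' N) := hN.preimage τ.continuous
  obtain ⟨e, he₀, hefix, hetarget, he, he', hform⟩ := exists_darboux_chart_zero hU h₀
    (contDiffOn_pullback hU hτ.contDiffOn ha fun _ hw => hw)
    fun X Y => by rw [hpull 0 h₀, hτ₀, hL]
  refine ⟨e.transHomeomorph τ, he₀, (congrArg τ hefix).trans hτ₀, fun x hx => ?_,
    hτ.comp_contDiffOn he, he'.comp hτ'.contDiffOn fun _ hx => hx, fun w hw X Y => ?_⟩
  · exact τ.apply_symm_apply x ▸ hetarget hx
  · have hed := ((he.contDiffAt (e.open_source.mem_nhds hw)).differentiableAt (by simp)).hasFDerivAt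
    have hκd : HasFDerivAt (e.transHomeomorph τ)
      ((L : PhaseSpace n →L[ℝ] E).comp (fderiv ℝ e w)) w := (hτd (e w)).comp w hed
    rw [hκd.fderiv, ← hform w hw, hpull _ (hetarget (e.map_source hw))]
    rfl

end Darboux

section Weinstein

variable {n : ℕ} {E : Type*} [NormedAddCommGroup E] [NormedSpace ℝ E]

/-- The embedding of a neighbourhood of the zero section of the symplectic normal bundle of the
graph of `a` into phase space `E × E*`. -/
def normalEmbedding (κ : PhaseSpace n → E) (a : E → E →L[ℝ] ℝ) (Q : E → PhaseSpace n →L[ℝ] E)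
    (p : PhaseSpace n × PhaseSpace n) : E × (E →L[ℝ] ℝ) :=
  (κ p.1 + Q (κ p.1) p.2, a (κ p.1) + (fderiv ℝ a (κ p.1)).flip (Q (κ p.1) p.2))

theorem contDiffOn_flip_apply {X F : Type*} [NormedAddCommGroup X] [NormedSpace ℝ X]
    [NormedAddCommGroup F] [NormedSpace ℝ F] {U : Set X} {b : X → F →L[ℝ] F →L[ℝ] ℝ} {v : X → F}
    (hb : ContDiffOn ℝ ∞ b U) (hv : ContDiffOn ℝ ∞ v U) :
    ContDiffOn ℝ ∞ (fun x => (b x).flip (v x)) U :=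
  (((ContinuousLinearMap.flipₗᵢ ℝ F F ℝ).contDiff).comp_contDiffOn hb).clm_apply hv

theorem contDiffOn_normalEmbedding {κ : PhaseSpace n → E} {V : Set (PhaseSpace n)}
    (hκ : ContDiffOn ℝ ∞ κ V) {N : Set E} (hN : IsOpen N) (hκN : MapsTo κ V N)
    {a : E → E →L[ℝ] ℝ} (ha : ContDiffOn ℝ ∞ a N)
    {Q : E → PhaseSpace n →L[ℝ] E} (hQ : ContDiffOn ℝ ∞ Q N) :
    ContDiffOn ℝ ∞ (normalEmbedding κ a Q) (V ×ˢ univ) := by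
  have hbase : ContDiffOn ℝ ∞ (fun p : PhaseSpace n × PhaseSpace n => κ p.1) (V ×ˢ univ) :=
    hκ.comp contDiff_fst.contDiffOn fun p hp => hp.1
  have hmaps : MapsTo (fun p : PhaseSpace n × PhaseSpace n => κ p.1) (V ×ˢ univ) N :=
    fun p hp => hκN hp.1
  have hnormal : ContDiffOn ℝ ∞ (fun p : PhaseSpace n × PhaseSpace n => Q (κ p.1) p.2)
      (V ×ˢ univ) := (hQ.comp hbase hmaps).clm_apply contDiff_snd.contDiffOn
  have hda := (ha.fderiv_of_isOpen (m := ∞) hN (by simp)).comp hbase hmaps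
  exact (hbase.add hnormal).prodMk
    ((ha.comp hbase hmaps).add (contDiffOn_flip_apply hda hnormal))

theorem hasFDerivAt_flip_apply_of_eq_zero {X F : Type*} [NormedAddCommGroup X] [NormedSpace ℝ X]
    [NormedAddCommGroup F] [NormedSpace ℝ F] {b : X → F →L[ℝ] F →L[ℝ] ℝ} {v : X → F}
    {v' : X →L[ℝ] F} {x : X} (hb : DifferentiableAt ℝ b x) (hv : HasFDerivAt v v' x)
    (hvx : v x = 0) :
    HasFDerivAt (fun x => (b x).flip (v x)) ((b x).flip.comp v') x := by
  have hflip := ((ContinuousLinearMap.flipₗᵢ ℝ F F ℝ).toContinuousLinearEquiv :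
    (F →L[ℝ] F →L[ℝ] ℝ) →L[ℝ] F →L[ℝ] F →L[ℝ] ℝ).hasFDerivAt.comp x hb.hasFDerivAt
  refine (HasFDerivAt.clm_apply (c := fun x => (b x).flip) hflip hv).congr_fderiv ?_
  ext p q
  simp [hvx]

theorem fderiv_normalEmbedding {κ : PhaseSpace n → E} {N : Set E} (hN : IsOpen N)
    {w : PhaseSpace n} (hκ : DifferentiableAt ℝ κ w) (hw : κ w ∈ N)
    {a : E → E →L[ℝ] ℝ} (ha : ContDiffOn ℝ ∞ a N)
    {Q : E → PhaseSpace n →L[ℝ] E} (hQ : ContDiffOn ℝ ∞ Q N) (p : PhaseSpace n × PhaseSpace n) :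
    fderiv ℝ (normalEmbedding κ a Q) (w, 0) p =
      (fderiv ℝ κ w p.1 + Q (κ w) p.2,
        fderiv ℝ a (κ w) (fderiv ℝ κ w p.1) + (fderiv ℝ a (κ w)).flip (Q (κ w) p.2)) := by
  have hNw := hN.mem_nhds hw
  have hbase : HasFDerivAt (fun p : PhaseSpace n × PhaseSpace n => κ p.1)
      ((fderiv ℝ κ w).comp (ContinuousLinearMap.fst ℝ _ _)) (w, 0) :=
    HasFDerivAt.comp (g := κ) (w, (0 : PhaseSpace n)) hκ.hasFDerivAt hasFDerivAt_fst
  have had := (ha.contDiffAt hNw).differentiableAt (by simp)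
  have hQd := (hQ.contDiffAt hNw).differentiableAt (by simp)
  have hdad := ((ha.fderiv_of_isOpen (m := ∞) hN (by simp)).contDiffAt hNw).differentiableAt
    (by simp)
  have hframe : HasFDerivAt (fun p : PhaseSpace n × PhaseSpace n => Q (κ p.1)) _ (w, 0) :=
    HasFDerivAt.comp (g := Q) (w, (0 : PhaseSpace n)) hQd.hasFDerivAt hbase
  have hnormal : HasFDerivAt (fun p : PhaseSpace n × PhaseSpace n => Q (κ p.1) p.2)
      ((Q (κ w)).comp (ContinuousLinearMap.snd ℝ _ _)) (w, 0) := by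
    refine (hframe.clm_apply hasFDerivAt_snd).congr_fderiv (ContinuousLinearMap.ext fun p => ?_)
    simp
  have hda : DifferentiableAt ℝ (fun p : PhaseSpace n × PhaseSpace n => fderiv ℝ a (κ p.1))
      (w, 0) := DifferentiableAt.comp (g := fderiv ℝ a) (w, (0 : PhaseSpace n)) hdad
        hbase.differentiableAt
  have hform : HasFDerivAt (fun p : PhaseSpace n × PhaseSpace n => a (κ p.1)) _ (w, 0) :=
    HasFDerivAt.comp (g := a) (w, (0 : PhaseSpace n)) had.hasFDerivAt hbase
  have hΨ : HasFDerivAt (normalEmbedding κ a Q) _ (w, 0) := (hbase.add hnormal).prodMk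
    (hform.add (hasFDerivAt_flip_apply_of_eq_zero hda hnormal (by simp)))
  exact DFunLike.congr_fun hΨ.fderiv p

theorem dForm_pullback_liouvilleCLM {F : Type*} [NormedAddCommGroup F] [NormedSpace ℝ F]
    {Ψ : F → E × (E →L[ℝ] ℝ)} {p : F} (hΨ : ContDiffAt ℝ 2 Ψ p) (X Y : F) :
    dForm (fun y => (liouvilleCLM E (Ψ y)).comp (fderiv ℝ Ψ y)) p X Y =
      (fderiv ℝ Ψ p X).2 (fderiv ℝ Ψ p Y).1 - (fderiv ℝ Ψ p Y).2 (fderiv ℝ Ψ p X).1 :=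
  (dForm_pullback (θ := fun x => liouvilleCLM E x) hΨ (liouvilleCLM E).differentiableAt X Y).trans
    (dForm_liouvilleCLM _ _ _)

theorem dForm_pullback_normalEmbedding_zero {κ : PhaseSpace n → E} {V : Set (PhaseSpace n)}
    (hV : IsOpen V) (hκ : ContDiffOn ℝ ∞ κ V) {N : Set E} (hN : IsOpen N) (hκN : MapsTo κ V N)
    {a : E → E →L[ℝ] ℝ} (ha : ContDiffOn ℝ ∞ a N)
    {Q : E → PhaseSpace n →L[ℝ] E} (hQ : ContDiffOn ℝ ∞ Q N) {w : PhaseSpace n} (hw : w ∈ V)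
    (hQa : ∀ X Y, dForm a (κ w) (Q (κ w) X) (Q (κ w) Y) = -stdForm n X Y)
    (hκa : ∀ X Y, dForm a (κ w) (fderiv ℝ κ w X) (fderiv ℝ κ w Y) = stdForm n X Y) :
    dForm (fun p => (liouvilleCLM E (normalEmbedding κ a Q p)).comp
      (fderiv ℝ (normalEmbedding κ a Q) p)) (w, 0) = dForm (fun p => prodPrimitive n p) (w, 0) := by
  have hκd : DifferentiableAt ℝ κ w :=
    (hκ.contDiffAt (hV.mem_nhds hw)).differentiableAt (by simp)
  have hΨ : ContDiffAt ℝ ∞ (normalEmbedding κ a Q) (w, 0) :=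
    (contDiffOn_normalEmbedding hκ hN hκN ha hQ).contDiffAt
      ((hV.prod isOpen_univ).mem_nhds ⟨hw, mem_univ _⟩)
  refine ContinuousLinearMap.ext fun X => ContinuousLinearMap.ext fun Y => ?_
  have htangent := hκa X.1 Y.1
  have hnormal := hQa X.2 Y.2
  rw [dForm_apply] at htangent hnormal
  rw [dForm_pullback_liouvilleCLM (hΨ.of_le two_le_infty), dForm_prodPrimitive]
  simp only [fderiv_normalEmbedding hN hκd (hκN hw) ha hQ, map_add, add_apply,
    ContinuousLinearMap.flip_apply, prodForm]
  linarith

theorem isInvertible_of_symplectic [FiniteDimensional ℝ E] (hn : Module.finrank ℝ E = 2 * n)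
    {T : PhaseSpace n × PhaseSpace n →L[ℝ] E × (E →L[ℝ] ℝ)}
    (hT : ∀ X Y, (T X).2 (T Y).1 - (T Y).2 (T X).1 = prodForm n X Y) : T.IsInvertible := by
  have hdim : Module.finrank ℝ (PhaseSpace n × PhaseSpace n) =
      Module.finrank ℝ (E × (E →L[ℝ] ℝ)) := by
    rw [Module.finrank_prod, Module.finrank_prod, finrank_dual_eq, hn, finrank_euclideanSpace,
      Fintype.card_sum, Fintype.card_fin, two_mul]
  refine isInvertible_of_injective hdim ((injective_iff_map_eq_zero _).2 fun X hX => ?_)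
  exact eq_zero_of_prodForm fun Y => by simp [← hT, hX]

/-- The embedding of the normal bundle is symplectic along the zero section only; a relative Darboux
correction, tangent to the identity there, makes it symplectic nearby. -/
theorem exists_symplectic_map {N : Set E} (hN : IsOpen N)
    {a : E → E →L[ℝ] ℝ} (ha : ContDiffOn ℝ ∞ a N) {Q : E → PhaseSpace n →L[ℝ] E}
    (hQ : ContDiffOn ℝ ∞ Q N)
    (hQa : ∀ x ∈ N, ∀ X Y, dForm a x (Q x X) (Q x Y) = -stdForm n X Y)
    {κ : PhaseSpace n → E} {V : Set (PhaseSpace n)} (hV : IsOpen V) (h₀ : 0 ∈ V)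
    (hκN : MapsTo κ V N) (hκ : ContDiffOn ℝ ∞ κ V)
    (hκa : ∀ w ∈ V, ∀ X Y, dForm a (κ w) (fderiv ℝ κ w X) (fderiv ℝ κ w Y) = stdForm n X Y) :
    ∃ (U : Set (PhaseSpace n × PhaseSpace n))
      (Φ : PhaseSpace n × PhaseSpace n → E × (E →L[ℝ] ℝ)),
      IsOpen U ∧ (0, 0) ∈ U ∧ U ⊆ V ×ˢ univ ∧ ContDiffOn ℝ ∞ Φ U ∧
      (∀ p ∈ U, ∀ X Y, (fderiv ℝ Φ p X).2 (fderiv ℝ Φ p Y).1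
        - (fderiv ℝ Φ p Y).2 (fderiv ℝ Φ p X).1 = prodForm n X Y) ∧
      ∀ w, (w, (0 : PhaseSpace n)) ∈ U → Φ (w, 0) = (κ w, a (κ w)) ∧
        ∀ z, fderiv ℝ Φ (w, 0) (0, z) = (Q (κ w) z, (fderiv ℝ a (κ w)).flip (Q (κ w) z)) := by
  set Ψ := normalEmbedding κ a Q with hΨdef
  have hU : IsOpen (V ×ˢ (univ : Set (PhaseSpace n))) := hV.prod isOpen_univ
  have hΨ : ContDiffOn ℝ ∞ Ψ (V ×ˢ univ) := contDiffOn_normalEmbedding hκ hN hκN ha hQ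
  have hΨAt : ∀ p ∈ V ×ˢ (univ : Set (PhaseSpace n)), ContDiffAt ℝ ∞ Ψ p := fun p hp =>
    hΨ.contDiffAt (hU.mem_nhds hp)
  let P : (PhaseSpace n × PhaseSpace n) →L[ℝ] (PhaseSpace n × PhaseSpace n) :=
    (ContinuousLinearMap.inl ℝ _ _).comp (ContinuousLinearMap.fst ℝ _ _)
  have hzero : ∀ p ∈ V ×ˢ (univ : Set (PhaseSpace n)), P p = p →
      dForm (fun y => (liouvilleCLM E (Ψ y)).comp (fderiv ℝ Ψ y)) p =
        dForm (fun p => prodPrimitive n p) p := by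
    rintro ⟨w, z⟩ hp hPp
    obtain rfl : z = 0 := (congrArg Prod.snd hPp).symm
    exact dForm_pullback_normalEmbedding_zero hV hκ hN hκN ha hQ hp.1 (hQa _ (hκN hp.1))
      (hκa w hp.1)
  obtain ⟨e, he₀, hesource, hetarget, he, -, hpull, hfix⟩ := exists_relative_darboux
    (P := P) (fun _ => rfl) hU (prodPrimitive n).contDiff.contDiffOn
    (contDiffOn_pullback hU hΨ ((liouvilleCLM E).contDiff.contDiffOn (s := univ))
      fun x _ => mem_univ _)
    (p₀ := ((0, 0) : PhaseSpace n × PhaseSpace n)) ⟨h₀, mem_univ _⟩ rfl hzero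
    (isInvertible_dForm_prodPrimitive n _)
  have heU : ∀ p ∈ e.source, e p ∈ V ×ˢ univ := fun p hp => hetarget (e.map_source hp)
  have hΦd : ∀ p ∈ e.source, HasFDerivAt (fun p => Ψ (e p))
      ((fderiv ℝ Ψ (e p)).comp (fderiv ℝ e p)) p := fun p hp => HasFDerivAt.comp p
    ((hΨAt _ (heU p hp)).differentiableAt (by simp)).hasFDerivAt
    ((he.contDiffAt (e.open_source.mem_nhds hp)).differentiableAt (by simp)).hasFDerivAt
  refine ⟨e.source, fun p => Ψ (e p), e.open_source, he₀, hesource, hΨ.comp he heU,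
    fun p hp X Y => ?_, fun w hw => ?_⟩
  · rw [← dForm_prodPrimitive n p, ← hpull p hp,
      dForm_pullback_liouvilleCLM ((hΨAt _ (heU p hp)).of_le two_le_infty), (hΦd p hp).fderiv]
    rfl
  · obtain ⟨hew, hdew⟩ := hfix (w, 0) hw rfl
    have hwV : w ∈ V := (hesource hw).1
    have hκd := (hκ.contDiffAt (hV.mem_nhds hwV)).differentiableAt (by simp)
    refine ⟨by simp [hew, hΨdef, normalEmbedding], fun z => ?_⟩
    rw [(hΦd _ hw).fderiv, hew, hdew, ContinuousLinearMap.comp_id,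
      fderiv_normalEmbedding hN hκd (hκN hwV) ha hQ]
    simp

theorem exists_symplectic_normalForm [FiniteDimensional ℝ E]
    (hn : Module.finrank ℝ E = 2 * n) {N : Set E} (hN : IsOpen N)
    {a : E → E →L[ℝ] ℝ} (ha : ContDiffOn ℝ ∞ a N) {Q : E → PhaseSpace n →L[ℝ] E}
    (hQ : ContDiffOn ℝ ∞ Q N)
    (hQa : ∀ x ∈ N, ∀ X Y, dForm a x (Q x X) (Q x Y) = -stdForm n X Y)
    {κ : PhaseSpace n → E} {V : Set (PhaseSpace n)} (hV : IsOpen V) (h₀ : 0 ∈ V)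
    (hκN : MapsTo κ V N) (hκ : ContDiffOn ℝ ∞ κ V)
    (hκa : ∀ w ∈ V, ∀ X Y, dForm a (κ w) (fderiv ℝ κ w X) (fderiv ℝ κ w Y) = stdForm n X Y) :
    ∃ Φ : OpenPartialHomeomorph (PhaseSpace n × PhaseSpace n) (E × (E →L[ℝ] ℝ)),
      ((0, 0) : PhaseSpace n × PhaseSpace n) ∈ Φ.source ∧ (∀ p ∈ Φ.source, p.1 ∈ V) ∧
      (∀ q ∈ Φ.target, q.1 ∈ N) ∧
      ContDiffOn ℝ ∞ Φ Φ.source ∧ ContDiffOn ℝ ∞ Φ.symm Φ.target ∧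
      (∀ p ∈ Φ.source, ∀ X Y, (fderiv ℝ Φ p X).2 (fderiv ℝ Φ p Y).1
        - (fderiv ℝ Φ p Y).2 (fderiv ℝ Φ p X).1 = prodForm n X Y) ∧
      ∀ w, (w, (0 : PhaseSpace n)) ∈ Φ.source → Φ (w, 0) = (κ w, a (κ w)) ∧
        ∀ z, fderiv ℝ Φ (w, 0) (0, z) = (Q (κ w) z, (fderiv ℝ a (κ w)).flip (Q (κ w) z)) := by
  obtain ⟨U, Φ₀, hU, h₀U, hUV, hΦ₀, hsymp, hzero⟩ :=
    exists_symplectic_map hN ha hQ hQa hV h₀ hκN hκ hκa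
  have hU' : IsOpen (U ∩ Φ₀ ⁻¹' (N ×ˢ univ)) :=
    hΦ₀.continuousOn.isOpen_inter_preimage hU (hN.prod isOpen_univ)
  have h₀U' : ((0, 0) : PhaseSpace n × PhaseSpace n) ∈ U ∩ Φ₀ ⁻¹' (N ×ˢ univ) :=
    ⟨h₀U, by rw [mem_preimage, (hzero 0 h₀U).1]; exact ⟨hκN h₀, mem_univ _⟩⟩
  obtain ⟨Φ, hΦ0, hΦU, rfl, hΦ, hΦ'⟩ := exists_contDiffOn_openPartialHomeomorph
    (n := ∞) (by simp) hU' (hΦ₀.mono inter_subset_left) h₀U'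
    (isInvertible_of_symplectic hn (hsymp _ h₀U))
  refine ⟨Φ, hΦ0, fun p hp => (hUV (hΦU hp).1).1, fun q hq => ?_, hΦ, hΦ',
    fun p hp => hsymp p (hΦU hp).1, fun w hw => hzero w (hΦU hw).1⟩
  have hq' := (hΦU (Φ.map_target hq)).2
  rw [mem_preimage, Φ.right_inv hq] at hq'
  exact hq'.1

end Weinstein

/-! ### The normal form in a chart -/

section CubicRemainder

variable {W Z E : Type*} [NormedAddCommGroup W] [NormedSpace ℝ W] [NormedAddCommGroup Z]
  [NormedSpace ℝ Z] [NormedAddCommGroup E] [NormedSpace ℝ E]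

theorem abs_sub_quadratic_le {G G₀ : (E →L[ℝ] ℝ) →L[ℝ] E} {r ρ : E →L[ℝ] ℝ} {C t : ℝ}
    (ht : 0 ≤ t) (hC : 0 ≤ C) (hr : ‖r‖ ≤ C * t) (hρ : ‖ρ‖ ≤ C * t) (hrρ : ‖r - ρ‖ ≤ C * t ^ 2)
    (hG : ‖G - G₀‖ ≤ C * t) (hG₀ : ‖G₀‖ ≤ C) :
    |r (G r) - ρ (G₀ ρ)| ≤ 3 * C ^ 3 * t ^ 3 := by
  have hsplit : r (G r) - ρ (G₀ ρ) = r ((G - G₀) r) + (r - ρ) (G₀ r) + ρ (G₀ (r - ρ)) := by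
    simp only [sub_apply, map_sub]
    ring
  have hbound : ∀ (p q : E →L[ℝ] ℝ) (A : (E →L[ℝ] ℝ) →L[ℝ] E), |p (A q)| ≤ ‖p‖ * (‖A‖ * ‖q‖) :=
    fun p q A => (p.le_opNorm _).trans (mul_le_mul_of_nonneg_left (A.le_opNorm q) (norm_nonneg _))
  calc |r (G r) - ρ (G₀ ρ)|
      ≤ |r ((G - G₀) r)| + |(r - ρ) (G₀ r)| + |ρ (G₀ (r - ρ))| := hsplit ▸ abs_add_three _ _ _
    _ ≤ ‖r‖ * (‖G - G₀‖ * ‖r‖) + ‖r - ρ‖ * (‖G₀‖ * ‖r‖) + ‖ρ‖ * (‖G₀‖ * ‖r - ρ‖) :=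
        add_le_add_three (hbound _ _ _) (hbound _ _ _) (hbound _ _ _)
    _ ≤ C * t * (C * t * (C * t)) + C * t ^ 2 * (C * (C * t)) + C * t * (C * (C * t ^ 2)) := by
        gcongr
    _ = 3 * C ^ 3 * t ^ 3 := by ring

theorem exists_abs_sub_quadratic_le {U : Set (W × Z)} (hU : IsOpen U)
    {r ρ : W × Z → E →L[ℝ] ℝ} {G G₀ : W × Z → (E →L[ℝ] ℝ) →L[ℝ] E}
    (hr : ContDiffOn ℝ 2 r U) (hρ : ContDiffOn ℝ 2 ρ U) (hG : ContDiffOn ℝ 1 G U)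
    (hG₀ : ContDiffOn ℝ 1 G₀ U) {w₀ : W} (h₀ : (w₀, (0 : Z)) ∈ U)
    (hr₀ : ∀ w, (w, (0 : Z)) ∈ U → r (w, 0) = 0) (hρ₀ : ∀ w, (w, (0 : Z)) ∈ U → ρ (w, 0) = 0)
    (hGG₀ : ∀ w, (w, (0 : Z)) ∈ U → G (w, 0) = G₀ (w, 0))
    (hrρ : ∀ w, (w, (0 : Z)) ∈ U → ∀ z, fderiv ℝ r (w, 0) (0, z) = fderiv ℝ ρ (w, 0) (0, z)) :
    ∃ C : ℝ, ∀ᶠ p in 𝓝 (w₀, (0 : Z)), |r p (G p (r p)) - ρ p (G₀ p (ρ p))| ≤ C * ‖p.2‖ ^ 3 := by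
  obtain ⟨C₁, hC₁, hr_le⟩ := exists_norm_le_of_vanishing hU (hr.of_le one_le_two) h₀ hr₀
  obtain ⟨C₂, hC₂, hρ_le⟩ := exists_norm_le_of_vanishing hU (hρ.of_le one_le_two) h₀ hρ₀
  obtain ⟨C₃, hC₃, hG_le⟩ := exists_norm_le_of_vanishing hU (hG.sub hG₀) h₀
    fun w hw => sub_eq_zero.2 (hGG₀ w hw)
  obtain ⟨C₄, hC₄, hrρ_le⟩ := exists_norm_le_sq_of_vanishing hU (hr.sub hρ) h₀
    (fun w hw => by rw [hr₀ w hw, hρ₀ w hw, sub_zero]) fun w hw z => by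
      have hUw := hU.mem_nhds hw
      rw [fderiv_fun_sub ((hr.contDiffAt hUw).differentiableAt two_ne_zero)
        ((hρ.contDiffAt hUw).differentiableAt two_ne_zero), sub_apply, hrρ w hw z, sub_self]
  have hG₀_lt := (hG₀.continuousOn.continuousAt (hU.mem_nhds h₀)).norm.eventually_lt_const
    (lt_add_one _)
  set C₅ := ‖G₀ (w₀, 0)‖ + 1
  have hC₅ : 0 ≤ C₅ := by positivity
  refine ⟨3 * (C₁ + C₂ + C₃ + C₄ + C₅) ^ 3, ?_⟩
  filter_upwards [hr_le, hρ_le, hG_le, hrρ_le, hG₀_lt] with p hrp hρp hGp hrρp hG₀p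
  exact abs_sub_quadratic_le (norm_nonneg _) (by positivity)
    (hrp.trans (by gcongr; linarith)) (hρp.trans (by gcongr; linarith))
    (hrρp.trans (by gcongr; linarith)) (hGp.trans (by gcongr; linarith)) (by linarith)

theorem fderiv_clm_apply_snd_zero {F : Type*} [NormedAddCommGroup F] [NormedSpace ℝ F]
    {L : W → Z →L[ℝ] F} {w : W} (hL : DifferentiableAt ℝ L w) (z : Z) :
    fderiv ℝ (fun p : W × Z => L p.1 p.2) (w, 0) (0, z) = L w z := by
  have hfst : HasFDerivAt (fun p : W × Z => L p.1) _ (w, 0) :=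
    HasFDerivAt.comp (g := L) (w, (0 : Z)) hL.hasFDerivAt hasFDerivAt_fst
  have happly : HasFDerivAt (fun p : W × Z => L p.1 p.2) _ (w, 0) :=
    hfst.clm_apply hasFDerivAt_snd
  exact (DFunLike.congr_fun happly.fderiv _).trans (by simp)

theorem fderiv_snd_sub_comp_fst {a : E → E →L[ℝ] ℝ} {Φ : W → E × (E →L[ℝ] ℝ)} {p : W}
    (hΦ : DifferentiableAt ℝ Φ p) (ha : DifferentiableAt ℝ a (Φ p).1) (v : W) :
    fderiv ℝ (fun p => (Φ p).2 - a (Φ p).1) p v =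
      (fderiv ℝ Φ p v).2 - fderiv ℝ a (Φ p).1 (fderiv ℝ Φ p v).1 := by
  have hsub : HasFDerivAt (fun p => (Φ p).2 - a (Φ p).1) _ p :=
    hΦ.hasFDerivAt.snd.sub (ha.hasFDerivAt.comp p hΦ.hasFDerivAt.fst)
  exact DFunLike.congr_fun hsub.fderiv v

/-- Along the fibre over `w`, the momentum relative to the graph of `a` is `-da(Q z, ·)` to first
order, so that the Hamiltonian is its value on this linear term up to a cubic error. -/
theorem exists_hamiltonian_expansion {n : ℕ} {N : Set E} (hN : IsOpen N)
    {a : E → E →L[ℝ] ℝ} (ha : ContDiffOn ℝ ∞ a N) {Q : E → PhaseSpace n →L[ℝ] E}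
    (hQ : ContDiffOn ℝ ∞ Q N) {G : E → (E →L[ℝ] ℝ) →L[ℝ] E} (hG : ContDiffOn ℝ ∞ G N)
    {κ : PhaseSpace n → E} {V : Set (PhaseSpace n)} (hV : IsOpen V) (hκN : MapsTo κ V N)
    (hκ : ContDiffOn ℝ ∞ κ V)
    {Φ : PhaseSpace n × PhaseSpace n → E × (E →L[ℝ] ℝ)} {U : Set (PhaseSpace n × PhaseSpace n)}
    (hU : IsOpen U) (h₀ : ((0, 0) : PhaseSpace n × PhaseSpace n) ∈ U)
    (hUV : ∀ p ∈ U, p.1 ∈ V) (hUN : ∀ p ∈ U, (Φ p).1 ∈ N) (hΦ : ContDiffOn ℝ ∞ Φ U)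
    (hΦ₀ : ∀ w, (w, (0 : PhaseSpace n)) ∈ U → Φ (w, 0) = (κ w, a (κ w)) ∧
        ∀ z, fderiv ℝ Φ (w, 0) (0, z) = (Q (κ w) z, (fderiv ℝ a (κ w)).flip (Q (κ w) z))) :
    ∃ C : ℝ, ∀ᶠ p in 𝓝 ((0, 0) : PhaseSpace n × PhaseSpace n),
      |((Φ p).2 - a (Φ p).1) (G (Φ p).1 ((Φ p).2 - a (Φ p).1))
        - (dForm a (κ p.1) (Q (κ p.1) p.2)) (G (κ p.1) (dForm a (κ p.1) (Q (κ p.1) p.2)))|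
      ≤ C * ‖p.2‖ ^ 3 := by
  let L : PhaseSpace n → PhaseSpace n →L[ℝ] E →L[ℝ] ℝ := fun w => -(dForm a (κ w)).comp (Q (κ w))
  have hL : ContDiffOn ℝ ∞ L V :=
    (((contDiffOn_dForm hN ha).comp hκ hκN).clm_comp (hQ.comp hκ hκN)).neg
  have hΦ₁ : ContDiffOn ℝ ∞ (fun p => (Φ p).1) U := hΦ.fst
  have hr : ContDiffOn ℝ ∞ (fun p => (Φ p).2 - a (Φ p).1) U := hΦ.snd.sub (ha.comp hΦ₁ hUN)
  have hρ : ContDiffOn ℝ ∞ (fun p : PhaseSpace n × PhaseSpace n => L p.1 p.2) U :=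
    (hL.comp contDiff_fst.contDiffOn hUV).clm_apply contDiff_snd.contDiffOn
  have hG₀ : ContDiffOn ℝ ∞ (fun p : PhaseSpace n × PhaseSpace n => G (κ p.1)) U :=
    (hG.comp hκ hκN).comp contDiff_fst.contDiffOn hUV
  obtain ⟨C, hC⟩ := exists_abs_sub_quadratic_le hU (hr.of_le two_le_infty)
    (hρ.of_le two_le_infty) ((hG.comp hΦ₁ hUN).of_le (by simp)) (hG₀.of_le (by simp)) h₀
    (fun w hw => by simp [(hΦ₀ w hw).1]) (fun w _ => map_zero _)
    (fun w hw => by simp [(hΦ₀ w hw).1]) fun w hw z => by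
      have hwV := hUV _ hw
      have hLw := (hL.contDiffAt (hV.mem_nhds hwV)).differentiableAt (by simp)
      have haw := (ha.contDiffAt (hN.mem_nhds (hUN _ hw))).differentiableAt (by simp)
      have hΦw := (hΦ.contDiffAt (hU.mem_nhds hw)).differentiableAt (by simp)
      rw [fderiv_snd_sub_comp_fst hΦw haw, fderiv_clm_apply_snd_zero hLw]
      ext Y
      simp [(hΦ₀ w hw).1, (hΦ₀ w hw).2, L, dForm_apply]
  refine ⟨C, hC.mono fun p hp => ?_⟩
  simpa only [L, neg_apply, ContinuousLinearMap.comp_apply, map_neg, neg_neg, Function.comp_apply]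
    using hp

end CubicRemainder

section LocalNormalForm

variable {n : ℕ} {E : Type*} [NormedAddCommGroup E] [NormedSpace ℝ E]

/-- The endomorphism `T` representing the bilinear form `σ` through the metric `γ`, that is
`γ (T X) Y = σ X Y`. For `σ` the magnetic form this is the magnetic operator. -/
def formOperator (γ σ : E →L[ℝ] E →L[ℝ] ℝ) : E →L[ℝ] E :=
  γ.inverse.comp σ

theorem inner_formOperator {γ σ : E →L[ℝ] E →L[ℝ] ℝ} (hγ : γ.IsInvertible) (X Y : E) :
    γ (formOperator γ σ X) Y = σ X Y :=
  DFunLike.congr_fun (hγ.self_apply_inverse (σ X)) Y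

theorem contDiffOn_inverse_metric [CompleteSpace E] {g : E → E →L[ℝ] E →L[ℝ] ℝ} {O : Set E}
    (hg : ContDiffOn ℝ ∞ g O) (hinv : ∀ x ∈ O, (g x).IsInvertible) :
    ContDiffOn ℝ ∞ (fun x => (g x).inverse) O := fun x hx =>
  (hinv x hx).contDiffAt_map_inverse.comp_contDiffWithinAt x (hg x hx)

variable [FiniteDimensional ℝ E]

theorem IsSkew.isInvertible {γ : E →L[ℝ] E →L[ℝ] ℝ} {T : E →L[ℝ] E} (h : IsSkew γ T) :
    γ.IsInvertible :=
  isInvertible_of_pos h.pos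

theorem isSkew_formOperator {γ σ : E →L[ℝ] E →L[ℝ] ℝ} (hsymm : ∀ X Y, γ X Y = γ Y X)
    (hpos : ∀ X, X ≠ 0 → 0 < γ X X) (halt : ∀ X Y, σ X Y = -σ Y X) :
    IsSkew γ (formOperator γ σ) :=
  ⟨hsymm, hpos, fun X Y => by
    have hγ := isInvertible_of_pos hpos
    rw [hsymm X, inner_formOperator hγ, inner_formOperator hγ, halt]⟩

theorem exists_contDiffOn_adaptedFrame (hn : Module.finrank ℝ E = 2 * n) {O : Set E}
    (hO : IsOpen O) {x₀ : E} (hx₀ : x₀ ∈ O) {a : E → E →L[ℝ] ℝ} (ha : ContDiffOn ℝ ∞ a O)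
    {g : E → E →L[ℝ] E →L[ℝ] ℝ} (hg : ContDiffOn ℝ ∞ g O)
    (hsymm : ∀ x ∈ O, ∀ X Y, g x X Y = g x Y X) (hpos : ∀ x ∈ O, ∀ X, X ≠ 0 → 0 < g x X X)
    (hinj : Function.Injective (formOperator (g x₀) (dForm a x₀)))
    (hs : ((formOperator (g x₀) (dForm a x₀) : E →ₗ[ℝ] E).charpoly.map
      (algebraMap ℝ ℂ)).roots.Nodup) :
    ∃ (N : Set E) (β : Fin n → E → ℝ) (u v : Fin n → E → E), IsOpen N ∧ N ⊆ O ∧ x₀ ∈ N ∧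
      (∀ j, ContDiffOn ℝ ∞ (β j) N) ∧
      ContDiffOn ℝ ∞ (fun x => frameMap (fun j => u j x) fun j => v j x) N ∧
      ∀ x ∈ N, IsAdaptedFrame (g x) (formOperator (g x) (dForm a x)) (fun j => β j x)
        (fun j => u j x) fun j => v j x := by
  have : CompleteSpace E := FiniteDimensional.complete ℝ E
  have hskew : ∀ x ∈ O, IsSkew (g x) (formOperator (g x) (dForm a x)) := fun x hx =>
    isSkew_formOperator (hsymm x hx) (hpos x hx) (dForm_swap a x)
  have hT : ContDiffOn ℝ ∞ (fun x => formOperator (g x) (dForm a x)) O :=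
    (contDiffOn_inverse_metric hg fun x hx => (hskew x hx).isInvertible).clm_comp
      (contDiffOn_dForm hO ha)
  obtain ⟨N, β, v, u, hN, hNO, hx₀N, hsmooth, hframe⟩ :=
    exists_contDiffOn_eigenframe hn hO hx₀ hg hT hskew hinj hs
  exact ⟨N, β, u, v, hN, hNO, hx₀N, fun j => (hsmooth j).1,
    contDiffOn_frameMap (fun j => (hsmooth j).2.2) fun j => (hsmooth j).2.1,
    fun x hx => ⟨hskew x (hNO hx), (hframe x hx).1, (hframe x hx).2⟩⟩

namespace IsAdaptedFrame

variable {γ σ : E →L[ℝ] E →L[ℝ] ℝ} {β : Fin n → ℝ} {u v : Fin n → E}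

theorem pullback_form (h : IsAdaptedFrame γ (formOperator γ σ) β u v) (X Y : PhaseSpace n) :
    σ (frameMap u v X) (frameMap u v Y) = -stdForm n X Y := by
  rw [← h.form_frameMap, inner_formOperator h.isSkew.isInvertible]

theorem dual_normSq (h : IsAdaptedFrame γ (formOperator γ σ) β u v) (z : PhaseSpace n) :
    σ (frameMap u v z) (γ.inverse (σ (frameMap u v z))) = ∑ j, β j * normSqAt z j := by
  rw [← h.normSq_frameMap, inner_formOperator h.isSkew.isInvertible]
  rfl

end IsAdaptedFrame

/-- The conclusion of the normal form theorem for the metric `g` and the potential `a` on an open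
subset of a vector space: `χ` are Darboux coordinates for `da`, and `Φ` is a symplectic
parametrization of a neighbourhood of the graph of `a` in `E × E*` in which the Hamiltonian
`|p - a(x)|²` is `∑ β_j |z_j|²` up to `C |z|³`, for `|z| ≤ ε`. -/
structure IsMagneticNormalForm (g : E → E →L[ℝ] E →L[ℝ] ℝ) (a : E → E →L[ℝ] ℝ)
    (β : Fin n → E → ℝ) (χ : OpenPartialHomeomorph E (PhaseSpace n))
    (Φ : OpenPartialHomeomorph (PhaseSpace n × PhaseSpace n) (E × (E →L[ℝ] ℝ))) (ε C : ℝ) :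
    Prop where
  contDiffOn_base : ContDiffOn ℝ ∞ χ χ.source
  contDiffOn_base_symm : ContDiffOn ℝ ∞ χ.symm χ.target
  symplectic_base : ∀ w ∈ χ.target, ∀ X Y,
    dForm a (χ.symm w) (fderiv ℝ χ.symm w X) (fderiv ℝ χ.symm w Y) = stdForm n X Y
  contDiffOn : ContDiffOn ℝ ∞ Φ Φ.source
  contDiffOn_symm : ContDiffOn ℝ ∞ Φ.symm Φ.target
  symplectic : ∀ p ∈ Φ.source, ∀ X Y, (fderiv ℝ Φ p X).2 (fderiv ℝ Φ p Y).1
    - (fderiv ℝ Φ p Y).2 (fderiv ℝ Φ p X).1 = prodForm n X Y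
  prod_subset_source : χ.target ×ˢ Metric.closedBall 0 ε ⊆ Φ.source
  apply_zero : ∀ x ∈ χ.source, Φ (χ x, 0) = (x, a x)
  abs_sub_le : ∀ w ∈ χ.target, ∀ z, ‖z‖ ≤ ε →
    |((Φ (w, z)).2 - a (Φ (w, z)).1) ((g (Φ (w, z)).1).inverse ((Φ (w, z)).2 - a (Φ (w, z)).1))
      - ∑ j, β j (χ.symm w) * normSqAt z j| ≤ C * ‖z‖ ^ 3

theorem exists_darboux_chart_of_adaptedFrame (hn : Module.finrank ℝ E = 2 * n) {N : Set E}
    (hN : IsOpen N) {x₀ : E} (hx₀ : x₀ ∈ N) {a : E → E →L[ℝ] ℝ} (ha : ContDiffOn ℝ ∞ a N)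
    {γ : E →L[ℝ] E →L[ℝ] ℝ} {β : Fin n → ℝ} {u v : Fin n → E}
    (hframe : IsAdaptedFrame γ (formOperator γ (dForm a x₀)) β u v) :
    ∃ κ : OpenPartialHomeomorph (PhaseSpace n) E, 0 ∈ κ.source ∧ κ 0 = x₀ ∧ κ.target ⊆ N ∧
      ContDiffOn ℝ ∞ κ κ.source ∧ ContDiffOn ℝ ∞ κ.symm κ.target ∧
      ∀ w ∈ κ.source, ∀ X Y,
        dForm a (κ w) (fderiv ℝ κ w X) (fderiv ℝ κ w Y) = stdForm n X Y := by
  obtain ⟨L, hL⟩ := isInvertible_of_injective (by simp [hn, two_mul]) hframe.injective_frameMap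
  have hLz : ∀ z, L z = frameMap u v z := DFunLike.congr_fun hL
  -- The frame is anti-symplectic, and exchanging `x` and `ξ` restores the sign.
  refine exists_darboux_chart hN hx₀ ha ((swapCLE n).trans L) fun X Y => ?_
  rw [ContinuousLinearEquiv.trans_apply, ContinuousLinearEquiv.trans_apply, hLz, hLz,
    hframe.pullback_form, stdForm_swapCLE, neg_neg]

theorem exists_isMagneticNormalForm_of_adaptedFrame (hn : Module.finrank ℝ E = 2 * n) {N : Set E}
    (hN : IsOpen N) {x₀ : E} (hx₀ : x₀ ∈ N) {a : E → E →L[ℝ] ℝ} (ha : ContDiffOn ℝ ∞ a N)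
    {g : E → E →L[ℝ] E →L[ℝ] ℝ} (hg : ContDiffOn ℝ ∞ g N) {β : Fin n → E → ℝ}
    {u v : Fin n → E → E}
    (hQ : ContDiffOn ℝ ∞ (fun x => frameMap (fun j => u j x) fun j => v j x) N)
    (hframe : ∀ x ∈ N, IsAdaptedFrame (g x) (formOperator (g x) (dForm a x)) (fun j => β j x)
      (fun j => u j x) fun j => v j x) :
    ∃ (χ : OpenPartialHomeomorph E (PhaseSpace n))
      (Φ : OpenPartialHomeomorph (PhaseSpace n × PhaseSpace n) (E × (E →L[ℝ] ℝ))) (ε C : ℝ),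
      x₀ ∈ χ.source ∧ χ.source ⊆ N ∧ (∀ q ∈ Φ.target, q.1 ∈ N) ∧ 0 < ε ∧
      IsMagneticNormalForm g a β χ Φ ε C := by
  have : CompleteSpace E := FiniteDimensional.complete ℝ E
  have hginv := contDiffOn_inverse_metric hg fun x hx => (hframe x hx).isSkew.isInvertible
  obtain ⟨κ, hκ₀, hκx₀, hκN, hκ, hκ', hκa⟩ :=
    exists_darboux_chart_of_adaptedFrame hn hN hx₀ ha (hframe x₀ hx₀)
  have hκmaps : MapsTo κ κ.source N := fun w hw => hκN (κ.map_source hw)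
  obtain ⟨Φ, hΦ₀, hΦκ, hΦN, hΦ, hΦ', hsymp, hjet⟩ := exists_symplectic_normalForm hn hN ha hQ
    (fun x hx => (hframe x hx).pullback_form) κ.open_source hκ₀ hκmaps hκ hκa
  obtain ⟨C, hC⟩ := exists_hamiltonian_expansion hN ha hQ hginv κ.open_source hκmaps hκ
    Φ.open_source hΦ₀ hΦκ (fun p hp => hΦN _ (Φ.map_source hp)) hΦ hjet
  obtain ⟨⟨δ, ε⟩, ⟨hδ, hε⟩, hball⟩ :=
    (Metric.nhds_basis_ball.prod_nhds Metric.nhds_basis_closedBall).eventually_iff.1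
      (hC.and (Φ.open_source.eventually_mem hΦ₀))
  have hmem : ∀ w ∈ Metric.ball (0 : PhaseSpace n) δ, ∀ z : PhaseSpace n, ‖z‖ ≤ ε →
      (w, z) ∈ Metric.ball (0 : PhaseSpace n) δ ×ˢ Metric.closedBall (0 : PhaseSpace n) ε :=
    fun w hw z hz => mk_mem_prod hw (mem_closedBall_zero_iff.2 hz)
  refine ⟨(κ.restrOpen (Metric.ball 0 δ) Metric.isOpen_ball).symm, Φ, ε, C,
    ⟨hκx₀ ▸ κ.map_source hκ₀, ?_⟩, fun x hx => hκN hx.1, hΦN, hε, ?_⟩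
  · simpa [← hκx₀, κ.left_inv hκ₀] using hδ
  · exact
    { contDiffOn_base := hκ'.mono fun x hx => hx.1
      contDiffOn_base_symm := hκ.mono fun w hw => hw.1
      symplectic_base := fun w hw => hκa w hw.1
      contDiffOn := hΦ
      contDiffOn_symm := hΦ'
      symplectic := hsymp
      prod_subset_source := fun p hp => (hball ⟨hp.1.2, hp.2⟩).2
      apply_zero := fun x hx => by
        refine (hjet (κ.symm x) (hball (hmem _ hx.2 0 (by simpa using hε.le))).2).1.trans ?_
        rw [κ.right_inv hx.1]
      abs_sub_le := fun w hw z hz => by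
        have hexp := (hball (hmem w hw.2 z hz)).1
        rwa [(hframe _ (hκmaps hw.1)).dual_normSq] at hexp }

theorem exists_isMagneticNormalForm (hn : Module.finrank ℝ E = 2 * n) {O : Set E} (hO : IsOpen O)
    {x₀ : E} (hx₀ : x₀ ∈ O) {a : E → E →L[ℝ] ℝ} (ha : ContDiffOn ℝ ∞ a O)
    {g : E → E →L[ℝ] E →L[ℝ] ℝ} (hg : ContDiffOn ℝ ∞ g O)
    (hsymm : ∀ x ∈ O, ∀ X Y, g x X Y = g x Y X) (hpos : ∀ x ∈ O, ∀ X, X ≠ 0 → 0 < g x X X)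
    (hinj : Function.Injective (formOperator (g x₀) (dForm a x₀)))
    (hs : ((formOperator (g x₀) (dForm a x₀) : E →ₗ[ℝ] E).charpoly.map
      (algebraMap ℝ ℂ)).roots.Nodup) :
    ∃ (β : Fin n → E → ℝ) (χ : OpenPartialHomeomorph E (PhaseSpace n))
      (Φ : OpenPartialHomeomorph (PhaseSpace n × PhaseSpace n) (E × (E →L[ℝ] ℝ))) (ε C : ℝ),
      x₀ ∈ χ.source ∧ χ.source ⊆ O ∧ (∀ q ∈ Φ.target, q.1 ∈ O) ∧ 0 < ε ∧
      (∀ j, ContDiffOn ℝ ∞ (β j) χ.source) ∧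
      (∀ x ∈ χ.source, (∀ j, 0 < β j x) ∧
        ((formOperator (g x) (dForm a x) : E →ₗ[ℝ] E).charpoly.map
          (algebraMap ℝ ℂ)).roots.Nodup ∧
        ((formOperator (g x) (dForm a x) : E →ₗ[ℝ] E).charpoly.map (algebraMap ℝ ℂ)).roots =
          ∑ j, {(β j x : ℂ) * Complex.I, -((β j x : ℂ) * Complex.I)}) ∧
      IsMagneticNormalForm g a β χ Φ ε C := by
  obtain ⟨N, β, u, v, hN, hNO, hx₀N, hβ, hQ, hframe⟩ :=
    exists_contDiffOn_adaptedFrame hn hO hx₀ ha hg hsymm hpos hinj hs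
  obtain ⟨χ, Φ, ε, C, hxχ, hχN, hΦN, hε, hnormal⟩ :=
    exists_isMagneticNormalForm_of_adaptedFrame hn hN hx₀N (ha.mono hNO) (hg.mono hNO) hQ hframe
  exact ⟨β, χ, Φ, ε, C, hxχ, hχN.trans hNO, fun q hq => hNO (hΦN q hq), hε,
    fun j => (hβ j).mono hχN, fun x hx =>
      have hrot := (hframe x (hχN hx)).isRotationSystem
      ⟨hrot.pos, hrot.nodup_roots_charpoly_and_eq (by simpa)⟩, hnormal⟩

end LocalNormalForm

/-! ### Forms in charts -/

section Naturality

variable {E' : Type*} [NormedAddCommGroup E'] [NormedSpace ℝ E']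
  {F : Type*} [NormedAddCommGroup F] [NormedSpace ℝ F]
  {G : Type*} [TopologicalSpace G] {J : ModelWithCorners ℝ F G}
  {N : Type*} [TopologicalSpace N] [ChartedSpace G N]

theorem extChartAt_symm_mem_chartAt_source {c : N} {x : F} (hx : x ∈ (extChartAt J c).target) :
    (extChartAt J c).symm x ∈ (chartAt G c).source := by
  rw [← extChartAt_source J]
  exact (extChartAt J c).map_target hx

/-- The pullback of a `1`-form on a manifold by a map defined on a vector space. -/
def pullbackOneForm (α : ∀ q : N, TangentSpace J q →L[ℝ] ℝ) (f : E' → N) (y : E') : E' →L[ℝ] ℝ :=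
  (α (f y)).comp (mfderiv 𝓘(ℝ, E') J f y)

theorem oneForm_apply_congr (α : ∀ q : N, TangentSpace J q →L[ℝ] ℝ) {q q' : N} (h : q = q')
    (v : F) : (α q : F →L[ℝ] ℝ) v = (α q' : F →L[ℝ] ℝ) v := by
  subst h
  rfl

variable [IsManifold J ∞ N]

theorem hasMFDerivAt_of_chart {f : E' → N} {y : E'} {c : N} (hc : f y ∈ (chartAt G c).source)
    (hf : MDifferentiableAt 𝓘(ℝ, E') J f y) :
    HasMFDerivAt 𝓘(ℝ, E') J f y
      ((mfderivWithin 𝓘(ℝ, F) J (extChartAt J c).symm (range J) (extChartAt J c (f y))).comp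
        (fderiv ℝ (fun y => extChartAt J c (f y)) y)) := by
  have : IsManifold J 1 N := IsManifold.of_le (n := ∞) (by simp)
  have hsrc : f y ∈ (extChartAt J c).source := by rwa [extChartAt_source]
  have hF : MDifferentiableAt 𝓘(ℝ, E') 𝓘(ℝ, F) (fun y => extChartAt J c (f y)) y :=
    (mdifferentiableAt_extChartAt hc).comp y hf
  have hF' : HasMFDerivAt 𝓘(ℝ, E') 𝓘(ℝ, F) (fun y => extChartAt J c (f y)) y
      (fderiv ℝ (fun y => extChartAt J c (f y)) y) :=
    (mdifferentiableAt_iff_differentiableAt.mp hF).hasFDerivAt.hasMFDerivAt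
  have hK := (mdifferentiableWithinAt_extChartAt_symm
    ((extChartAt J c).map_source hsrc)).hasMFDerivWithinAt
  have hev : ∀ᶠ t in 𝓝 y, f t ∈ (extChartAt J c).source :=
    hf.continuousAt.preimage_mem_nhds (extChartAt_source_mem_nhds' hsrc)
  have hcomp := hK.comp y (hF'.hasMFDerivWithinAt (s := univ)) fun t _ => mem_range_self _
  rw [hasMFDerivWithinAt_univ] at hcomp
  refine hcomp.congr_of_eventuallyEq ?_
  filter_upwards [hev] with t ht
  exact ((extChartAt J c).left_inv ht).symm

theorem pullbackOneForm_eq_of_chart (α : ∀ q : N, TangentSpace J q →L[ℝ] ℝ) {f : E' → N} {y : E'}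
    {c : N} (hc : f y ∈ (chartAt G c).source) (hf : MDifferentiableAt 𝓘(ℝ, E') J f y) :
    pullbackOneForm α f y = (oneFormInChart J α c (extChartAt J c (f y))).comp
      (fderiv ℝ (fun y => extChartAt J c (f y)) y) := by
  have hsrc : f y ∈ (extChartAt J c).source := by rwa [extChartAt_source]
  ext X
  rw [pullbackOneForm, (hasMFDerivAt_of_chart hc hf).mfderiv]
  exact oneForm_apply_congr α ((extChartAt J c).left_inv hsrc).symm _

theorem eventually_pullbackOneForm_eq_of_chart (α : ∀ q : N, TangentSpace J q →L[ℝ] ℝ)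
    {f : E' → N} {x : E'} (hf : ContMDiffAt 𝓘(ℝ, E') J ∞ f x) :
    pullbackOneForm α f =ᶠ[𝓝 x] fun y =>
      (oneFormInChart J α (f x) (extChartAt J (f x) (f y))).comp
        (fderiv ℝ (fun y => extChartAt J (f x) (f y)) y) := by
  have : IsManifold J 2 N := IsManifold.of_le (n := ∞) (by exact two_le_infty)
  have hf₂ : ContMDiffAt 𝓘(ℝ, E') J 2 f x := hf.of_le (by exact two_le_infty)
  filter_upwards [(contMDiffAt_iff_contMDiffAt_nhds (by simp)).1 hf₂,
    hf.continuousAt.preimage_mem_nhds (chart_source_mem_nhds G (f x))] with y hfy hy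
  exact pullbackOneForm_eq_of_chart α hy (hfy.mdifferentiableAt (by simp))

theorem mfderiv_extChartAt_mfderiv {f : E' → N} {x : E'}
    (hf : MDifferentiableAt 𝓘(ℝ, E') J f x) (Z : E') :
    mfderiv J 𝓘(ℝ, F) (extChartAt J (f x)) (f x) (mfderiv 𝓘(ℝ, E') J f x Z) =
      fderiv ℝ (fun y => extChartAt J (f x) (f y)) x Z := by
  have : IsManifold J 1 N := IsManifold.of_le (n := ∞) (by simp)
  rw [← mfderiv_comp_apply (x := x)
    (mdifferentiableAt_extChartAt (I := J) (mem_chart_source G (f x))) hf Z, ← mfderiv_eq_fderiv]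
  rfl

theorem extDerivOneForm_pullback (α : ∀ q : N, TangentSpace J q →L[ℝ] ℝ) {f : E' → N} {x : E'}
    (hf : ContMDiffAt 𝓘(ℝ, E') J ∞ f x)
    (hα : DifferentiableWithinAt ℝ (oneFormInChart J α (f x)) (range J)
      (extChartAt J (f x) (f x))) (X Y : E') :
    extDerivOneForm J α (f x) (mfderiv 𝓘(ℝ, E') J f x X) (mfderiv 𝓘(ℝ, E') J f x Y) =
      dForm (pullbackOneForm α f) x X Y := by
  have hf₀ : ContDiffAt ℝ ∞ (fun y => extChartAt J (f x) (f y)) x :=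
    contMDiffAt_iff_contDiffAt.1 (contMDiffAt_extChartAt.comp x hf)
  have hd := hf.mdifferentiableAt (by simp)
  rw [extDerivOneForm_apply, mfderiv_extChartAt_mfderiv hd, mfderiv_extChartAt_mfderiv hd, dForm,
    (eventually_pullbackOneForm_eq_of_chart α hf).fderiv_eq]
  exact (dForm_pullback_of_hasFDerivWithinAt (hf₀.of_le (by exact two_le_infty))
    (hα.hasFDerivWithinAt.mono (range_subset_iff.2 fun y => mem_range_self _)) X Y).symm

end Naturality

section InteriorChart

variable {F : Type*} [NormedAddCommGroup F] [NormedSpace ℝ F]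
  {G : Type*} [TopologicalSpace G] (J : ModelWithCorners ℝ F G)
  {N : Type*} [TopologicalSpace N] [ChartedSpace G N]

/-- The preferred chart at `c`, restricted to the preimage of the interior of its target. -/
def interiorChart (c : N) : OpenPartialHomeomorph N F where
  toFun := extChartAt J c
  invFun := (extChartAt J c).symm
  source := (extChartAt J c).source ∩ extChartAt J c ⁻¹' interior (extChartAt J c).target
  target := interior (extChartAt J c).target
  map_source' _ hq := hq.2
  map_target' x hx := ⟨(extChartAt J c).map_target (interior_subset hx), by
    rw [mem_preimage, (extChartAt J c).right_inv (interior_subset hx)]; exact hx⟩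
  left_inv' _ hq := (extChartAt J c).left_inv hq.1
  right_inv' _ hx := (extChartAt J c).right_inv (interior_subset hx)
  open_source := isOpen_extChartAt_preimage' c isOpen_interior
  open_target := isOpen_interior
  continuousOn_toFun := (continuousOn_extChartAt c).mono inter_subset_left
  continuousOn_invFun := (continuousOn_extChartAt_symm c).mono interior_subset

theorem interiorChart_target (c : N) :
    (interiorChart J c).target = interior (extChartAt J c).target := rfl

theorem interiorChart_source_subset (c : N) :
    (interiorChart J c).source ⊆ (chartAt G c).source := fun _ hq => by
  rw [← extChartAt_source J]
  exact hq.1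

theorem mfderivWithin_extChartAt_symm_eq {c : N} {x : F}
    (hx : x ∈ (interiorChart J c).target) :
    mfderivWithin 𝓘(ℝ, F) J (extChartAt J c).symm (range J) x =
      mfderiv 𝓘(ℝ, F) J (extChartAt J c).symm x :=
  mfderivWithin_of_mem_nhds (mem_of_superset (isOpen_interior.mem_nhds hx)
    (interior_subset.trans (extChartAt_target_subset_range c)))

theorem pullbackOneForm_extChartAt_symm (α : ∀ q : N, TangentSpace J q →L[ℝ] ℝ) {c : N} {x : F}
    (hx : x ∈ (interiorChart J c).target) :
    pullbackOneForm α (extChartAt J c).symm x = oneFormInChart J α c x := by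
  rw [pullbackOneForm, oneFormInChart, mfderivWithin_extChartAt_symm_eq J hx]

variable [IsManifold J ∞ N]

theorem contMDiffOn_interiorChart (c : N) :
    ContMDiffOn J 𝓘(ℝ, F) ∞ (interiorChart J c) (interiorChart J c).source :=
  contMDiffOn_extChartAt.mono (interiorChart_source_subset J c)

theorem contMDiffOn_interiorChart_symm (c : N) :
    ContMDiffOn 𝓘(ℝ, F) J ∞ (interiorChart J c).symm (interiorChart J c).target :=
  (contMDiffOn_extChartAt_symm c).mono interior_subset

theorem mfderiv_interiorChart_symm_comp {E' : Type*} [NormedAddCommGroup E'] [NormedSpace ℝ E']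
    {c : N} {f : E' → F} {x : E'} (hf : DifferentiableAt ℝ f x)
    (hx : f x ∈ (interiorChart J c).target) (X : E') :
    (mfderiv 𝓘(ℝ, E') J ((interiorChart J c).symm ∘ f) x X : F) =
      mfderiv 𝓘(ℝ, F) J (extChartAt J c).symm (f x) (fderiv ℝ f x X) :=
  have hchart : MDifferentiableAt 𝓘(ℝ, F) J (extChartAt J c).symm (f x) :=
    ((contMDiffOn_interiorChart_symm J c).contMDiffAt
      ((interiorChart J c).open_target.mem_nhds hx)).mdifferentiableAt (by simp)
  congrArg (fun L : E' →L[ℝ] F => L X)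
    (hchart.hasMFDerivAt.comp x hf.hasFDerivAt.hasMFDerivAt).mfderiv

theorem extDerivOneForm_chart (α : ∀ q : N, TangentSpace J q →L[ℝ] ℝ) {c : N} {x : F}
    (hx : x ∈ (interiorChart J c).target)
    (hα : DifferentiableWithinAt ℝ (oneFormInChart J α ((extChartAt J c).symm x)) (range J)
      (extChartAt J ((extChartAt J c).symm x) ((extChartAt J c).symm x))) (X Y : F) :
    extDerivOneForm J α ((extChartAt J c).symm x)
        (mfderiv 𝓘(ℝ, F) J (extChartAt J c).symm x X)
        (mfderiv 𝓘(ℝ, F) J (extChartAt J c).symm x Y) =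
      dForm (oneFormInChart J α c) x X Y := by
  have hsm := (contMDiffOn_interiorChart_symm J c).contMDiffAt
    ((interiorChart J c).open_target.mem_nhds hx)
  have hev : pullbackOneForm α (extChartAt J c).symm =ᶠ[𝓝 x] oneFormInChart J α c := by
    filter_upwards [(interiorChart J c).open_target.mem_nhds hx] with y hy
    exact pullbackOneForm_extChartAt_symm J α hy
  have h := extDerivOneForm_pullback α hsm hα X Y
  rw [dForm, ← hev.fderiv_eq]
  exact h

end InteriorChart

section Cotangent

variable {E : Type*} [NormedAddCommGroup E] [NormedSpace ℝ E]
  {H : Type*} [TopologicalSpace H] {I : ModelWithCorners ℝ E H}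
  {M : Type*} [TopologicalSpace M] [ChartedSpace H M] [IsManifold I ∞ M]

theorem cotangent_trivializationAt_apply {c : M} (ζ : CotangentBundle I M)
    (hζ : ζ.1 ∈ (chartAt H c).source) :
    (trivializationAt (E →L[ℝ] ℝ) (fun q : M => TangentSpace I q →L[ℝ] Trivial M ℝ q) c ζ).2 =
      (ζ.2 : TangentSpace I ζ.1 →L[ℝ] ℝ).comp
        (mfderivWithin 𝓘(ℝ, E) I (extChartAt I c).symm (range I) (extChartAt I c ζ.1)) := by
  have : IsManifold I 1 M := IsManifold.of_le (n := ∞) (by simp)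
  rw [← TangentBundle.symmL_trivializationAt hζ]
  ext X
  change (Trivial.trivialization M ℝ).continuousLinearMapAt ℝ ζ.1 _ = _
  rw [Trivial.continuousLinearMapAt_trivialization]
  rfl

theorem cotangent_baseSet (c : M) :
    (trivializationAt (E →L[ℝ] ℝ) (fun q : M => TangentSpace I q →L[ℝ] Trivial M ℝ q) c).baseSet =
      (chartAt H c).source := by
  rw [hom_trivializationAt_baseSet]
  simp

theorem oneFormInChart_eq_trivializationAt (A : ∀ q : M, TangentSpace I q →L[ℝ] Trivial M ℝ q)
    {c : M} {x : E} (hx : x ∈ (extChartAt I c).target) :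
    oneFormInChart I A c x = (trivializationAt (E →L[ℝ] ℝ)
      (fun q : M => TangentSpace I q →L[ℝ] Trivial M ℝ q) c
        ⟨(extChartAt I c).symm x, A ((extChartAt I c).symm x)⟩).2 := by
  rw [cotangent_trivializationAt_apply _ (extChartAt_symm_mem_chartAt_source hx)]
  change _ = ContinuousLinearMap.comp _ (mfderivWithin 𝓘(ℝ, E) I (extChartAt I c).symm (range I)
    (extChartAt I c ((extChartAt I c).symm x)))
  rw [(extChartAt I c).right_inv hx]
  rfl

theorem contDiffOn_oneFormInChart (A : OneForm I M) (c : M) :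
    ContDiffOn ℝ ∞ (oneFormInChart I (fun q => A q) c) (extChartAt I c).target := by
  have hA := (Trivialization.contMDiffOn_section_iff (IB := I) (n := ∞) (s := fun q => A q)
    (trivializationAt (E →L[ℝ] ℝ) (fun q : M => TangentSpace I q →L[ℝ] Trivial M ℝ q) c)
    (Trivialization.open_baseSet _) le_rfl).mp A.contMDiff.contMDiffOn
  rw [cotangent_baseSet] at hA
  rw [← contMDiffOn_iff_contDiffOn]
  exact (hA.comp (contMDiffOn_extChartAt_symm c) fun x hx =>
    extChartAt_symm_mem_chartAt_source hx).congr fun x hx => oneFormInChart_eq_trivializationAt A hx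

theorem cotangent_extChartAt_target (ζ : CotangentBundle I M) :
    (extChartAt (I.prod 𝓘(ℝ, E →L[ℝ] ℝ)) ζ).target = (extChartAt I ζ.1).target ×ˢ univ := by
  rw [FiberBundle.extChartAt_target, cotangent_baseSet]
  congr 1
  exact inter_eq_left.mpr fun x hx => extChartAt_symm_mem_chartAt_source hx

theorem cotangent_extChartAt_symm_proj (ζ : CotangentBundle I M) {y : E × (E →L[ℝ] ℝ)}
    (hy : y.1 ∈ (extChartAt I ζ.1).target) :
    ((extChartAt (I.prod 𝓘(ℝ, E →L[ℝ] ℝ)) ζ).symm y).1 = (extChartAt I ζ.1).symm y.1 := by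
  rw [FiberBundle.extChartAt]
  refine Trivialization.proj_symm_apply' (trivializationAt (E →L[ℝ] ℝ)
    (fun q : M => TangentSpace I q →L[ℝ] Trivial M ℝ q) ζ.1) ?_
  rw [cotangent_baseSet]
  exact extChartAt_symm_mem_chartAt_source hy

theorem cotangent_extChartAt_symm_snd (ζ : CotangentBundle I M) {y : E × (E →L[ℝ] ℝ)}
    (hy : y.1 ∈ (extChartAt I ζ.1).target) (X : E) :
    (((extChartAt (I.prod 𝓘(ℝ, E →L[ℝ] ℝ)) ζ).symm y).2 : E →L[ℝ] ℝ)
      (mfderivWithin 𝓘(ℝ, E) I (extChartAt I ζ.1).symm (range I) y.1 X : E) = y.2 X := by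
  have hproj := cotangent_extChartAt_symm_proj ζ hy
  have hbase : extChartAt I ζ.1 ((extChartAt (I.prod 𝓘(ℝ, E →L[ℝ] ℝ)) ζ).symm y).1 = y.1 := by
    rw [hproj, (extChartAt I ζ.1).right_inv hy]
  have hright := (extChartAt (I.prod 𝓘(ℝ, E →L[ℝ] ℝ)) ζ).right_inv (x := y)
    (by rw [cotangent_extChartAt_target]; exact ⟨hy, mem_univ _⟩)
  rw [FiberBundle.extChartAt] at hright
  have hsnd : (trivializationAt (E →L[ℝ] ℝ) (fun q : M => TangentSpace I q →L[ℝ] Trivial M ℝ q)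
      ζ.1 ((extChartAt (I.prod 𝓘(ℝ, E →L[ℝ] ℝ)) ζ).symm y)).2 = y.2 := by
    rw [FiberBundle.extChartAt]
    exact congrArg Prod.snd hright
  rw [cotangent_trivializationAt_apply _ (hproj ▸ extChartAt_symm_mem_chartAt_source hy), hbase]
    at hsnd
  exact DFunLike.congr_fun hsnd X

theorem mfderiv_proj_mfderivWithin_extChartAt_symm (ζ : CotangentBundle I M)
    {y : E × (E →L[ℝ] ℝ)} (hy : y.1 ∈ (extChartAt I ζ.1).target) (X : E × (E →L[ℝ] ℝ)) :
    (mfderiv (I.prod 𝓘(ℝ, E →L[ℝ] ℝ)) I (fun ζ : CotangentBundle I M => ζ.1)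
      ((extChartAt (I.prod 𝓘(ℝ, E →L[ℝ] ℝ)) ζ).symm y)
      (mfderivWithin 𝓘(ℝ, E × (E →L[ℝ] ℝ)) (I.prod 𝓘(ℝ, E →L[ℝ] ℝ))
        (extChartAt (I.prod 𝓘(ℝ, E →L[ℝ] ℝ)) ζ).symm (range (I.prod 𝓘(ℝ, E →L[ℝ] ℝ))) y X) : E) =
    mfderivWithin 𝓘(ℝ, E) I (extChartAt I ζ.1).symm (range I) y.1 X.1 := by
  have : IsManifold I 1 M := IsManifold.of_le (n := ∞) (by simp)
  have : IsManifold (I.prod 𝓘(ℝ, E →L[ℝ] ℝ)) 1 (CotangentBundle I M) :=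
    IsManifold.of_le (n := ∞) (by simp)
  have hyt : y ∈ (extChartAt (I.prod 𝓘(ℝ, E →L[ℝ] ℝ)) ζ).target := by
    rw [cotangent_extChartAt_target]
    exact ⟨hy, mem_univ _⟩
  have hproj := (((contMDiff_proj (n := 1)
    (fun q : M => TangentSpace I q →L[ℝ] Trivial M ℝ q)).contMDiffAt
      (x := (extChartAt (I.prod 𝓘(ℝ, E →L[ℝ] ℝ)) ζ).symm y)).mdifferentiableAt
        (by simp)).hasMFDerivAt.comp_hasMFDerivWithinAt y
          (mdifferentiableWithinAt_extChartAt_symm hyt).hasMFDerivWithinAt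
  have hfst : HasMFDerivWithinAt 𝓘(ℝ, E × (E →L[ℝ] ℝ)) 𝓘(ℝ, E)
      (fun y : E × (E →L[ℝ] ℝ) => y.1) (range (I.prod 𝓘(ℝ, E →L[ℝ] ℝ))) y
      (ContinuousLinearMap.fst ℝ E (E →L[ℝ] ℝ)) :=
    (hasFDerivAt_fst (𝕜 := ℝ) (p := y)).hasMFDerivAt.hasMFDerivWithinAt
  have hchart := (mdifferentiableWithinAt_extChartAt_symm hy).hasMFDerivWithinAt.comp y hfst <| by
    rintro _ ⟨t, rfl⟩
    exact mem_range_self t.1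
  have heq : ((fun ζ : CotangentBundle I M => ζ.1) ∘
      (extChartAt (I.prod 𝓘(ℝ, E →L[ℝ] ℝ)) ζ).symm) =ᶠ[𝓝[range (I.prod 𝓘(ℝ, E →L[ℝ] ℝ))] y]
      ((extChartAt I ζ.1).symm ∘ fun y : E × (E →L[ℝ] ℝ) => y.1) := by
    filter_upwards [extChartAt_target_mem_nhdsWithin_of_mem hyt] with t ht
    rw [cotangent_extChartAt_target] at ht
    exact cotangent_extChartAt_symm_proj ζ ht.1
  have hunique :=
    (I.prod 𝓘(ℝ, E →L[ℝ] ℝ)).uniqueMDiffOn y (extChartAt_target_subset_range ζ hyt)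
  exact congrArg (fun L : E × (E →L[ℝ] ℝ) →L[ℝ] E => L X) <| hunique.eq hproj <|
    hchart.congr_of_eventuallyEq heq (cotangent_extChartAt_symm_proj ζ hy)

theorem oneFormInChart_liouvilleForm (ζ : CotangentBundle I M) {y : E × (E →L[ℝ] ℝ)}
    (hy : y.1 ∈ (extChartAt I ζ.1).target) :
    oneFormInChart (I.prod 𝓘(ℝ, E →L[ℝ] ℝ)) (liouvilleForm I M) ζ y = liouvilleCLM E y :=
  ContinuousLinearMap.ext fun X => by
    rw [liouvilleCLM_apply]
    exact (congrArg (fun v : E =>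
      (((extChartAt (I.prod 𝓘(ℝ, E →L[ℝ] ℝ)) ζ).symm y).2 : E →L[ℝ] ℝ) v)
        (mfderiv_proj_mfderivWithin_extChartAt_symm ζ hy X)).trans
      (cotangent_extChartAt_symm_snd ζ hy X.1)

theorem differentiableWithinAt_of_contDiffOn_chart {F G N : Type*} [NormedAddCommGroup F]
    [NormedSpace ℝ F] [TopologicalSpace G] {J : ModelWithCorners ℝ F G} [TopologicalSpace N]
    [ChartedSpace G N] {θ : F → F →L[ℝ] ℝ} {q : N}
    (h : ContDiffOn ℝ ∞ θ (extChartAt J q).target) :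
    DifferentiableWithinAt ℝ θ (range J) (extChartAt J q q) :=
  ((h _ (mem_extChartAt_target q)).differentiableWithinAt (by simp)).mono_of_mem_nhdsWithin
    (extChartAt_target_mem_nhdsWithin q)

theorem magneticForm_chart (A : OneForm I M) {c : M} {x : E}
    (hx : x ∈ (interiorChart I c).target) (X Y : E) :
    magneticForm A ((extChartAt I c).symm x) (mfderiv 𝓘(ℝ, E) I (extChartAt I c).symm x X)
        (mfderiv 𝓘(ℝ, E) I (extChartAt I c).symm x Y) =
      dForm (oneFormInChart I (fun q => A q) c) x X Y :=
  extDerivOneForm_chart I (fun q => A q) hx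
    (differentiableWithinAt_of_contDiffOn_chart (contDiffOn_oneFormInChart A _)) X Y

theorem contDiffOn_oneFormInChart_liouvilleForm (ζ : CotangentBundle I M) :
    ContDiffOn ℝ ∞ (oneFormInChart (I.prod 𝓘(ℝ, E →L[ℝ] ℝ)) (liouvilleForm I M) ζ)
      (extChartAt (I.prod 𝓘(ℝ, E →L[ℝ] ℝ)) ζ).target := by
  refine (liouvilleCLM E).contDiff.contDiffOn.congr fun y hy => ?_
  rw [cotangent_extChartAt_target] at hy
  exact oneFormInChart_liouvilleForm ζ hy.1

theorem canonicalForm_chart (ζ : CotangentBundle I M) {y : E × (E →L[ℝ] ℝ)}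
    (hy : y ∈ (interiorChart (I.prod 𝓘(ℝ, E →L[ℝ] ℝ)) ζ).target) (X Y : E × (E →L[ℝ] ℝ)) :
    canonicalForm I M ((extChartAt (I.prod 𝓘(ℝ, E →L[ℝ] ℝ)) ζ).symm y)
        (mfderiv 𝓘(ℝ, E × (E →L[ℝ] ℝ)) (I.prod 𝓘(ℝ, E →L[ℝ] ℝ))
          (extChartAt (I.prod 𝓘(ℝ, E →L[ℝ] ℝ)) ζ).symm y X)
        (mfderiv 𝓘(ℝ, E × (E →L[ℝ] ℝ)) (I.prod 𝓘(ℝ, E →L[ℝ] ℝ))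
          (extChartAt (I.prod 𝓘(ℝ, E →L[ℝ] ℝ)) ζ).symm y Y) = X.2 Y.1 - Y.2 X.1 := by
  have hev : oneFormInChart (I.prod 𝓘(ℝ, E →L[ℝ] ℝ)) (liouvilleForm I M) ζ =ᶠ[𝓝 y]
      fun y => liouvilleCLM E y := by
    filter_upwards [(interiorChart (I.prod 𝓘(ℝ, E →L[ℝ] ℝ)) ζ).open_target.mem_nhds hy] with t ht
    have ht' := interior_subset ht
    rw [cotangent_extChartAt_target] at ht'
    exact oneFormInChart_liouvilleForm ζ ht'.1
  rw [← dForm_liouvilleCLM, dForm, ← hev.fderiv_eq]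
  exact extDerivOneForm_chart (I.prod 𝓘(ℝ, E →L[ℝ] ℝ)) (liouvilleForm I M) hy
    (differentiableWithinAt_of_contDiffOn_chart (contDiffOn_oneFormInChart_liouvilleForm _)) X Y

end Cotangent

/-! ### The metric and the Hamiltonian in charts -/

section LinearAlgebra

variable {E : Type*} [NormedAddCommGroup E] [NormedSpace ℝ E]

theorem apply_inverse_pullback {γ γ' : E →L[ℝ] E →L[ℝ] ℝ} {T : E →L[ℝ] E}
    (hγ : γ.IsInvertible) (hγ' : γ'.IsInvertible) (hT : Function.Surjective T)
    (h : ∀ X Y, γ' X Y = γ (T X) (T Y)) {ℓ ℓ' : E →L[ℝ] ℝ} (hℓ : ∀ X, ℓ' X = ℓ (T X)) :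
    T (γ'.inverse ℓ') = γ.inverse ℓ := by
  symm
  rw [hγ.inverse_apply_eq]
  ext Y
  obtain ⟨X, rfl⟩ := hT Y
  rw [← h, hγ'.self_apply_inverse, hℓ]

theorem charpoly_eq_of_intertwining [FiniteDimensional ℝ E] {S S' T : E →L[ℝ] E}
    (hT : T.IsInvertible) (h : ∀ X, T (S' X) = S (T X)) :
    (S : E →ₗ[ℝ] E).charpoly = (S' : E →ₗ[ℝ] E).charpoly := by
  obtain ⟨e, rfl⟩ := hT
  rw [← e.toLinearEquiv.charpoly_conj (S' : E →ₗ[ℝ] E)]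
  congr 1
  ext X
  simpa using (h (e.symm X)).symm

end LinearAlgebra

section Metric

variable {E : Type*} [NormedAddCommGroup E] [NormedSpace ℝ E]
  {H : Type*} [TopologicalSpace H] {I : ModelWithCorners ℝ E H}
  {M : Type*} [TopologicalSpace M] [ChartedSpace H M] [IsManifold I ∞ M]

/-- The derivative of the inverse of the preferred chart at `c`. -/
def chartDeriv (I : ModelWithCorners ℝ E H) (c : M) (x : E) : E →L[ℝ] E :=
  mfderiv 𝓘(ℝ, E) I (extChartAt I c).symm x

/-- The coordinate expression of the metric in the preferred chart at `c`. -/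
def metricInChart (g : RiemannianMetric I M) (c : M) (x : E) : E →L[ℝ] E →L[ℝ] ℝ :=
  (ContinuousLinearMap.precomp ℝ (chartDeriv I c x)).comp
    ((g.inner ((extChartAt I c).symm x) : E →L[ℝ] E →L[ℝ] ℝ).comp (chartDeriv I c x))

theorem metricInChart_apply (g : RiemannianMetric I M) (c : M) (x X Y : E) :
    metricInChart g c x X Y = (g.inner ((extChartAt I c).symm x) : E →L[ℝ] E →L[ℝ] ℝ)
      (chartDeriv I c x X) (chartDeriv I c x Y) := rfl

variable {c : M} {x : E}

theorem isInvertible_chartDeriv (hx : x ∈ (interiorChart I c).target) :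
    (chartDeriv I c x).IsInvertible := by
  have : IsManifold I 1 M := IsManifold.of_le (n := ∞) (by simp)
  have h := isInvertible_mfderivWithin_extChartAt_symm (I := I) (interior_subset hx)
  rw [mfderivWithin_extChartAt_symm_eq I hx] at h
  exact h

theorem metricInChart_symm (g : RiemannianMetric I M) (c : M) (x X Y : E) :
    metricInChart g c x X Y = metricInChart g c x Y X :=
  g.symm ((extChartAt I c).symm x) (chartDeriv I c x X) (chartDeriv I c x Y)

theorem metricInChart_pos (g : RiemannianMetric I M) (hx : x ∈ (interiorChart I c).target) {X : E}
    (hX : X ≠ 0) : 0 < metricInChart g c x X X :=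
  g.pos ((extChartAt I c).symm x) (chartDeriv I c x X) fun h =>
    hX ((isInvertible_chartDeriv hx).injective (h.trans (map_zero _).symm))

theorem contMDiffOn_chartDeriv (c : M) (X : E) :
    ContMDiffOn 𝓘(ℝ, E) (I.prod 𝓘(ℝ, E)) ∞
      (fun x => TotalSpace.mk' E (E := fun q : M => TangentSpace I q) ((extChartAt I c).symm x)
        (mfderiv 𝓘(ℝ, E) I (extChartAt I c).symm x X)) (interiorChart I c).target := by
  have : IsManifold I 1 M := IsManifold.of_le (n := ∞) (by simp)
  have hmem : ∀ x ∈ (interiorChart I c).target, (extChartAt I c).symm x ∈ (chartAt H c).source :=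
    fun x hx => extChartAt_symm_mem_chartAt_source (interior_subset hx)
  rw [Trivialization.contMDiffOn_iff (e := trivializationAt E (fun q : M => TangentSpace I q) c)
    fun x hx => by
      rw [Trivialization.mem_source]
      exact hmem x hx]
  refine ⟨contMDiffOn_interiorChart_symm I c, (contMDiffOn_const (c := X)).congr fun x hx => ?_⟩
  have hcomp := mfderiv_extChartAt_comp_mfderivWithin_extChartAt_symm (I := I) (interior_subset hx)
  rw [mfderivWithin_extChartAt_symm_eq I hx,
    ← TangentBundle.continuousLinearMapAt_trivializationAt (I := I) (hmem x hx)] at hcomp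
  exact (Trivialization.continuousLinearMapAt_apply_of_mem ℝ _ (hmem x hx) _).symm.trans
    (congrArg (fun L : E →L[ℝ] E => L X) hcomp)

theorem cotangent_extChartAt_symm_eq (ζ : CotangentBundle I M) {y : E × (E →L[ℝ] ℝ)}
    (hy : y.1 ∈ (interiorChart I ζ.1).target) :
    (extChartAt (I.prod 𝓘(ℝ, E →L[ℝ] ℝ)) ζ).symm y =
      ⟨(extChartAt I ζ.1).symm y.1, y.2.comp (chartDeriv I ζ.1 y.1).inverse⟩ := by
  have hproj := cotangent_extChartAt_symm_proj ζ (interior_subset hy)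
  have hsnd := cotangent_extChartAt_symm_snd ζ (interior_subset hy)
  rw [mfderivWithin_extChartAt_symm_eq I hy] at hsnd
  generalize (extChartAt (I.prod 𝓘(ℝ, E →L[ℝ] ℝ)) ζ).symm y = ζ' at hproj hsnd
  obtain ⟨q, p⟩ := ζ'
  obtain rfl : q = _ := hproj
  congr 1
  ext Y
  obtain ⟨X, rfl⟩ := (isInvertible_chartDeriv hy).surjective Y
  exact (hsnd X).trans (congrArg y.2 ((isInvertible_chartDeriv hy).inverse_apply_self X).symm)

theorem oneFormInChart_apply (A : OneForm I M) (hx : x ∈ (interiorChart I c).target) (X : E) :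
    oneFormInChart I (fun q => A q) c x X =
      (A ((extChartAt I c).symm x) : E →L[ℝ] ℝ) (chartDeriv I c x X) :=
  DFunLike.congr_fun (pullbackOneForm_extChartAt_symm I (fun q => A q) hx).symm X

theorem cotangent_extChartAt_symm_oneForm (A : OneForm I M) (ζ : CotangentBundle I M)
    (hx : x ∈ (interiorChart I ζ.1).target) :
    (extChartAt (I.prod 𝓘(ℝ, E →L[ℝ] ℝ)) ζ).symm (x, oneFormInChart I (fun q => A q) ζ.1 x) =
      ⟨(extChartAt I ζ.1).symm x, A ((extChartAt I ζ.1).symm x)⟩ := by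
  rw [cotangent_extChartAt_symm_eq ζ hx]
  congr 1
  ext Y
  obtain ⟨X, rfl⟩ := (isInvertible_chartDeriv hx).surjective Y
  exact (congrArg _ ((isInvertible_chartDeriv hx).inverse_apply_self X)).trans
    (oneFormInChart_apply A hx X)

variable [FiniteDimensional ℝ E]

theorem isInvertible_metricInChart (g : RiemannianMetric I M)
    (hx : x ∈ (interiorChart I c).target) : (metricInChart g c x).IsInvertible :=
  isInvertible_of_pos fun _ hX => metricInChart_pos g hx hX

theorem contDiffOn_metricInChart (g : RiemannianMetric I M) (c : M) :
    ContDiffOn ℝ ∞ (metricInChart g c) (interiorChart I c).target := by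
  refine contDiffOn_clm_apply.2 fun X => contDiffOn_clm_apply.2 fun Y =>
    contMDiffOn_iff_contDiffOn.1 fun x hx => ?_
  have hmetric : ContMDiffWithinAt 𝓘(ℝ, E) (I.prod 𝓘(ℝ)) ∞
      (fun x => TotalSpace.mk' ℝ (E := Bundle.Trivial M ℝ) ((extChartAt I c).symm x)
        (g.inner ((extChartAt I c).symm x) (mfderiv 𝓘(ℝ, E) I (extChartAt I c).symm x X)
          (mfderiv 𝓘(ℝ, E) I (extChartAt I c).symm x Y))) (interiorChart I c).target x := by
    apply ContMDiffWithinAt.clm_bundle_apply₂ (F₁ := E) (F₂ := E)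
    · exact ContMDiffAt.comp_contMDiffWithinAt x g.contMDiff.contMDiffAt
        (contMDiffOn_interiorChart_symm I c x hx)
    · exact contMDiffOn_chartDeriv c X x hx
    · exact contMDiffOn_chartDeriv c Y x hx
  exact (contMDiffWithinAt_totalSpace.1 hmetric).2

variable (g : RiemannianMetric I M) (A : OneForm I M)

theorem chartDeriv_inverse_metricInChart (hx : x ∈ (interiorChart I c).target)
    {ℓ ℓ' : E →L[ℝ] ℝ} (hℓ : ∀ X, ℓ' X = ℓ (chartDeriv I c x X)) :
    chartDeriv I c x ((metricInChart g c x).inverse ℓ') =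
      (sharp g ((extChartAt I c).symm x) : (E →L[ℝ] ℝ) →L[ℝ] E) ℓ :=
  apply_inverse_pullback (E := E) (γ := g.inner ((extChartAt I c).symm x))
    (isInvertible_inner g ((extChartAt I c).symm x))
    (isInvertible_metricInChart g hx) (isInvertible_chartDeriv hx).surjective
    (metricInChart_apply g c x) hℓ

/-- The coordinate expression of the magnetic operator. -/
def operatorInChart (c : M) (x : E) : E →L[ℝ] E :=
  formOperator (metricInChart g c x) (dForm (oneFormInChart I (fun q => A q) c) x)

theorem chartDeriv_operatorInChart (hx : x ∈ (interiorChart I c).target) (X : E) :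
    chartDeriv I c x (operatorInChart g A c x X) =
      (magneticOperator g A ((extChartAt I c).symm x) : E →L[ℝ] E) (chartDeriv I c x X) :=
  chartDeriv_inverse_metricInChart g hx
    (ℓ := (magneticForm A ((extChartAt I c).symm x) : E →L[ℝ] E →L[ℝ] ℝ) (chartDeriv I c x X))
    fun Y => (magneticForm_chart A hx X Y).symm

theorem magneticEigenvalues_chart (hx : x ∈ (interiorChart I c).target) :
    magneticEigenvalues g A ((extChartAt I c).symm x) =
      ((operatorInChart g A c x : E →ₗ[ℝ] E).charpoly.map (algebraMap ℝ ℂ)).roots := by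
  rw [← charpoly_eq_of_intertwining (isInvertible_chartDeriv hx)
    (chartDeriv_operatorInChart g A hx)]
  rfl

theorem injective_operatorInChart (hx : x ∈ (interiorChart I c).target)
    (h : Function.Injective (magneticOperator g A ((extChartAt I c).symm x))) :
    Function.Injective (operatorInChart g A c x) := by
  intro X Y hXY
  refine (isInvertible_chartDeriv hx).injective (h ?_)
  exact (chartDeriv_operatorInChart g A hx X).symm.trans
    ((congrArg _ hXY).trans (chartDeriv_operatorInChart g A hx Y))

theorem dualNormSq_eq (q : M) (p : TangentSpace I q →L[ℝ] ℝ) :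
    dualNormSq g q p = p (sharp g q p) := by
  rw [dualNormSq, inner_sharp]

theorem hamiltonian_chart (ζ : CotangentBundle I M) {y : E × (E →L[ℝ] ℝ)}
    (hy : y.1 ∈ (interiorChart I ζ.1).target) :
    hamiltonian g A ((extChartAt (I.prod 𝓘(ℝ, E →L[ℝ] ℝ)) ζ).symm y) =
      (y.2 - oneFormInChart I (fun q => A q) ζ.1 y.1)
        ((metricInChart g ζ.1 y.1).inverse (y.2 - oneFormInChart I (fun q => A q) ζ.1 y.1)) := by
  let p : E →L[ℝ] ℝ := y.2.comp (chartDeriv I ζ.1 y.1).inverse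
  let a : E →L[ℝ] ℝ := A ((extChartAt I ζ.1).symm y.1)
  have hcov : ∀ X, (y.2 - oneFormInChart I (fun q => A q) ζ.1 y.1) X =
      (p - a) (chartDeriv I ζ.1 y.1 X) := fun X => by
    rw [sub_apply, oneFormInChart_apply A hy, sub_apply, ContinuousLinearMap.comp_apply,
      (isInvertible_chartDeriv hy).inverse_apply_self]
    rfl
  rw [cotangent_extChartAt_symm_eq ζ hy, hamiltonian, dualNormSq_eq, hcov,
    chartDeriv_inverse_metricInChart g hy hcov]
  rfl

end Metric

/-! ### Transfer of the normal form to the manifold -/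

section Symplectomorphisms

variable {E E' F F' : Type*} [NormedAddCommGroup E] [NormedSpace ℝ E] [NormedAddCommGroup E']
  [NormedSpace ℝ E'] [NormedAddCommGroup F] [NormedSpace ℝ F] [NormedAddCommGroup F']
  [NormedSpace ℝ F']
  {H : Type*} [TopologicalSpace H] {I : ModelWithCorners ℝ E H}
  {G : Type*} [TopologicalSpace G] {J : ModelWithCorners ℝ F G}
  {M : Type*} [TopologicalSpace M] [ChartedSpace H M]
  {N : Type*} [TopologicalSpace N] [ChartedSpace G N]
  {σ : ∀ x : M, TangentSpace I x → TangentSpace I x → ℝ}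
  {τ : ∀ y : N, TangentSpace J y → TangentSpace J y → ℝ}

namespace IsSymplectomorphism

variable {f : OpenPartialHomeomorph M N}

theorem restrOpen (h : IsSymplectomorphism I J f σ τ) {S : Set M} (hS : IsOpen S) :
    IsSymplectomorphism I J (f.restrOpen S hS) σ τ where
  contMDiffOn := h.contMDiffOn.mono inter_subset_left
  contMDiffOn_symm := h.contMDiffOn_symm.mono inter_subset_left
  pullsBackOn x hx := h.pullsBackOn x hx.1

theorem symm [IsManifold I ∞ M] [IsManifold J ∞ N] (h : IsSymplectomorphism I J f σ τ) :
    IsSymplectomorphism J I f.symm τ σ where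
  contMDiffOn := h.contMDiffOn_symm
  contMDiffOn_symm := h.contMDiffOn
  pullsBackOn y hy X Y := by
    have : IsManifold I 1 M := IsManifold.of_le (n := ∞) (by simp)
    have : IsManifold J 1 N := IsManifold.of_le (n := ∞) (by simp)
    have hf : f.MDifferentiable I J :=
      ⟨h.contMDiffOn.mdifferentiableOn (by simp), h.contMDiffOn_symm.mdifferentiableOn (by simp)⟩
    obtain ⟨x, hx, rfl⟩ : ∃ x ∈ f.source, f x = y :=
      ⟨f.symm y, f.map_target hy, f.right_inv hy⟩
    obtain ⟨X, rfl⟩ := hf.mfderiv_surjective hx X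
    obtain ⟨Y, rfl⟩ := hf.mfderiv_surjective hx Y
    have hleft : ∀ Z : TangentSpace I x, mfderiv J I f.symm (f x) (mfderiv I J f x Z) = Z :=
      fun Z => congrArg (fun L : E →L[ℝ] E => L Z) (hf.symm_comp_deriv hx)
    have hbase : ∀ x', x' = x → ∀ Z W : E, σ x' Z W = σ x Z W := by
      rintro _ rfl _ _
      rfl
    exact (hbase _ (f.left_inv hx) _ _).trans
      ((congrArg₂ (σ x) (hleft X) (hleft Y)).trans (h.pullsBackOn x hx X Y).symm)

end IsSymplectomorphism

theorem isSymplectomorphism_trans_interiorChart_symm [IsManifold J ∞ N] {c : N}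
    {Φ : OpenPartialHomeomorph F' F} {σ : F' → F' → ℝ} (hΦ : ContDiffOn ℝ ∞ Φ Φ.source)
    (hΦ' : ContDiffOn ℝ ∞ Φ.symm Φ.target)
    (hform : ∀ p ∈ Φ.source, Φ p ∈ (interiorChart J c).target → ∀ X Y,
      τ ((extChartAt J c).symm (Φ p))
        (mfderiv 𝓘(ℝ, F) J (extChartAt J c).symm (Φ p) (fderiv ℝ Φ p X))
        (mfderiv 𝓘(ℝ, F) J (extChartAt J c).symm (Φ p) (fderiv ℝ Φ p Y)) = σ X Y) :
    IsSymplectomorphism 𝓘(ℝ, F') J (Φ.trans (interiorChart J c).symm) (fun _ => σ) τ where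
  contMDiffOn := (contMDiffOn_interiorChart_symm J c).comp
    (hΦ.contMDiffOn.mono fun _ hp => hp.1) fun _ hp => hp.2
  contMDiffOn_symm := hΦ'.contMDiffOn.comp
    ((contMDiffOn_interiorChart J c).mono fun _ hq => hq.1) fun _ hq => hq.2
  pullsBackOn p hp X Y := by
    have hd : DifferentiableAt ℝ Φ p :=
      (hΦ.contDiffAt (Φ.open_source.mem_nhds hp.1)).differentiableAt (by simp)
    exact (congrArg₂ (τ ((extChartAt J c).symm (Φ p))) (mfderiv_interiorChart_symm_comp J hd hp.2 X)
      (mfderiv_interiorChart_symm_comp J hd hp.2 Y)).trans (hform p hp.1 hp.2 X Y)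

end Symplectomorphisms

section NormalForm

variable {E : Type*} [NormedAddCommGroup E] [NormedSpace ℝ E]
  {H : Type*} [TopologicalSpace H] {I : ModelWithCorners ℝ E H}
  {M : Type*} [TopologicalSpace M] [ChartedSpace H M] [IsManifold I ∞ M]

theorem interiorChart_symm_mem_interior {c : M} {x : E} (hx : x ∈ (interiorChart I c).target) :
    (extChartAt I c).symm x ∈ I.interior M := by
  refine (I.isInteriorPoint_iff_of_mem_atlas (n := ∞) (by simp) (chart_mem_atlas H c)
    (extChartAt_symm_mem_chartAt_source (interior_subset hx))).mpr ?_
  change extChartAt I c ((extChartAt I c).symm x) ∈ interior (extChartAt I c).target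
  rwa [(extChartAt I c).right_inv (interior_subset hx)]

theorem isCompact_closure_and_subset_interior_of_chart [T2Space M] {c : M} {K : Set E}
    (hK : IsCompact K) (hKc : K ⊆ (interiorChart I c).target) {S : Set M}
    (hS : S ⊆ (extChartAt I c).source) (hSK : MapsTo (extChartAt I c) S K) :
    IsCompact (closure S) ∧ closure S ⊆ I.interior M := by
  have himage : IsCompact ((extChartAt I c).symm '' K) := hK.image_of_continuousOn
    ((continuousOn_extChartAt_symm c).mono (hKc.trans interior_subset))
  have hclosure : closure S ⊆ (extChartAt I c).symm '' K := closure_minimal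
    (fun q hq => ⟨extChartAt I c q, hSK hq, (extChartAt I c).left_inv (hS hq)⟩) himage.isClosed
  refine ⟨himage.of_isClosed_subset isClosed_closure hclosure, hclosure.trans ?_⟩
  rintro _ ⟨x, hx, rfl⟩
  exact interiorChart_symm_mem_interior (hKc hx)

theorem mem_cotangent_interiorChart_target (ζ : CotangentBundle I M) {y : E × (E →L[ℝ] ℝ)}
    (hy : y.1 ∈ (interiorChart I ζ.1).target) :
    y ∈ (interiorChart (I.prod 𝓘(ℝ, E →L[ℝ] ℝ)) ζ).target := by
  rw [interiorChart_target, cotangent_extChartAt_target, interior_prod_eq, interior_univ]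
  exact ⟨hy, mem_univ _⟩

variable {n : ℕ} {g : RiemannianMetric I M} {A : OneForm I M}
  {ζ : CotangentBundle I M} {β : Fin n → E → ℝ} {χ : OpenPartialHomeomorph E (PhaseSpace n)}
  {Φ : OpenPartialHomeomorph (PhaseSpace n × PhaseSpace n) (E × (E →L[ℝ] ℝ))} {ε C : ℝ}

namespace IsMagneticNormalForm

variable (h : IsMagneticNormalForm (metricInChart g ζ.1) (oneFormInChart I (fun q => A q) ζ.1)
  β χ Φ ε C)
include h

theorem isSymplectomorphism :
    IsSymplectomorphism 𝓘(ℝ, PhaseSpace n × PhaseSpace n) (I.prod 𝓘(ℝ, E →L[ℝ] ℝ))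
      (Φ.trans (interiorChart (I.prod 𝓘(ℝ, E →L[ℝ] ℝ)) ζ).symm)
      (fun _ => prodForm n) (canonicalForm I M) :=
  isSymplectomorphism_trans_interiorChart_symm h.contDiffOn h.contDiffOn_symm
    fun p hp hpc X Y => (canonicalForm_chart ζ hpc _ _).trans (h.symplectic p hp X Y)

theorem prod_subset_source_trans (hΦ : ∀ q ∈ Φ.target, q.1 ∈ (interiorChart I ζ.1).target) :
    ((interiorChart I ζ.1).trans χ).target ×ˢ Metric.closedBall 0 ε ⊆
      (Φ.trans (interiorChart (I.prod 𝓘(ℝ, E →L[ℝ] ℝ)) ζ).symm).source := fun _ hp =>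
  have hpΦ := h.prod_subset_source ⟨hp.1.1, hp.2⟩
  ⟨hpΦ, mem_cotangent_interiorChart_target ζ (hΦ _ (Φ.map_source hpΦ))⟩

theorem trans_apply_zero {q : M} (hq : q ∈ ((interiorChart I ζ.1).trans χ).source) :
    Φ.trans (interiorChart (I.prod 𝓘(ℝ, E →L[ℝ] ℝ)) ζ).symm
      ((interiorChart I ζ.1).trans χ q, 0) = ⟨q, A q⟩ := by
  have hgraph : Φ (χ (extChartAt I ζ.1 q), 0) =
    (extChartAt I ζ.1 q, oneFormInChart I (fun q => A q) ζ.1 (extChartAt I ζ.1 q)) :=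
    h.apply_zero _ hq.2
  change (extChartAt (I.prod 𝓘(ℝ, E →L[ℝ] ℝ)) ζ).symm (Φ (χ (extChartAt I ζ.1 q), 0)) = _
  rw [hgraph, cotangent_extChartAt_symm_oneForm A ζ hq.1.2,
    (extChartAt I ζ.1).left_inv hq.1.1]

theorem isSymplectomorphism_base :
    IsSymplectomorphism I 𝓘(ℝ, PhaseSpace n) ((interiorChart I ζ.1).trans χ)
      (fun q X Y => magneticForm A q X Y) (fun _ => stdForm n) := by
  refine IsSymplectomorphism.symm (f := χ.symm.trans (interiorChart I ζ.1).symm)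
    (isSymplectomorphism_trans_interiorChart_symm h.contDiffOn_base_symm h.contDiffOn_base
      fun w hw hwc X Y => ?_)
  rw [magneticForm_chart A hwc, h.symplectic_base w hw]

variable [FiniteDimensional ℝ E]

theorem abs_hamiltonian_sub_le (hΦ : ∀ q ∈ Φ.target, q.1 ∈ (interiorChart I ζ.1).target)
    {w : PhaseSpace n} (hw : w ∈ ((interiorChart I ζ.1).trans χ).target) {z : PhaseSpace n}
    (hz : ‖z‖ ≤ ε) :
    |hamiltonian g A (Φ.trans (interiorChart (I.prod 𝓘(ℝ, E →L[ℝ] ℝ)) ζ).symm (w, z)) -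
      ∑ j, β j (extChartAt I ζ.1 (((interiorChart I ζ.1).trans χ).symm w)) * normSqAt z j| ≤
      C * ‖z‖ ^ 3 := by
  have hwz : (w, z) ∈ Φ.source := h.prod_subset_source ⟨hw.1, mem_closedBall_zero_iff.2 hz⟩
  have hbase : extChartAt I ζ.1 (((interiorChart I ζ.1).trans χ).symm w) = χ.symm w :=
    (interiorChart I ζ.1).right_inv hw.2
  rw [hbase]
  exact (congrArg (fun t => |t - _|) (hamiltonian_chart g A ζ (hΦ _ (Φ.map_source hwz)))).trans_le
    (h.abs_sub_le w hw.1 z hz)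

end IsMagneticNormalForm

variable [FiniteDimensional ℝ E]

theorem exists_isMagneticNormalForm_interiorChart (hdim : Module.finrank ℝ E = 2 * n)
    (g : RiemannianMetric I M) (A : OneForm I M) {q₀ : M} (hq₀ : q₀ ∈ I.interior M)
    (hinv : Function.Injective (magneticOperator g A q₀))
    (hsimple : (magneticEigenvalues g A q₀).Nodup) :
    ∃ (K : Set E) (β : Fin n → E → ℝ) (χ : OpenPartialHomeomorph E (PhaseSpace n))
      (Φ : OpenPartialHomeomorph (PhaseSpace n × PhaseSpace n) (E × (E →L[ℝ] ℝ))) (ε C : ℝ),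
      IsCompact K ∧ K ⊆ (interiorChart I q₀).target ∧
      q₀ ∈ ((interiorChart I q₀).trans χ).source ∧ χ.source ⊆ K ∧
      (∀ q ∈ Φ.target, q.1 ∈ (interiorChart I q₀).target) ∧ 0 < ε ∧
      (∀ j, ContMDiffOn I 𝓘(ℝ, ℝ) ∞ (fun q => β j (extChartAt I q₀ q))
        ((interiorChart I q₀).trans χ).source) ∧
      (∀ q ∈ ((interiorChart I q₀).trans χ).source, (∀ j, 0 < β j (extChartAt I q₀ q)) ∧
        (magneticEigenvalues g A q).Nodup ∧ magneticEigenvalues g A q =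
          ∑ j, {(β j (extChartAt I q₀ q) : ℂ) * Complex.I,
            -((β j (extChartAt I q₀ q) : ℂ) * Complex.I)}) ∧
      IsMagneticNormalForm (metricInChart g q₀) (oneFormInChart I (fun q => A q) q₀)
        β χ Φ ε C := by
  have hx₀ : extChartAt I q₀ q₀ ∈ (interiorChart I q₀).target := I.isInteriorPoint_iff.mp hq₀
  have hleft : ∀ q ∈ (interiorChart I q₀).source, (extChartAt I q₀).symm (extChartAt I q₀ q) = q :=
    fun q hq => (extChartAt I q₀).left_inv hq.1
  have hq₀c : q₀ ∈ (interiorChart I q₀).source := ⟨mem_extChartAt_source q₀, hx₀⟩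
  obtain ⟨r, hr, hball⟩ := Metric.nhds_basis_closedBall.mem_iff.mp
    ((interiorChart I q₀).open_target.mem_nhds hx₀)
  have hball' := Metric.ball_subset_closedBall.trans hball
  have hroots := magneticEigenvalues_chart g A hx₀
  rw [hleft q₀ hq₀c] at hroots
  obtain ⟨β, χ, Φ, ε, C, hx₀χ, hχ, hΦ, hε, hβ, heig, h⟩ := exists_isMagneticNormalForm hdim
    Metric.isOpen_ball (Metric.mem_ball_self hr)
    ((contDiffOn_oneFormInChart A q₀).mono (hball'.trans interior_subset))
    ((contDiffOn_metricInChart g q₀).mono hball') (fun x _ => metricInChart_symm g q₀ x)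
    (fun x hx X hX => metricInChart_pos g (hball' hx) hX)
    (injective_operatorInChart g A hx₀ (by rwa [hleft q₀ hq₀c])) (hroots ▸ hsimple)
  refine ⟨Metric.closedBall (extChartAt I q₀ q₀) r, β, χ, Φ, ε, C, isCompact_closedBall _ _, hball,
    ⟨hq₀c, hx₀χ⟩, hχ.trans Metric.ball_subset_closedBall, fun q hq => hball' (hΦ q hq), hε,
    fun j => ?_, fun q hq => ?_, h⟩
  · exact (hβ j).contMDiffOn.comp ((contMDiffOn_interiorChart I q₀).mono fun _ hq => hq.1)
      fun _ hq => hq.2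
  · have hrootsq := magneticEigenvalues_chart g A hq.1.2
    rw [hleft q hq.1] at hrootsq
    rw [hrootsq]
    exact heig _ hq.2

end NormalForm

end MagneticWell

end

open MagneticWell in
theorem theorem1p1
    {E : Type*} [NormedAddCommGroup E] [NormedSpace ℝ E] [FiniteDimensional ℝ E]
    {H : Type*} [TopologicalSpace H] (I : ModelWithCorners ℝ E H)
    {M : Type*} [TopologicalSpace M] [T2Space M] [ChartedSpace H M] [IsManifold I ∞ M]
    (n : ℕ) (hdim : Module.finrank ℝ E = 2 * n)
    (g : RiemannianMetric I M) (A : OneForm I M)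
    (q₀ : M) (hq₀ : q₀ ∈ I.interior M)
    (hinv : Function.Bijective (magneticOperator g A q₀))
    (hsimple : (magneticEigenvalues g A q₀).Nodup) :
    ∃ (Ω₀ : Set M) (β : Fin n → M → ℝ) (ε₀ : ℝ),
      IsOpen Ω₀ ∧ q₀ ∈ Ω₀ ∧ IsCompact (closure Ω₀) ∧ closure Ω₀ ⊆ I.interior M ∧ 0 < ε₀ ∧
      -- on `Ω₀` the eigenvalues of `𝐁(q)` are simple, equal to `± i β_j(q)`, with `β_j` smooth
      (∀ j, ContMDiffOn I 𝓘(ℝ, ℝ) ∞ (β j) Ω₀) ∧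
      (∀ q ∈ Ω₀, (∀ j, 0 < β j q) ∧ (magneticEigenvalues g A q).Nodup ∧
        magneticEigenvalues g A q =
          ∑ j, {(β j q : ℂ) * Complex.I, -((β j q : ℂ) * Complex.I)}) ∧
      ∀ Ω : Set M, IsOpen Ω → q₀ ∈ Ω → Ω ⊆ Ω₀ → ∀ ε : ℝ, 0 < ε → ε ≤ ε₀ →
        ∃ (φ : OpenPartialHomeomorph M (PhaseSpace n))
          (Φ : OpenPartialHomeomorph (PhaseSpace n × PhaseSpace n) (CotangentBundle I M)),
          -- `φ : (Ω, B) → (V, dη ∧ dy)`, with `V = φ.target`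
          φ.source = Ω ∧
          IsSymplectomorphism I 𝓘(ℝ, PhaseSpace n) φ
            (fun q X Y => magneticForm A q X Y) (fun _ => stdForm n) ∧
          -- `Φ` is a symplectomorphism on an open neighbourhood of `V × {|z| ≤ ε}`
          φ.target ×ˢ Metric.closedBall 0 ε ⊆ Φ.source ∧
          IsSymplectomorphism 𝓘(ℝ, PhaseSpace n × PhaseSpace n) (I.prod 𝓘(ℝ, E →L[ℝ] ℝ)) Φ
            (fun _ => prodForm n) (canonicalForm I M) ∧
          (∀ q ∈ Ω, Φ (φ q, 0) = ⟨q, A q⟩) ∧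
          -- the expansion of the Hamiltonian, locally uniformly in `w`
          ∀ w₀ ∈ φ.target, ∃ C : ℝ, ∀ᶠ w in 𝓝 w₀, ∀ z : PhaseSpace n, ‖z‖ ≤ ε →
            |hamiltonian g A (Φ (w, z)) - ∑ j, β j (φ.symm w) * normSqAt z j|
              ≤ C * ‖z‖ ^ 3 := by
  let ζ₀ : CotangentBundle I M := ⟨q₀, A q₀⟩
  obtain ⟨K, β, χ, Φ, ε₀, C, hK, hKc, hq₀χ, hχK, hΦc, hε₀, hβ, heig, h⟩ :=
    exists_isMagneticNormalForm_interiorChart hdim g A (q₀ := ζ₀.1) hq₀ hinv.injective hsimple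
  have hcompact := isCompact_closure_and_subset_interior_of_chart hK hKc
    (S := ((interiorChart I q₀).trans χ).source) (fun _ hq => hq.1.1) fun _ hq => hχK hq.2
  refine ⟨((interiorChart I q₀).trans χ).source, fun j q => β j (extChartAt I q₀ q), ε₀,
    ((interiorChart I q₀).trans χ).open_source, hq₀χ, hcompact.1, hcompact.2, hε₀, hβ, heig,
    fun Ω hΩ _ hΩΩ₀ ε _ hε => ⟨((interiorChart I q₀).trans χ).restrOpen Ω hΩ,
      Φ.trans (interiorChart (I.prod 𝓘(ℝ, E →L[ℝ] ℝ)) ζ₀).symm, inter_eq_right.2 hΩΩ₀,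
      h.isSymplectomorphism_base.restrOpen hΩ, fun p hp => ?_, h.isSymplectomorphism,
      fun q hq => h.trans_apply_zero (hΩΩ₀ hq), fun w₀ hw₀ => ⟨C, ?_⟩⟩⟩
  · exact h.prod_subset_source_trans hΦc ⟨hp.1.1, Metric.closedBall_subset_closedBall hε hp.2⟩
  · filter_upwards [(OpenPartialHomeomorph.open_target _).mem_nhds hw₀] with w hw z hz
    exact h.abs_hamiltonian_sub_le hΦc hw.1 (hz.trans hε)
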